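/- \textbf{Setting.} Let $E$ be a ring spectrum and $\mathrm{Syn}_E$ the stable category of synthetic spectra based on $E$, i.e. spherical sheaves of spectra on the site $\mathrm{Sp}_E^{fp}$ of finite $E$-projective spectra (those finite spectra $P$ with $E_*P$ projective over $E_*$; the coverings are the $E_*$-surjections). Bigraded suspension is $(\Sigma^{a,b}X)(P)=\Sigma^{-b}X(\Sigma^{-a-b}P)$, the categorical suspension is $\Sigma=\Sigma^{1,-1}$, and $\pi_{a,b}X=\pi_{-b}\bigl(X(S^{a+b})\bigr)$, so that $\pi_{a,b}(\Sigma^{c,d}X)=\pi_{a-c,b-d}X$. Let $\tau\colon\Sigma^{0,-1}X\to X$ be the comparison map $\Sigma X(\Sigma P)\to X(P)$, and let $X/\tau^n$ be the cofiber of $\tau^n\colon\Sigma^{0,-n}X\to X$, with reduction maps $X\to X/\tau^n$ and $X/\tau^{n+m}\to X/\tau^n$, maps $\tau^m\colon\Sigma^{0,-m}(X/\tau^n)\to X/\tau^{n+m}$, and connecting map $\delta\colon X/\tau^n\to\Sigma^{1,-n-1}X$. \textbf{Adams spectral sequence of $X$} (the $\tau$-Bockstein spectral sequence with a change of sign). Its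 $E_2$ page is $\pi_{*,*}(X/\tau)$ (we also put $E_1=E_2$), and $d_r$ for $r\ge 2$ goes from bidegree $(a,b)$ to $(a-1,b+r)$. A class $x\in\pi_{a,b}(X/\tau)$ survives to the $E_r$ page if $\delta x=\tau^{r-2}w$ for some $w\in\pi_{a-1,b+r}X$, and the elements $-(w \bmod \tau)\in\pi_{a-1,b+r}(X/\tau)$, for all such $w$, are the representatives of $d_r(x)$. We write $d_r(x)=0$ if $0$ is a representative. Two elements of $\pi_{*,*}(X/\tau)$ are equal on the $E_r$ page if they differ by the reduction of some $v\in\pi_{*,*}X$ with $\tau^{r-2}v=0$ (for $r\le 2$: if they are equal), i.e. by a sum of images of $d_2,\dots,d_{r-1}$. \textbf{Hidden extensions.} Let $\alpha\colon X\to Y$ be a map in $\mathrm{Syn}_E$, $x\in\pi_{a,b}(X/\tau)$, $y\in\pi_{a,b+s}(Y/\tau)$ and $0\le s<r-1$. There is a hidden $\alpha$-extension by $s$ from $x$ to $y$ on the $E_r$ page if $x$ survives to the $E_r$ page and there are lifts $\{x\}\in\pi_{a,b}(X/\tau^{r-1})$ of $x$ and $\{y\}\in\pi_{a,b+s}(Y/\tau^{r-1-s})$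 of $y$ with $\alpha\{x\}=\tau^s\{y\}$ in $\pi_{a,b}(Y/\tau^{r-1})$. \textbf{Theorem.} Let $X,Y\in\mathrm{Syn}_E$ be arbitrary, let $\alpha\colon X\to Y$ be a map, with cofiber sequence $$X\xrightarrow{\ \alpha\ }Y\xrightarrow{\ \iota_\alpha\ }C\alpha\xrightarrow{\ \delta_\alpha\ }\Sigma X,$$ and let $k\ge 1$ and $a,b\in\mathbb Z$. Let $x\in\pi_{a,b}(X/\tau)$ be such that $d_{k+1}(x)=0$. Let $\bar x\in\pi_{a+1,b-1}(C\alpha/\tau)$ be such that $\delta_\alpha\bar x=x$ under $\pi_{a+1,b-1}((\Sigma X)/\tau)\cong\pi_{a,b}(X/\tau)$, and let $y\in\pi_{a,b+k}(Y/\tau)$ be such that $\iota_\alpha y=d_{k+1}(\bar x)$ on the $E_k$ page, i.e. $\bar x$ survives to the $E_{k+1}$ page and $\iota_\alpha y$ is equal on the $E_k$ page to a representative of $d_{k+1}(\bar x)$. Then there is a hidden $\alpha$-extension by $k$ from $x$ to $y$ on the $E_{k+2}$ page. -/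

import Mathlib

open CategoryTheory Topology

universe u

noncomputable section

namespace Synth

/-! ## Pointed spaces -/

/-- A pointed topological space. -/
structure PtTop : Type (u + 1) where
  carrier : Type u
  [top : TopologicalSpace carrier]
  pt : carrier

attribute [instance] PtTop.top

instance : CoeSort PtTop.{u} (Type u) := ⟨PtTop.carrier⟩

/-- Pointed continuous maps. -/
@[ext]
structure PtTop.Hom (A B : PtTop.{u}) where
  toFun : A → B
  cont : Continuous toFun
  map_pt : toFun A.pt = B.pt

instance : Category PtTop.{u} where
  Hom := PtTop.Hom
  id A := ⟨id, continuous_id, rfl⟩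
  comp f g := ⟨g.toFun ∘ f.toFun, g.cont.comp f.cont, by simp [f.map_pt, g.map_pt]⟩

namespace PtTop

@[ext]
theorem hom_ext {A B : PtTop.{u}} {f g : A ⟶ B} (h : ∀ a, f.toFun a = g.toFun a) : f = g :=
  PtTop.Hom.ext (funext h)

@[simp] theorem id_toFun (A : PtTop.{u}) (a : A) : PtTop.Hom.toFun (𝟙 A) a = a := rfl

@[simp] theorem comp_toFun {A B C : PtTop.{u}} (f : A ⟶ B) (g : B ⟶ C) (a : A) :
    (f ≫ g).toFun a = g.toFun (f.toFun a) := rfl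

/-- The constant map at the base point. -/
def zero (A B : PtTop.{u}) : A ⟶ B := ⟨fun _ => B.pt, continuous_const, rfl⟩

/-- The two-point space `S⁰`, pointed at `false`. -/
def sphereZero : PtTop.{0} := ⟨Bool, false⟩

/-- The relation collapsing `({0, 1} × A) ∪ (I × {pt})` to a point. -/
inductive SuspRel (A : PtTop.{u}) : unitInterval × A → unitInterval × A → Prop
  | zero (a : A) : SuspRel A (0, a) (0, A.pt)
  | one (a : A) : SuspRel A (1, a) (0, A.pt)
  | base (t : unitInterval) : SuspRel A (t, A.pt) (0, A.pt)

/-- The reduced suspension `ΣA = S¹ ∧ A`. -/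
def susp (A : PtTop.{u}) : PtTop.{u} := ⟨Quot (SuspRel A), Quot.mk _ (0, A.pt)⟩

/-- The relation defining the reduced mapping cone of `f`: the reduced cone coordinate `t`
is `0` at the cone point, and `(1, a)` is glued to `f a`. -/
inductive ConeRel {A B : PtTop.{u}} (f : A ⟶ B) :
    (unitInterval × A) ⊕ B → (unitInterval × A) ⊕ B → Prop
  | zero (a : A) : ConeRel f (Sum.inl (0, a)) (Sum.inr B.pt)
  | base (t : unitInterval) : ConeRel f (Sum.inl (t, A.pt)) (Sum.inr B.pt)
  | one (a : A) : ConeRel f (Sum.inl (1, a)) (Sum.inr (f.toFun a))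

/-- The reduced mapping cone of a pointed map. -/
def cone {A B : PtTop.{u}} (f : A ⟶ B) : PtTop.{u} := ⟨Quot (ConeRel f), Quot.mk _ (Sum.inr B.pt)⟩

/-- The relation collapsing the wedge `A ∨ K ⊆ A × K` to a point. -/
inductive SmashRel (A K : PtTop.{u}) : A × K → A × K → Prop
  | left (k : K) : SmashRel A K (A.pt, k) (A.pt, K.pt)
  | right (a : A) : SmashRel A K (a, K.pt) (A.pt, K.pt)

/-- The smash product `A ∧ K`. -/
def smash (A K : PtTop.{u}) : PtTop.{u} := ⟨Quot (SmashRel A K), Quot.mk _ (A.pt, K.pt)⟩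

/-- The based loop space (compact-open topology). -/
def loops (A : PtTop.{u}) : PtTop.{u} := ⟨Path A.pt A.pt, Path.refl A.pt⟩

/-- The value of a loop at a time. -/
def eval {A : PtTop.{u}} (w : loops A) : unitInterval → A := Path.toContinuousMap w

/-- Functoriality of the reduced suspension. -/
def suspMap {A B : PtTop.{u}} (f : A ⟶ B) : susp A ⟶ susp B where
  toFun := Quot.lift (fun p => Quot.mk _ (p.1, f.toFun p.2)) (by
    rintro _ _ (a | a | t)
    · exact (Quot.sound (.zero _)).trans (by rw [f.map_pt])
    · exact (Quot.sound (.one _)).trans (by rw [f.map_pt])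
    · simp only [f.map_pt]; exact Quot.sound (.base _))
  cont := continuous_quot_lift _ (continuous_quot_mk.comp
    (continuous_fst.prodMk (f.cont.comp continuous_snd)))
  map_pt := by
    change Quot.mk _ (0, f.toFun A.pt) = Quot.mk _ (0, B.pt)
    rw [f.map_pt]

/-- Functoriality of `A ∧ K` in `K`. -/
def smashMap (A : PtTop.{u}) {K L : PtTop.{u}} (f : K ⟶ L) : smash A K ⟶ smash A L where
  toFun := Quot.lift (fun p => Quot.mk _ (p.1, f.toFun p.2)) (by
    rintro _ _ (k | a)
    · simp only [f.map_pt]; exact Quot.sound (.left _)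
    · simp only [f.map_pt]; exact Quot.sound (.right _))
  cont := continuous_quot_lift _ (continuous_quot_mk.comp
    (continuous_fst.prodMk (f.cont.comp continuous_snd)))
  map_pt := by
    change Quot.mk _ (A.pt, f.toFun K.pt) = Quot.mk _ (A.pt, L.pt)
    rw [f.map_pt]

/-- The inclusion of the target into the mapping cone. -/
def coneIncl {A B : PtTop.{u}} (f : A ⟶ B) : B ⟶ cone f where
  toFun b := Quot.mk _ (Sum.inr b)
  cont := continuous_quot_mk.comp continuous_inr
  map_pt := rfl

/-- Functoriality of loop spaces. -/
def loopsMap {A B : PtTop.{u}} (f : A ⟶ B) : loops A ⟶ loops B where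
  toFun w := (w.map f.cont).cast f.map_pt.symm f.map_pt.symm
  cont := by
    refine Path.continuous_uncurry_iff.mp ?_
    exact f.cont.comp (Path.continuous_uncurry_iff.mpr continuous_id)
  map_pt := by
    apply Path.ext; funext t
    exact f.map_pt

/-- Maps out of `T × ΣA` are continuous if they are so on `T × (I × A)`. -/
theorem continuous_of_susp {T Y : Type*} [TopologicalSpace T] [LocallyCompactSpace T]
    [TopologicalSpace Y] {A : PtTop.{u}} {g : T × susp A → Y}
    (h : Continuous fun p : T × (unitInterval × A) => g (p.1, Quot.mk _ p.2)) : Continuous g :=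
  (isQuotientMap_quot_mk (r := SuspRel A)).continuous_lift_prod_right h

/-- Maps out of `T × cone f` are continuous if they are so on the two pieces. -/
theorem continuous_of_cone {T Y : Type*} [TopologicalSpace T] [LocallyCompactSpace T]
    [TopologicalSpace Y] {A B : PtTop.{u}} {f : A ⟶ B} {g : T × cone f → Y}
    (h₁ : Continuous fun p : T × (unitInterval × A) => g (p.1, Quot.mk _ (Sum.inl p.2)))
    (h₂ : Continuous fun p : T × B => g (p.1, Quot.mk _ (Sum.inr p.2))) : Continuous g := by
  refine (isQuotientMap_quot_mk (r := ConeRel f)).continuous_lift_prod_right ?_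
  have e : Continuous fun p : (T × (unitInterval × A)) ⊕ (T × B) =>
      g (((Homeomorph.prodSumDistrib).symm p).1,
        Quot.mk _ ((Homeomorph.prodSumDistrib).symm p).2) :=
    continuous_sum_dom.mpr ⟨h₁, h₂⟩
  have := e.comp (Homeomorph.prodSumDistrib (X := T) (Y := unitInterval × A) (Z := B)).continuous
  refine this.congr fun p => ?_
  simp only [Function.comp_apply, Homeomorph.symm_apply_apply]
  rfl

/-- Maps out of `T × (A ∧ K)` are continuous if they are so on `T × (A × K)`. -/
theorem continuous_of_smash {T Y : Type*} [TopologicalSpace T] [LocallyCompactSpace T]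
    [TopologicalSpace Y] {A K : PtTop.{u}} {g : T × smash A K → Y}
    (h : Continuous fun p : T × (A × K) => g (p.1, Quot.mk _ p.2)) : Continuous g :=
  (isQuotientMap_quot_mk (r := SmashRel A K)).continuous_lift_prod_right h

/-- The class of finite pointed complexes: built from `S⁰` by finitely many reduced suspensions
and reduced mapping cones. -/
inductive IsFiniteComplex : PtTop.{0} → Prop
  | sphere : IsFiniteComplex sphereZero
  | susp (K : PtTop.{0}) : IsFiniteComplex K → IsFiniteComplex (susp K)
  | cone {K L : PtTop.{0}} (f : K ⟶ L) :
      IsFiniteComplex K → IsFiniteComplex L → IsFiniteComplex (cone f)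

end PtTop

/-! ## Spectra -/

/-- A (sequential) spectrum: pointed spaces `Z₀, Z₁, …` with structure maps `S¹ ∧ Zₙ → Zₙ₊₁`,
written as maps `I × Zₙ → Zₙ₊₁`. -/
structure Spectrum : Type (u + 1) where
  level : ℕ → PtTop.{u}
  str : ∀ n, unitInterval × level n → level (n + 1)
  str_cont : ∀ n, Continuous (str n)
  str_zero : ∀ n x, str n (0, x) = (level (n + 1)).pt
  str_one : ∀ n x, str n (1, x) = (level (n + 1)).pt
  str_pt : ∀ n t, str n (t, (level n).pt) = (level (n + 1)).pt

/-- Maps of spectra. -/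
@[ext]
structure Spectrum.Hom (A B : Spectrum.{u}) where
  app : ∀ n, A.level n ⟶ B.level n
  comm : ∀ n t x, (app (n + 1)).toFun (A.str n (t, x)) = B.str n (t, (app n).toFun x)

instance : Category Spectrum.{u} where
  Hom := Spectrum.Hom
  id A := ⟨fun _ => 𝟙 _, fun _ _ _ => rfl⟩
  comp f g := ⟨fun n => f.app n ≫ g.app n, fun n t x => by simp [f.comm, g.comm]⟩

namespace Spectrum

open PtTop

@[ext]
theorem hom_ext {A B : Spectrum.{u}} {f g : A ⟶ B}
    (h : ∀ n a, (f.app n).toFun a = (g.app n).toFun a) : f = g :=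
  Spectrum.Hom.ext (funext fun n => PtTop.hom_ext (h n))

@[simp] theorem id_app (A : Spectrum.{u}) (n : ℕ) : Spectrum.Hom.app (𝟙 A) n = 𝟙 _ := rfl

@[simp] theorem comp_app {A B C : Spectrum.{u}} (f : A ⟶ B) (g : B ⟶ C) (n : ℕ) :
    (f ≫ g).app n = f.app n ≫ g.app n := rfl

/-- The map that is constant at the base points. -/
def zero (A B : Spectrum.{u}) : A ⟶ B := ⟨fun _ => PtTop.zero _ _, fun n t _ => (B.str_pt n t).symm⟩

/-- The levelwise suspension of a spectrum. -/
def suspObj (Z : Spectrum.{u}) : Spectrum.{u} where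
  level n := PtTop.susp (Z.level n)
  str n p := Quot.lift (fun q : unitInterval × Z.level n =>
      (Quot.mk _ (q.1, Z.str n (p.1, q.2)) : PtTop.susp (Z.level (n + 1)))) (by
    rintro _ _ (a | a | t)
    · exact (Quot.sound (.zero _)).trans (Quot.sound (.zero _)).symm
    · exact (Quot.sound (.one _)).trans (Quot.sound (.zero _)).symm
    · simp only [Z.str_pt]; exact Quot.sound (.base _)) p.2
  str_cont n := by
    refine continuous_of_susp ?_
    refine continuous_quot_mk.comp ?_
    have := Z.str_cont n
    fun_prop
  str_zero n x := by
    obtain ⟨q, rfl⟩ := Quot.exists_rep x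
    simp only [Z.str_zero]; exact Quot.sound (.base _)
  str_one n x := by
    obtain ⟨q, rfl⟩ := Quot.exists_rep x
    simp only [Z.str_one]; exact Quot.sound (.base _)
  str_pt n t := Quot.sound (.zero _)

/-- Suspension as a functor on spectra. -/
def susp : Spectrum.{u} ⥤ Spectrum.{u} where
  obj := suspObj
  map f :=
    { app := fun n => PtTop.suspMap (f.app n)
      comm := fun n t x => by
        obtain ⟨q, rfl⟩ := Quot.exists_rep x
        exact congrArg (fun w => Quot.mk _ (q.1, w)) (f.comm n t q.2) }
  map_id Z := by
    ext n x
    obtain ⟨q, rfl⟩ := Quot.exists_rep x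
    rfl
  map_comp f g := by
    ext n x
    obtain ⟨q, rfl⟩ := Quot.exists_rep x
    rfl

theorem susp_map_zero (A B : Spectrum.{u}) : susp.map (zero A B) = zero _ _ := by
  ext n x
  obtain ⟨q, rfl⟩ := Quot.exists_rep x
  exact Quot.sound (.base _)

/-- The levelwise loop spectrum. -/
def loopsObj (Z : Spectrum.{u}) : Spectrum.{u} where
  level n := PtTop.loops (Z.level n)
  str n p :=
    { toFun := fun s => Z.str n (p.1, PtTop.eval p.2 s)
      continuous_toFun := (Z.str_cont n).comp (continuous_const.prodMk (Path.continuous _))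
      source' := (congrArg (fun z => Z.str n (p.1, z)) (Path.source _)).trans (Z.str_pt n p.1)
      target' := (congrArg (fun z => Z.str n (p.1, z)) (Path.target _)).trans (Z.str_pt n p.1) }
  str_cont n := by
    refine Path.continuous_uncurry_iff.mp ?_
    refine (Z.str_cont n).comp ?_
    have : Continuous fun q : Path (Z.level n).pt (Z.level n).pt × unitInterval => q.1 q.2 :=
      Path.continuous_uncurry_iff.mpr continuous_id
    exact (continuous_fst.comp continuous_fst).prodMk
      (this.comp ((continuous_snd.comp continuous_fst).prodMk continuous_snd))
  str_zero n x := Path.ext (funext fun s => Z.str_zero n _)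
  str_one n x := Path.ext (funext fun s => Z.str_one n _)
  str_pt n t := Path.ext (funext fun s => Z.str_pt n t)

/-- Looping as a functor on spectra. -/
def loops : Spectrum.{u} ⥤ Spectrum.{u} where
  obj := loopsObj
  map f :=
    { app := fun n => PtTop.loopsMap (f.app n)
      comm := fun n t x => Path.ext (funext fun s => f.comm n t (PtTop.eval x s)) }
  map_id Z := by ext n x; exact Path.ext rfl
  map_comp f g := by ext n x; exact Path.ext rfl

/-- The unit `Z → ΩΣZ`, `z ↦ (t ↦ [t, z])`. -/
def unit (Z : Spectrum.{u}) : Z ⟶ loops.obj (susp.obj Z) where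
  app n :=
    { toFun := fun z =>
        { toFun := fun t => Quot.mk _ (t, z)
          continuous_toFun := continuous_quot_mk.comp (continuous_id.prodMk continuous_const)
          source' := Quot.sound (.zero _)
          target' := Quot.sound (.one _) }
      cont := Path.continuous_uncurry_iff.mp
        (continuous_quot_mk.comp (continuous_snd.prodMk continuous_fst))
      map_pt := Path.ext (funext fun t => Quot.sound (.base t)) }
  comm n t x := Path.ext (funext fun _ => rfl)

/-- The levelwise reduced mapping cone of a map of spectra, i.e. its cofiber. -/
def cone {A B : Spectrum.{u}} (f : A ⟶ B) : Spectrum.{u} where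
  level n := PtTop.cone (f.app n)
  str n p := Quot.lift (fun q : (unitInterval × A.level n) ⊕ B.level n =>
      (Quot.mk _ (Sum.map (fun w => (w.1, A.str n (p.1, w.2))) (fun b => B.str n (p.1, b)) q) :
        PtTop.cone (f.app (n + 1)))) (by
    rintro _ _ (a | t | a)
    · exact (Quot.sound (.zero _)).trans (by simp only [Sum.map_inr, B.str_pt])
    · simp only [Sum.map_inl, Sum.map_inr, A.str_pt, B.str_pt]; exact Quot.sound (.base _)
    · exact (Quot.sound (.one _)).trans (by simp only [Sum.map_inr, f.comm])) p.2
  str_cont n := by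
    have hA := A.str_cont n
    have hB := B.str_cont n
    refine continuous_of_cone ?_ ?_
    · refine continuous_quot_mk.comp (continuous_inl.comp ?_)
      fun_prop
    · exact continuous_quot_mk.comp (continuous_inr.comp hB)
  str_zero n x := by
    obtain ⟨q | q, rfl⟩ := Quot.exists_rep x
    · simp only [Sum.map_inl, A.str_zero]; exact Quot.sound (.base _)
    · simp only [Sum.map_inr, B.str_zero]; rfl
  str_one n x := by
    obtain ⟨q | q, rfl⟩ := Quot.exists_rep x
    · simp only [Sum.map_inl, A.str_one]; exact Quot.sound (.base _)
    · simp only [Sum.map_inr, B.str_one]; rfl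
  str_pt n t := by
    change Quot.mk _ (Sum.inr (B.str n (t, _))) = Quot.mk _ (Sum.inr _)
    rw [B.str_pt]

/-- The inclusion `B → cone f`. -/
def coneIncl {A B : Spectrum.{u}} (f : A ⟶ B) : B ⟶ cone f where
  app n := PtTop.coneIncl (f.app n)
  comm _ _ _ := rfl

/-- The connecting map `cone f → ΣA`, collapsing `B`. -/
def conePinch {A B : Spectrum.{u}} (f : A ⟶ B) : cone f ⟶ susp.obj A where
  app n :=
    { toFun := Quot.lift (Sum.elim (fun p => Quot.mk _ p)
          (fun _ => (PtTop.susp (A.level n)).pt)) (by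
        rintro _ _ (a | t | a)
        · exact Quot.sound (.zero _)
        · exact Quot.sound (.base _)
        · exact Quot.sound (.one _))
      cont := continuous_quot_lift _
        (continuous_sum_dom.mpr ⟨continuous_quot_mk, continuous_const⟩)
      map_pt := rfl }
  comm n t x := by
    obtain ⟨q | q, rfl⟩ := Quot.exists_rep x
    · rfl
    · exact ((susp.obj A).str_pt n t).symm

/-- Functoriality of mapping cones for commutative squares. -/
def coneMap {A B A' B' : Spectrum.{u}} {f : A ⟶ B} {f' : A' ⟶ B'} (a : A ⟶ A') (b : B ⟶ B')
    (h : f ≫ b = a ≫ f') : cone f ⟶ cone f' where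
  app n :=
    { toFun := Quot.lift (fun q => Quot.mk _
          (Sum.map (fun w => (w.1, (a.app n).toFun w.2)) (b.app n).toFun q)) (by
        rintro _ _ (x | t | x)
        · exact (Quot.sound (.zero _)).trans (by simp only [Sum.map_inr, (b.app n).map_pt])
        · simp only [Sum.map_inl, Sum.map_inr, (a.app n).map_pt, (b.app n).map_pt]
          exact Quot.sound (.base _)
        · refine (Quot.sound (.one _)).trans (congrArg (fun w => Quot.mk _ (Sum.inr w)) ?_)
          exact congrArg (fun k : A ⟶ B' => (k.app n).toFun x) h.symm)
      cont := continuous_quot_lift _ (continuous_quot_mk.comp (by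
        have ha := (a.app n).cont
        have hb := (b.app n).cont
        exact Continuous.sumMap (by fun_prop) hb))
      map_pt := congrArg (fun w => Quot.mk _ (Sum.inr w)) (b.app n).map_pt }
  comm n t x := by
    obtain ⟨q | q, rfl⟩ := Quot.exists_rep x
    · exact congrArg (fun w => Quot.mk _ (Sum.inl (q.1, w))) (a.comm n t q.2)
    · exact congrArg (fun w => Quot.mk _ (Sum.inr w)) (b.comm n t q)

theorem coneMap_id {A B : Spectrum.{u}} {f : A ⟶ B} {a : A ⟶ A} {b : B ⟶ B}
    (h : f ≫ b = a ≫ f) (ha : a = 𝟙 A) (hb : b = 𝟙 B) : coneMap a b h = 𝟙 (cone f) := by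
  subst ha hb
  ext n x
  obtain ⟨q | q, rfl⟩ := Quot.exists_rep x <;> rfl

theorem coneMap_comp {A B A' B' A'' B'' : Spectrum.{u}} {f : A ⟶ B} {f' : A' ⟶ B'}
    {f'' : A'' ⟶ B''} {a : A ⟶ A'} {b : B ⟶ B'} (h : f ≫ b = a ≫ f') {a' : A' ⟶ A''}
    {b' : B' ⟶ B''} (h' : f' ≫ b' = a' ≫ f'') {a'' : A ⟶ A''} {b'' : B ⟶ B''}
    (h'' : f ≫ b'' = a'' ≫ f'') (ha : a'' = a ≫ a') (hb : b'' = b ≫ b') :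
    coneMap a'' b'' h'' = coneMap a b h ≫ coneMap a' b' h' := by
  subst ha hb
  ext n x
  obtain ⟨q | q, rfl⟩ := Quot.exists_rep x <;> rfl

theorem coneMap_square {A₁ A₂ A₃ A₄ B₁ B₂ B₃ B₄ : Spectrum.{u}} {f₁ : A₁ ⟶ B₁} {f₂ : A₂ ⟶ B₂}
    {f₃ : A₃ ⟶ B₃} {f₄ : A₄ ⟶ B₄} {a : A₁ ⟶ A₂} {b : B₁ ⟶ B₂} {a' : A₂ ⟶ A₄} {b' : B₂ ⟶ B₄}
    {c : A₁ ⟶ A₃} {d : B₁ ⟶ B₃} {c' : A₃ ⟶ A₄} {d' : B₃ ⟶ B₄} (h₁ : f₁ ≫ b = a ≫ f₂)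
    (h₂ : f₂ ≫ b' = a' ≫ f₄) (h₃ : f₁ ≫ d = c ≫ f₃) (h₄ : f₃ ≫ d' = c' ≫ f₄)
    (hA : a ≫ a' = c ≫ c') (hB : b ≫ b' = d ≫ d') :
    coneMap a b h₁ ≫ coneMap a' b' h₂ = coneMap c d h₃ ≫ coneMap c' d' h₄ := by
  ext n x
  obtain ⟨q | q, rfl⟩ := Quot.exists_rep x
  · exact congrArg (fun k : A₁ ⟶ A₄ => Quot.mk _ (Sum.inl (q.1, (k.app n).toFun q.2))) hA
  · exact congrArg (fun k : B₁ ⟶ B₄ => Quot.mk _ (Sum.inr ((k.app n).toFun q))) hB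

theorem coneMap_zero {A B A' B' : Spectrum.{u}} {f : A ⟶ B} {f' : A' ⟶ B'} {a : A ⟶ A'}
    {b : B ⟶ B'} (h : f ≫ b = a ≫ f') (ha : a = zero A A') (hb : b = zero B B') :
    coneMap a b h = zero (cone f) (cone f') := by
  subst ha hb
  ext n x
  obtain ⟨q | q, rfl⟩ := Quot.exists_rep x
  · exact Quot.sound (.base _)
  · rfl

/-- A map `g` out of the target of `f` with `f ≫ g` constant extends to the mapping cone of `f`,
by the constant map on the cone coordinate. -/
def coneDesc {A B C : Spectrum.{u}} (f : A ⟶ B) (g : B ⟶ C) (h : f ≫ g = zero A C) :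
    cone f ⟶ C where
  app n :=
    { toFun := Quot.lift (Sum.elim (fun _ => (C.level n).pt) (g.app n).toFun) (by
        rintro _ _ (a | t | a)
        · exact (g.app n).map_pt.symm
        · exact (g.app n).map_pt.symm
        · exact (congrArg (fun k : A ⟶ C => (k.app n).toFun a) h).symm)
      cont := continuous_quot_lift _ (continuous_sum_dom.mpr ⟨continuous_const, (g.app n).cont⟩)
      map_pt := (g.app n).map_pt }
  comm n t x := by
    obtain ⟨q | q, rfl⟩ := Quot.exists_rep x
    · exact (C.str_pt n t).symm
    · exact g.comm n t q

/-- The interchange map `Σ(cone f) → cone (Σf)` swapping the suspension and cone coordinates. -/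
def suspCone {A B : Spectrum.{u}} (f : A ⟶ B) : susp.obj (cone f) ⟶ cone (susp.map f) where
  app n :=
    { toFun := Quot.lift (fun p => Quot.lift
          (Sum.elim (fun q => Quot.mk _ (Sum.inl (q.1, Quot.mk _ (p.1, q.2))))
            (fun b => Quot.mk _ (Sum.inr (Quot.mk _ (p.1, b))))) (by
          rintro _ _ (a | t | a)
          · exact (Quot.sound (.zero _)).trans
              (congrArg (fun w => Quot.mk _ (Sum.inr w)) (Quot.sound (.base _)).symm)
          · exact ((congrArg (fun w => Quot.mk _ (Sum.inl (t, w))) (Quot.sound (.base _))).trans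
              (Quot.sound (.base _))).trans
              (congrArg (fun w => Quot.mk _ (Sum.inr w)) (Quot.sound (.base _)).symm)
          · exact Quot.sound (.one _)) p.2) (by
        rintro _ _ (x | x | t)
        · obtain ⟨q | q, rfl⟩ := Quot.exists_rep x
          · exact ((congrArg (fun w => Quot.mk _ (Sum.inl (q.1, w))) (Quot.sound (.zero _))).trans
              (Quot.sound (.base _)))
          · exact congrArg (fun w => Quot.mk _ (Sum.inr w)) (Quot.sound (.zero _))
        · obtain ⟨q | q, rfl⟩ := Quot.exists_rep x
          · exact ((congrArg (fun w => Quot.mk _ (Sum.inl (q.1, w))) (Quot.sound (.one _))).trans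
              (Quot.sound (.base _)))
          · exact congrArg (fun w => Quot.mk _ (Sum.inr w)) (Quot.sound (.one _))
        · exact congrArg (fun w => Quot.mk _ (Sum.inr w)) (Quot.sound (.base _)))
      cont := by
        refine continuous_quot_lift _ ?_
        refine continuous_of_cone (T := unitInterval) ?_ ?_
        · refine continuous_quot_mk.comp (continuous_inl.comp ?_)
          exact (continuous_fst.comp continuous_snd).prodMk (continuous_quot_mk.comp (by fun_prop))
        · exact continuous_quot_mk.comp (continuous_inr.comp continuous_quot_mk)
      map_pt := rfl }
  comm n t x := by
    obtain ⟨⟨s, y⟩, rfl⟩ := Quot.exists_rep x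
    obtain ⟨q | q, rfl⟩ := Quot.exists_rep y
    · rfl
    · rfl

/-- The interchange map `cone (cone f → cone f') → cone (cone a → cone b)` attached to a commutative
square with horizontal maps `f, f'` and vertical maps `a, b`, swapping the two cone coordinates. -/
def coneSwap {A B A' B' : Spectrum.{u}} {f : A ⟶ B} {f' : A' ⟶ B'} (a : A ⟶ A') (b : B ⟶ B')
    (h : f ≫ b = a ≫ f') : cone (coneMap a b h) ⟶ cone (coneMap f f' h.symm) where
  app n :=
    { toFun := Quot.lift (Sum.elim
          (fun p => Quot.lift (Sum.elim
            (fun q => Quot.mk _ (Sum.inl (q.1, Quot.mk _ (Sum.inl (p.1, q.2)))))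
            (fun y => Quot.mk _ (Sum.inr (Quot.mk _ (Sum.inl (p.1, y)))))) (by
              rintro _ _ (x | t | x)
              · exact (Quot.sound (.zero _)).trans
                  (congrArg (fun w => Quot.mk _ (Sum.inr w)) (Quot.sound (.base _)).symm)
              · exact ((congrArg (fun w => Quot.mk _ (Sum.inl (t, w))) (Quot.sound (.base _))).trans
                  (Quot.sound (.base _))).trans
                  (congrArg (fun w => Quot.mk _ (Sum.inr w)) (Quot.sound (.base _)).symm)
              · exact Quot.sound (.one _)) p.2)
          (Quot.lift (Sum.elim
            (fun q => Quot.mk _ (Sum.inl (q.1, Quot.mk _ (Sum.inr q.2))))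
            (fun y => Quot.mk _ (Sum.inr (Quot.mk _ (Sum.inr y))))) (by
              rintro _ _ (x | t | x)
              · exact Quot.sound (.zero _)
              · exact Quot.sound (.base _)
              · exact Quot.sound (.one _)))) (by
        rintro _ _ (x | t | x)
        · obtain ⟨q | q, rfl⟩ := Quot.exists_rep x
          · exact (congrArg (fun w => Quot.mk _ (Sum.inl (q.1, w))) (Quot.sound (.zero _))).trans
              (Quot.sound (.base _))
          · exact congrArg (fun w => Quot.mk _ (Sum.inr w)) (Quot.sound (.zero _))
        · exact congrArg (fun w => Quot.mk _ (Sum.inr w)) (Quot.sound (.base _))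
        · obtain ⟨q | q, rfl⟩ := Quot.exists_rep x
          · exact congrArg (fun w => Quot.mk _ (Sum.inl (q.1, w))) (Quot.sound (.one _))
          · exact congrArg (fun w => Quot.mk _ (Sum.inr w)) (Quot.sound (.one _)))
      cont := by
        refine continuous_quot_lift _ (continuous_sum_dom.mpr ⟨?_, ?_⟩)
        · refine continuous_of_cone (T := unitInterval) ?_ ?_
          · refine continuous_quot_mk.comp (continuous_inl.comp ?_)
            refine (continuous_fst.comp continuous_snd).prodMk
              (continuous_quot_mk.comp (continuous_inl.comp ?_))
            fun_prop
          · exact continuous_quot_mk.comp (continuous_inr.comp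
              (continuous_quot_mk.comp continuous_inl))
        · refine continuous_quot_lift _ (continuous_sum_dom.mpr ⟨?_, ?_⟩)
          · refine continuous_quot_mk.comp (continuous_inl.comp ?_)
            exact continuous_fst.prodMk
              (continuous_quot_mk.comp (continuous_inr.comp continuous_snd))
          · exact continuous_quot_mk.comp (continuous_inr.comp
              (continuous_quot_mk.comp continuous_inr))
      map_pt := rfl }
  comm n t x := by
    obtain ⟨⟨s, y⟩ | y, rfl⟩ := Quot.exists_rep x
    · obtain ⟨q | q, rfl⟩ := Quot.exists_rep y <;> rfl
    · obtain ⟨q | q, rfl⟩ := Quot.exists_rep y <;> rfl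

theorem susp_square {A B A' B' : Spectrum.{u}} {f : A ⟶ B} {f' : A' ⟶ B'} {a : A ⟶ A'}
    {b : B ⟶ B'} (h : f ≫ b = a ≫ f') :
    susp.map f ≫ susp.map b = susp.map a ≫ susp.map f' := by
  rw [← susp.map_comp, ← susp.map_comp, h]

theorem suspCone_naturality {A B A' B' : Spectrum.{u}} {f : A ⟶ B} {f' : A' ⟶ B'} (a : A ⟶ A')
    (b : B ⟶ B') (h : f ≫ b = a ≫ f') (h' : susp.map f ≫ susp.map b = susp.map a ≫ susp.map f') :
    susp.map (coneMap a b h) ≫ suspCone f' = suspCone f ≫ coneMap (susp.map a) (susp.map b) h' := by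
  ext n x
  obtain ⟨⟨s, y⟩, rfl⟩ := Quot.exists_rep x
  obtain ⟨q | q, rfl⟩ := Quot.exists_rep y <;> rfl

end Spectrum

/-! ## Homotopy groups of spectra -/

namespace PtTop

/-- The homotopy group `π_{i+2}(A)`, written additively. -/
abbrev hgrp (i : ℕ) (A : PtTop.{u}) : Type u := Additive (HomotopyGroup (Fin (i + 2)) A A.pt)

/-- The effect of a pointed map on generalised loops. -/
def genLoopMap {A B : PtTop.{u}} (n : ℕ) (f : A ⟶ B)
    (g : GenLoop (Fin n) A A.pt) : GenLoop (Fin n) B B.pt :=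
  ⟨(⟨f.toFun, f.cont⟩ : C(A, B)).comp g.1, fun y hy =>
    (congrArg f.toFun (g.2 y hy)).trans f.map_pt⟩

/-- The class of a generalised loop. -/
def cls {N A : Type*} [TopologicalSpace A] {a : A} (g : GenLoop N A a) : HomotopyGroup N A a :=
  Quotient.mk _ g

/-- The effect of a pointed map on homotopy groups. -/
def hgrpMap {A B : PtTop.{u}} (i : ℕ) (f : A ⟶ B) : hgrp i A →+ hgrp i B :=
  MonoidHom.toAdditive (MonoidHom.mk'
    (Quotient.map (genLoopMap (i + 2) f) (by
      rintro p q ⟨H⟩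
      exact ⟨H.compContinuousMap ⟨f.toFun, f.cont⟩⟩) :
      HomotopyGroup (Fin (i + 2)) A A.pt → HomotopyGroup (Fin (i + 2)) B B.pt) (by
    intro p q
    induction p using Quotient.inductionOn with | _ p => ?_
    induction q using Quotient.inductionOn with | _ q => ?_
    have hm : cls p * cls q = cls (GenLoop.transAt 0 q p) :=
      HomotopyGroup.mul_spec
    have hm' : cls (genLoopMap _ f p) * cls (genLoopMap _ f q) =
        cls (GenLoop.transAt 0 (genLoopMap _ f q) (genLoopMap _ f p)) := HomotopyGroup.mul_spec
    refine (congrArg _ hm).trans (Eq.trans ?_ hm'.symm)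
    refine congrArg (Quotient.mk _) (GenLoop.ext _ _ fun y => ?_)
    change f.toFun (GenLoop.transAt 0 q p y) = _
    simp only [GenLoop.transAt, GenLoop.coe_copy]
    split_ifs <;> rfl))

/-- A continuous map `σ : I × A → B` that is constant on `({0, 1} × A) ∪ (I × {pt})` sends an
`n`-fold loop `g` in `A` to the `(n + 1)`-fold loop `(s₀, s) ↦ σ (s₀, g s)` in `B`. -/
def genLoopStab {A B : PtTop.{u}} (n : ℕ) (σ : unitInterval × A → B) (hσ : Continuous σ)
    (h₀ : ∀ x, σ (0, x) = B.pt) (h₁ : ∀ x, σ (1, x) = B.pt) (h : ∀ t, σ (t, A.pt) = B.pt)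
    (g : GenLoop (Fin n) A A.pt) : GenLoop (Fin (n + 1)) B B.pt :=
  ⟨⟨fun s => σ (s 0, g fun j => s j.succ), by
      have := g.1.continuous
      exact hσ.comp ((continuous_apply 0).prodMk (this.comp (by fun_prop)))⟩, by
    rintro s ⟨j, hj⟩
    change σ (s 0, g fun j => s j.succ) = _
    refine Fin.cases (fun hj => ?_) (fun j hj => ?_) j hj
    · rcases hj with hj | hj
      · rw [hj, h₀]
      · rw [hj, h₁]
    · have hg : g (fun j => s j.succ) = A.pt := g.2 _ ⟨j, hj⟩
      rw [hg, h]⟩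

/-- The map of homotopy groups induced by `genLoopStab`. -/
def hgrpStab {A B : PtTop.{u}} (i : ℕ) (σ : unitInterval × A → B) (hσ : Continuous σ)
    (h₀ : ∀ x, σ (0, x) = B.pt) (h₁ : ∀ x, σ (1, x) = B.pt) (h : ∀ t, σ (t, A.pt) = B.pt) :
    hgrp i A →+ hgrp (i + 1) B :=
  MonoidHom.toAdditive (MonoidHom.mk'
    (Quotient.map (genLoopStab (i + 2) σ hσ h₀ h₁ h) (by
      rintro p q ⟨H⟩
      refine ⟨⟨⟨⟨fun z => σ (z.2 0, H (z.1, fun j => z.2 j.succ)), ?_⟩, ?_, ?_⟩, ?_⟩⟩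
      · exact hσ.comp (((continuous_apply 0).comp continuous_snd).prodMk
          (H.continuous.comp (by fun_prop)))
      · intro s
        exact congrArg (fun x => σ (s 0, x)) (H.apply_zero _)
      · intro s
        exact congrArg (fun x => σ (s 0, x)) (H.apply_one _)
      · rintro t s ⟨j, hj⟩
        change σ (s 0, H (t, fun j => s j.succ)) = σ (s 0, p fun j => s j.succ)
        refine Fin.cases (fun hj => ?_) (fun j hj => ?_) j hj
        · rcases hj with hj | hj
          · rw [hj, h₀, h₀]
          · rw [hj, h₁, h₁]
        · exact congrArg (fun x => σ (s 0, x)) (H.eq_fst t ⟨j, hj⟩)) :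
      HomotopyGroup (Fin (i + 2)) A A.pt → HomotopyGroup (Fin (i + 1 + 2)) B B.pt) (by
    intro p q
    induction p using Quotient.inductionOn with | _ p => ?_
    induction q using Quotient.inductionOn with | _ q => ?_
    have hm : cls p * cls q = cls (GenLoop.transAt 0 q p) :=
      HomotopyGroup.mul_spec
    have hm' : cls (genLoopStab _ σ hσ h₀ h₁ h p) * cls (genLoopStab _ σ hσ h₀ h₁ h q) =
        cls (GenLoop.transAt (Fin.succ 0) (genLoopStab _ σ hσ h₀ h₁ h q)
          (genLoopStab _ σ hσ h₀ h₁ h p)) := HomotopyGroup.mul_spec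
    refine (congrArg _ hm).trans (Eq.trans ?_ hm'.symm)
    refine congrArg (Quotient.mk _) (GenLoop.ext _ _ fun s => ?_)
    change σ (s 0, GenLoop.transAt 0 q p fun j => s j.succ) = _
    simp only [GenLoop.transAt, GenLoop.coe_copy]
    have key : ∀ (c : unitInterval) (r : GenLoop (Fin (i + 2)) A A.pt),
        genLoopStab (i + 2) σ hσ h₀ h₁ h r (Function.update s (Fin.succ 0) c) =
          σ (s 0, r (Function.update (fun j => s j.succ) 0 c)) := by
      intro c r
      change σ (Function.update s (Fin.succ 0) c 0,
        r fun j => Function.update s (Fin.succ 0) c j.succ) = _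
      congr 2
      congr 1
      funext j
      by_cases hj : j = 0
      · subst hj; simp
      · rw [Function.update_of_ne hj,
          Function.update_of_ne fun e => hj (Fin.succ_injective _ e)]
    split_ifs
    · exact (key _ q).symm
    · exact (key _ p).symm))

end PtTop

namespace Spectrum

open PtTop

/-- The stabilisation map `π_{i+2}(Z_{i+2}) → π_{i+3}(Z_{i+3})`. -/
def stab (Z : Spectrum.{u}) (i : ℕ) : hgrp i (Z.level (i + 2)) →+ hgrp (i + 1) (Z.level (i + 1 + 2)) :=
  hgrpStab i (Z.str (i + 2)) (Z.str_cont _) (Z.str_zero _) (Z.str_one _) (Z.str_pt _)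

/-- The sequence `π₂(Z₂) → π₃(Z₃) → ⋯`. -/
def pi0Seq : Spectrum.{u} ⥤ ℕ ⥤ AddCommGrpCat.{u} where
  obj Z := Functor.ofSequence (X := fun i => AddCommGrpCat.of (hgrp i (Z.level (i + 2))))
    fun i => AddCommGrpCat.ofHom (stab Z i)
  map {Z W} f := NatTrans.ofSequence
    (F := Functor.ofSequence (X := fun i => AddCommGrpCat.of (hgrp i (Z.level (i + 2))))
      fun i => AddCommGrpCat.ofHom (stab Z i))
    (G := Functor.ofSequence (X := fun i => AddCommGrpCat.of (hgrp i (W.level (i + 2))))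
      fun i => AddCommGrpCat.ofHom (stab W i))
    (fun i => AddCommGrpCat.ofHom (hgrpMap i (f.app (i + 2)))) (by
      intro i
      rw [Functor.ofSequence_map_homOfLE_succ, Functor.ofSequence_map_homOfLE_succ]
      ext x
      induction x using Additive.rec with | _ x => ?_
      induction x using Quotient.inductionOn with | _ p => ?_
      refine congrArg Additive.ofMul (congrArg (Quotient.mk _) (GenLoop.ext _ _ fun s => ?_))
      exact f.comm _ _ _)
  map_id Z := by
    ext i x
    induction x using Additive.rec with | _ x => ?_
    induction x using Quotient.inductionOn with | _ p => ?_
    rfl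
  map_comp f g := by
    ext i x
    induction x using Additive.rec with | _ x => ?_
    induction x using Quotient.inductionOn with | _ p => ?_
    rfl

/-- The stable homotopy group `π₀(Z) = colimᵢ πᵢ(Zᵢ)`. -/
def pi0 : Spectrum.{u} ⥤ AddCommGrpCat.{u} := pi0Seq ⋙ Limits.colim

/-- Iterated suspension of spectra. -/
def suspPow : ℕ → Spectrum.{u} ⥤ Spectrum.{u}
  | 0 => 𝟭 _
  | n + 1 => susp ⋙ suspPow n

/-- Iterated looping of spectra. -/
def loopsPow : ℕ → Spectrum.{u} ⥤ Spectrum.{u}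
  | 0 => 𝟭 _
  | n + 1 => loops ⋙ loopsPow n

/-- The stable homotopy groups of spectra: `π_n(Z) = π₀(ΩⁿZ)` and `π_{-n}(Z) = π₀(ΣⁿZ)`. -/
def π : ℤ → Spectrum.{u} ⥤ AddCommGrpCat.{u}
  | Int.ofNat n => loopsPow n ⋙ pi0
  | Int.negSucc n => suspPow (n + 1) ⋙ pi0

/-- Stable equivalences are the maps inducing isomorphisms on all stable homotopy groups. -/
def IsStableEquiv {Z W : Spectrum.{u}} (f : Z ⟶ W) : Prop :=
  ∀ k, Function.Bijective ((π k).map f)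

/-- The suspension homomorphism `π_k(Z) → π_{k+1}(ΣZ)`: for `k ≥ 0` it is induced by the unit
`Z → ΩΣZ`, and for `k < 0` it is the identity of `π₀(Σ^{-k}Z)`. -/
def suspHom (Z : Spectrum.{u}) : ∀ k : ℤ, (π k).obj Z →+ (π (k + 1)).obj (susp.obj Z)
  | Int.ofNat n => ((loopsPow n ⋙ pi0).map (unit Z)).hom
  | Int.negSucc 0 => AddMonoidHom.id _
  | Int.negSucc (_ + 1) => AddMonoidHom.id _

/-- The suspension spectrum of a pointed space: its levels are the iterated suspensions of `K`,
and the structure maps are `(t, x) ↦ [t, x]`. -/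
def suspensionSpectrum (K : PtTop.{u}) : Spectrum.{u} where
  level n := Nat.rec K (fun _ A => PtTop.susp A) n
  str n p := Quot.mk _ p
  str_cont _ := continuous_quot_mk
  str_zero _ x := Quot.sound (.zero x)
  str_one _ x := Quot.sound (.one x)
  str_pt _ t := Quot.sound (.base t)

/-- Iterated reduced suspension of a pointed map. -/
def suspensionMapApp {K L : PtTop.{u}} (f : K ⟶ L) :
    ∀ n, (suspensionSpectrum K).level n ⟶ (suspensionSpectrum L).level n
  | 0 => f
  | n + 1 => PtTop.suspMap (suspensionMapApp f n)

/-- The map of suspension spectra induced by a pointed map. -/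
def suspensionMap {K L : PtTop.{u}} (f : K ⟶ L) : suspensionSpectrum K ⟶ suspensionSpectrum L where
  app := suspensionMapApp f
  comm _ _ _ := rfl

/-- The smash product `E ∧ K` of a spectrum and a pointed space, formed levelwise. -/
def smashObj (E : Spectrum.{u}) (K : PtTop.{u}) : Spectrum.{u} where
  level n := PtTop.smash (E.level n) K
  str n p := Quot.lift (fun q : E.level n × K =>
      (Quot.mk _ (E.str n (p.1, q.1), q.2) : PtTop.smash (E.level (n + 1)) K)) (by
    rintro _ _ (k | a)
    · simp only [E.str_pt]; exact Quot.sound (.left _)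
    · simp only [E.str_pt]; exact Quot.sound (.right _)) p.2
  str_cont n := by
    refine continuous_of_smash ?_
    refine continuous_quot_mk.comp ?_
    have := E.str_cont n
    fun_prop
  str_zero n x := by
    obtain ⟨q, rfl⟩ := Quot.exists_rep x
    simp only [E.str_zero]; exact Quot.sound (.left _)
  str_one n x := by
    obtain ⟨q, rfl⟩ := Quot.exists_rep x
    simp only [E.str_one]; exact Quot.sound (.left _)
  str_pt n t := by
    change Quot.mk _ (E.str n (t, _), K.pt) = Quot.mk _ (_, K.pt)
    rw [E.str_pt]

/-- Functoriality of `E ∧ K` in `K`. -/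
def smashMap (E : Spectrum.{u}) {K L : PtTop.{u}} (f : K ⟶ L) : smashObj E K ⟶ smashObj E L where
  app n := PtTop.smashMap (E.level n) f
  comm n t x := by
    obtain ⟨q, rfl⟩ := Quot.exists_rep x
    rfl

/-- The equivalence `E → E ∧ S⁰`. -/
def toSmashSphere (E : Spectrum.{0}) : E ⟶ smashObj E sphereZero where
  app n :=
    { toFun := fun x => Quot.mk _ (x, true)
      cont := continuous_quot_mk.comp (continuous_id.prodMk continuous_const)
      map_pt := Quot.sound (.left _) }
  comm _ _ _ := rfl

end Spectrum

/-! ## Ring spectra and the site of finite projective spectra -/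

open DirectSum in
/-- A spectrum `E` with a ring structure in the following weak sense, which every homotopy
associative and unital ring spectrum (in particular every Adams type one) has: `E_*` is a graded
ring, and `E_*(K) = π_*(E ∧ K)` is a graded `E_*`-module, naturally in the finite complex `K`, with
`E_*(S⁰)` the regular module. The category `Syn_E` depends only on the functor `E_*` and on this
structure. -/
structure RingSpectrum where
  spec : Spectrum.{0}
  ring : GRing fun i : ℤ => (Spectrum.π i).obj spec
  module : ∀ K : PtTop.{0}, PtTop.IsFiniteComplex K →
    Gmodule (fun i : ℤ => (Spectrum.π i).obj spec)
      (fun j : ℤ => (Spectrum.π j).obj (Spectrum.smashObj spec K))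
  smul_map : ∀ {K L : PtTop.{0}} (hK : PtTop.IsFiniteComplex K) (hL : PtTop.IsFiniteComplex L)
    (f : K ⟶ L) (i j : ℤ) (r : (Spectrum.π i).obj spec)
    (m : (Spectrum.π j).obj (Spectrum.smashObj spec K)),
    (Spectrum.π (i + j)).map (Spectrum.smashMap spec f) ((module K hK).smul r m) =
      (module L hL).smul r ((Spectrum.π j).map (Spectrum.smashMap spec f) m)
  smul_sphere : ∀ (i j : ℤ) (r : (Spectrum.π i).obj spec) (m : (Spectrum.π j).obj spec),
    (Spectrum.π (i + j)).map (Spectrum.toSmashSphere spec) (ring.mul r m) =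
      (module PtTop.sphereZero .sphere).smul r ((Spectrum.π j).map (Spectrum.toSmashSphere spec) m)

namespace RingSpectrum

/-- The coefficient groups `E_i`. -/
abbrev coeff (E : RingSpectrum) (i : ℤ) : Type := (Spectrum.π i).obj E.spec

/-- The homology groups `E_j(K)`. -/
abbrev homology (E : RingSpectrum) (K : PtTop.{0}) (j : ℤ) : Type :=
  (Spectrum.π j).obj (Spectrum.smashObj E.spec K)

/-- `E_*(K)` is a projective `E_*`-module. -/
def IsProjective (E : RingSpectrum) (K : PtTop.{0}) (hK : PtTop.IsFiniteComplex K) : Prop :=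
  letI := E.ring
  letI := E.module K hK
  Module.Projective (DirectSum ℤ E.coeff) (DirectSum ℤ (E.homology K))

/-- `E_*(f)` is surjective. -/
def IsHomologySurjective (E : RingSpectrum) {K L : PtTop.{0}} (f : K ⟶ L) : Prop :=
  ∀ j : ℤ, Function.Surjective ((Spectrum.π j).map (Spectrum.smashMap E.spec f))

end RingSpectrum

/-- The finite `E`-projective spectra: the spectra stably equivalent to a desuspension of the
suspension spectrum of a finite complex `K` with `E_*(K)` projective over `E_*`. -/
inductive IsFiniteProjective (E : RingSpectrum) : Spectrum.{0} → Prop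
  | sphere : IsFiniteProjective E (Spectrum.suspensionSpectrum PtTop.sphereZero)
  | ofComplex (K : PtTop.{0}) (hK : PtTop.IsFiniteComplex K) (h : E.IsProjective K hK) :
      IsFiniteProjective E (Spectrum.suspensionSpectrum K)
  | susp (P : Spectrum.{0}) : IsFiniteProjective E P → IsFiniteProjective E (Spectrum.susp.obj P)
  | loops (P : Spectrum.{0}) : IsFiniteProjective E P → IsFiniteProjective E (Spectrum.loops.obj P)
  | cone_id (P : Spectrum.{0}) : IsFiniteProjective E P → IsFiniteProjective E (Spectrum.cone (𝟙 P))
  | equiv {P Q : Spectrum.{0}} (f : P ⟶ Q) (hf : Spectrum.IsStableEquiv f) :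
      IsFiniteProjective E P → IsFiniteProjective E Q
  | equiv_symm {P Q : Spectrum.{0}} (f : P ⟶ Q) (hf : Spectrum.IsStableEquiv f) :
      IsFiniteProjective E Q → IsFiniteProjective E P

/-- Finite `E`-projective spectra, as a property of spectra. -/
def finiteProjective (E : RingSpectrum) : ObjectProperty Spectrum.{0} := IsFiniteProjective E

/-- The category `Sp_E^fp` of finite `E`-projective spectra, with strict maps of spectra as
morphisms. Its localisation at the stable equivalences is the usual `∞`-category. -/
abbrev Site (E : RingSpectrum) : Type 1 := (finiteProjective E).FullSubcategory

namespace Site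

variable (E : RingSpectrum)

/-- The suspension functor of `Sp_E^fp`. -/
def susp : Site E ⥤ Site E where
  obj P := ⟨Spectrum.susp.obj P.obj, .susp _ P.property⟩
  map f := ObjectProperty.homMk (Spectrum.susp.map f.hom)
  map_id P := ObjectProperty.hom_ext _ (Spectrum.susp.map_id P.obj)
  map_comp f g := ObjectProperty.hom_ext _ (Spectrum.susp.map_comp f.hom g.hom)

/-- The cone functor `P ↦ CP` of `Sp_E^fp`. -/
def cone : Site E ⥤ Site E where
  obj P := ⟨Spectrum.cone (𝟙 P.obj), .cone_id _ P.property⟩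
  map f := ObjectProperty.homMk (Spectrum.coneMap f.hom f.hom rfl)
  map_id _ := ObjectProperty.hom_ext _ (Spectrum.coneMap_id (f := 𝟙 _) rfl rfl rfl)
  map_comp f g := ObjectProperty.hom_ext _ 
    (Spectrum.coneMap_comp (f := 𝟙 _) (f' := 𝟙 _) (f'' := 𝟙 _) (a := f.hom) (b := f.hom) rfl
      (a' := g.hom) (b' := g.hom) rfl rfl rfl rfl)

/-- The inclusion `P → CP`. -/
def incl (P : Site E) : P ⟶ (cone E).obj P := ObjectProperty.homMk (Spectrum.coneIncl (𝟙 P.obj))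

/-- The projection `CP → ΣP`. -/
def pinch (P : Site E) : (cone E).obj P ⟶ (susp E).obj P :=
  ObjectProperty.homMk (Spectrum.conePinch (𝟙 P.obj))

/-- The zero map. -/
def zero {E : RingSpectrum} (P Q : Site E) : P ⟶ Q :=
  ObjectProperty.homMk (Spectrum.zero P.obj Q.obj)

variable {E}

theorem incl_naturality {P Q : Site E} (f : P ⟶ Q) : f ≫ incl E Q = incl E P ≫ (cone E).map f :=
  rfl

theorem pinch_naturality {P Q : Site E} (f : P ⟶ Q) :
    (cone E).map f ≫ pinch E Q = pinch E P ≫ (susp E).map f := by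
  refine ObjectProperty.hom_ext _ (Spectrum.hom_ext fun n x => ?_)
  obtain ⟨q | q, rfl⟩ := Quot.exists_rep x
  · rfl
  · exact ((Spectrum.susp.map f.hom).app n).map_pt.symm

theorem incl_pinch (P : Site E) : incl E P ≫ pinch E P = zero _ _ := rfl

theorem susp_zero (P Q : Site E) : (susp E).map (zero P Q) = zero _ _ :=
  ObjectProperty.hom_ext _ (Spectrum.susp_map_zero _ _)

theorem cone_zero (P Q : Site E) : (cone E).map (zero P Q) = zero _ _ :=
  ObjectProperty.hom_ext _
    (Spectrum.coneMap_zero (f := 𝟙 P.obj) (f' := 𝟙 Q.obj) rfl rfl rfl)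

variable (E)

/-- The finite `E`-projective spectrum `Ωᵐ Σ^∞ K`. -/
def ofComplex (m : ℕ) (K : PtTop.{0}) (hK : PtTop.IsFiniteComplex K) (h : E.IsProjective K hK) :
    Site E :=
  ⟨(Spectrum.loopsPow m).obj (Spectrum.suspensionSpectrum K), by
    have : ∀ (m : ℕ) (P : Spectrum.{0}), IsFiniteProjective E P →
        IsFiniteProjective E ((Spectrum.loopsPow m).obj P) := by
      intro m
      induction m with
      | zero => exact fun _ hP => hP
      | succ m ih => exact fun P hP => ih _ (.loops _ hP)
    exact this m _ (.ofComplex K hK h)⟩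

/-- The sphere spectra `S^c`, `c ∈ ℤ`. -/
def sphere (c : ℤ) : Site E :=
  match c with
  | Int.ofNat n => ⟨(Spectrum.suspPow n).obj (Spectrum.suspensionSpectrum PtTop.sphereZero), by
      have : ∀ (m : ℕ) (P : Spectrum.{0}), IsFiniteProjective E P →
          IsFiniteProjective E ((Spectrum.suspPow m).obj P) := by
        intro m
        induction m with
        | zero => exact fun _ hP => hP
        | succ m ih => exact fun P hP => ih _ (.susp _ hP)
      exact this n _ .sphere⟩
  | Int.negSucc n =>
    ⟨(Spectrum.loopsPow (n + 1)).obj (Spectrum.suspensionSpectrum PtTop.sphereZero), by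
      have : ∀ (m : ℕ) (P : Spectrum.{0}), IsFiniteProjective E P →
          IsFiniteProjective E ((Spectrum.loopsPow m).obj P) := by
        intro m
        induction m with
        | zero => exact fun _ hP => hP
        | succ m ih => exact fun P hP => ih _ (.loops _ hP)
      exact this (n + 1) _ .sphere⟩

end Site

/-! ## Presheaves of spectra -/

/-- A presheaf is reduced if it sends zero maps to zero maps. -/
def IsReduced (E : RingSpectrum) : ObjectProperty ((Site E)ᵒᵖ ⥤ Spectrum.{u}) :=
  fun X => ∀ P Q : Site E, X.map (Site.zero P Q).op = Spectrum.zero _ _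

/-- Reduced presheaves of spectra on `Sp_E^fp`. -/
abbrev Psh (E : RingSpectrum) : Type (u + 1) := (IsReduced.{u} E).FullSubcategory

namespace Psh

variable {E : RingSpectrum}

/-- The value of a presheaf at a finite projective spectrum. -/
abbrev val (X : Psh.{u} E) (P : Site E) : Spectrum.{u} := X.obj.obj (Opposite.op P)

/-- The restriction along a map of finite projective spectra. -/
abbrev res (X : Psh.{u} E) {P Q : Site E} (f : P ⟶ Q) : val X Q ⟶ val X P := X.obj.map f.op

/-- The component of a map of presheaves. -/
abbrev comp {X Y : Psh.{u} E} (f : X ⟶ Y) (P : Site E) : val X P ⟶ val Y P :=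
  f.hom.app (Opposite.op P)

theorem res_id (X : Psh.{u} E) (P : Site E) : res X (𝟙 P) = 𝟙 _ := X.obj.map_id _

theorem res_comp (X : Psh.{u} E) {P Q R : Site E} (f : P ⟶ Q) (g : Q ⟶ R) :
    res X (f ≫ g) = res X g ≫ res X f := X.obj.map_comp _ _

theorem res_zero (X : Psh.{u} E) (P Q : Site E) : res X (Site.zero P Q) = Spectrum.zero _ _ :=
  X.property P Q

theorem pinch_res (X : Psh.{u} E) {P Q : Site E} (g : P ⟶ Q) :
    res X (Site.pinch E Q) ≫ res X ((Site.cone E).map g) =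
      res X ((Site.susp E).map g) ≫ res X (Site.pinch E P) := by
  rw [← res_comp, ← res_comp, Site.pinch_naturality]

theorem comp_res {X Y : Psh.{u} E} (f : X ⟶ Y) {P Q : Site E} (g : P ⟶ Q) :
    res X g ≫ comp f P = comp f Q ≫ res Y g := f.hom.naturality g.op

/-- The categorical suspension `ΣX = Σ^{1,-1}X`, computed objectwise. -/
def susp : Psh.{u} E ⥤ Psh.{u} E where
  obj X := ⟨X.obj ⋙ Spectrum.susp, fun P Q => by
    change Spectrum.susp.map (res X (Site.zero P Q)) = _
    exact (congrArg _ (X.property P Q)).trans (Spectrum.susp_map_zero _ _)⟩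
  map f := ObjectProperty.homMk (Functor.whiskerRight f.hom Spectrum.susp)
  map_id X := ObjectProperty.hom_ext _ (by ext; simp)
  map_comp f g := ObjectProperty.hom_ext _ (by ext; simp)

/-- The cofiber of a map of presheaves, computed objectwise. -/
def cone {X Y : Psh.{u} E} (f : X ⟶ Y) : Psh.{u} E where
  obj :=
    { obj := fun P => Spectrum.cone (comp f P.unop)
      map := fun {P Q} g => Spectrum.coneMap (X.obj.map g) (Y.obj.map g) (f.hom.naturality g).symm
      map_id := fun P => Spectrum.coneMap_id (f.hom.naturality _).symm (X.obj.map_id P)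
        (Y.obj.map_id P)
      map_comp := fun g h => Spectrum.coneMap_comp (f.hom.naturality _).symm
        (f.hom.naturality _).symm (f.hom.naturality _).symm (X.obj.map_comp g h) (Y.obj.map_comp g h) }
  property P Q := Spectrum.coneMap_zero (comp_res f _).symm (X.property P Q) (Y.property P Q)

/-- The map from the target of `f` to its cofiber. -/
def coneIncl {X Y : Psh.{u} E} (f : X ⟶ Y) : Y ⟶ cone f :=
  ObjectProperty.homMk { app := fun _ => Spectrum.coneIncl _, naturality := fun _ _ _ => rfl }

/-- The connecting map from the cofiber of `f : X → Y` to `ΣX`. -/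
def conePinch {X Y : Psh.{u} E} (f : X ⟶ Y) : cone f ⟶ susp.obj X :=
  ObjectProperty.homMk
    { app := fun P => Spectrum.conePinch _
      naturality := fun P Q g => by
        refine Spectrum.hom_ext fun n x => ?_
        obtain ⟨q | q, rfl⟩ := Quot.exists_rep x
        · rfl
        · exact ((Spectrum.susp.map (X.obj.map g)).app n).map_pt.symm }

/-- Functoriality of cofibers for commutative squares. -/
def coneMap {X Y X' Y' : Psh.{u} E} {f : X ⟶ Y} {f' : X' ⟶ Y'} (a : X ⟶ X') (b : Y ⟶ Y')
    (h : f ≫ b = a ≫ f') : cone f ⟶ cone f' :=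
  ObjectProperty.homMk
    { app := fun P => Spectrum.coneMap (a.hom.app P) (b.hom.app P)
        (congrArg (fun k : X ⟶ Y' => k.hom.app P) h)
      naturality := fun _ _ g => Spectrum.coneMap_square
        (f.hom.naturality g).symm _ _ (f'.hom.naturality g).symm (a.hom.naturality g)
        (b.hom.naturality g) }

/-- The bigraded suspension `DX = Σ^{0,-1}X`, given by `P ↦ Σ X(ΣP)`. The model used here is the
cofiber of `X(ΣP) → X(CP)`; collapsing `X(CP)`, which is contractible for a synthetic spectrum `X`,
identifies it with `Σ X(ΣP)`. -/
def D : Psh.{u} E ⥤ Psh.{u} E where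
  obj X :=
    { obj :=
        { obj := fun P => Spectrum.cone (res X (Site.pinch E P.unop))
          map := fun g => Spectrum.coneMap (res X ((Site.susp E).map g.unop))
            (res X ((Site.cone E).map g.unop)) (pinch_res X _)
          map_id := fun P => Spectrum.coneMap_id (pinch_res X _)
            ((congrArg (res X) ((Site.susp E).map_id _)).trans (res_id X _))
            ((congrArg (res X) ((Site.cone E).map_id _)).trans (res_id X _))
          map_comp := fun g h => Spectrum.coneMap_comp (pinch_res X _) (pinch_res X _)
            (pinch_res X _) ((congrArg (res X) ((Site.susp E).map_comp _ _)).trans (res_comp X _ _))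
            ((congrArg (res X) ((Site.cone E).map_comp _ _)).trans (res_comp X _ _)) }
      property := fun P Q => Spectrum.coneMap_zero (pinch_res X _)
        ((congrArg (res X) (Site.susp_zero P Q)).trans (res_zero X _ _))
        ((congrArg (res X) (Site.cone_zero P Q)).trans (res_zero X _ _)) }
  map f := ObjectProperty.homMk
    { app := fun P => Spectrum.coneMap (comp f _) (comp f _) (comp_res f _)
      naturality := fun _ _ g => Spectrum.coneMap_square (pinch_res _ _) (comp_res f _)
        (comp_res f _) (pinch_res _ _) (comp_res f _) (comp_res f _) }
  map_id X := ObjectProperty.hom_ext _ (NatTrans.ext (funext fun _ =>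
    Spectrum.coneMap_id (comp_res (𝟙 X) _) rfl rfl))
  map_comp f g := ObjectProperty.hom_ext _ (NatTrans.ext (funext fun _ =>
    Spectrum.coneMap_comp (comp_res f _) (comp_res g _) (comp_res (f ≫ g) _) rfl rfl))

/-- The map `τ : Σ^{0,-1}X → X`, the comparison `Σ X(ΣP) → X(P)`: the composite
`X(ΣP) → X(CP) → X(P)` is zero, so that `X(CP) → X(P)` extends to the cofiber of
`X(ΣP) → X(CP)`. -/
def tau : D (E := E) ⟶ 𝟭 (Psh.{u} E) where
  app X := ObjectProperty.homMk
    { app := fun P => Spectrum.coneDesc _ (res X (Site.incl E P.unop)) (by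
        rw [← Functor.map_comp, ← op_comp, Site.incl_pinch]
        exact X.property _ _)
      naturality := fun P Q g => by
        have hg : res X ((Site.cone E).map g.unop) ≫ res X (Site.incl E Q.unop) =
            res X (Site.incl E P.unop) ≫ X.obj.map g := by
          rw [← Functor.map_comp, ← op_comp, ← Site.incl_naturality]
          exact X.obj.map_comp _ _
        refine Spectrum.hom_ext fun n x => ?_
        obtain ⟨q | q, rfl⟩ := Quot.exists_rep x
        · exact ((X.obj.map g).app n).map_pt.symm
        · exact congrArg (fun k => (Spectrum.Hom.app k n).toFun q) hg }
  naturality X Y f := by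
    refine ObjectProperty.hom_ext _ (NatTrans.ext (funext fun P => Spectrum.hom_ext fun n x => ?_))
    obtain ⟨q | q, rfl⟩ := Quot.exists_rep x
    · exact ((comp f P.unop).app n).map_pt.symm
    · exact congrArg (fun k => (Spectrum.Hom.app k n).toFun q) (comp_res f _).symm

/-- The interchange `D(cone f) → cone (Df)`. -/
def dCone {X Y : Psh.{u} E} (f : X ⟶ Y) : D.obj (cone f) ⟶ cone (D.map f) :=
  ObjectProperty.homMk
    { app := fun P => Spectrum.coneSwap (f := comp f ((Site.susp E).obj P.unop))
        (f' := comp f ((Site.cone E).obj P.unop)) (res X (Site.pinch E P.unop))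
        (res Y (Site.pinch E P.unop)) (comp_res f _).symm
      naturality := fun P Q g => by
        refine Spectrum.hom_ext fun n x => ?_
        obtain ⟨⟨s, y⟩ | y, rfl⟩ := Quot.exists_rep x
        · obtain ⟨q | q, rfl⟩ := Quot.exists_rep y <;> rfl
        · obtain ⟨q | q, rfl⟩ := Quot.exists_rep y <;> rfl }

/-- The interchange `Σ(cone f) → cone (Σf)`. -/
def suspCone {X Y : Psh.{u} E} (f : X ⟶ Y) : susp.obj (cone f) ⟶ cone (susp.map f) :=
  ObjectProperty.homMk
    { app := fun _ => Spectrum.suspCone _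
      naturality := fun _ _ g => Spectrum.suspCone_naturality (X.obj.map g) (Y.obj.map g)
        (f.hom.naturality g).symm
        (Spectrum.susp_square (f.hom.naturality g).symm) }

/-- The interchange `ΣDX → DΣX`. -/
def suspD (X : Psh.{u} E) : susp.obj (D.obj X) ⟶ D.obj (susp.obj X) :=
  ObjectProperty.homMk
    { app := fun _ => Spectrum.suspCone _
      naturality := fun _ _ g => Spectrum.suspCone_naturality _ _ (pinch_res X g.unop)
        (Spectrum.susp_square (pinch_res X g.unop)) }

theorem suspD_tau (X : Psh.{u} E) : suspD X ≫ tau.app (susp.obj X) = susp.map (tau.app X) := by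
  refine ObjectProperty.hom_ext _ (NatTrans.ext (funext fun P => Spectrum.hom_ext fun n x => ?_))
  obtain ⟨⟨s, y⟩, rfl⟩ := Quot.exists_rep x
  obtain ⟨q | q, rfl⟩ := Quot.exists_rep y
  · exact (Quot.sound (PtTop.SuspRel.base _)).symm
  · rfl

end Psh

/-! ## Synthetic spectra -/

/-- A reduced presheaf of spectra on `Sp_E^fp` is (a strict model of) a synthetic spectrum if it
* sends stable equivalences to stable equivalences,
* is spherical: it sends finite coproducts to products,
* is a sheaf: for a cofiber sequence `K → L → C` in `Sp_E^fp` for which `E_*L → E_*C` is surjective,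
  `X(C) → X(L) → X(K)` is a fiber sequence. This is expressed by saying that the square with
  corners `X(C)`, `X(L)`, `X(CK)`, `X(K)` is homotopy cocartesian. -/
structure IsSynthetic {E : RingSpectrum} (X : Psh.{u} E) : Prop where
  homotopical : ∀ {P Q : Site E} (f : P ⟶ Q), Spectrum.IsStableEquiv f.hom →
    Spectrum.IsStableEquiv (X.res f)
  spherical : ∀ {P Q R : Site E} (i : P ⟶ R) (j : Q ⟶ R),
    Nonempty (Limits.IsColimit (Limits.BinaryCofan.mk i j)) → ∀ k : ℤ,
    Function.Bijective fun x : (Spectrum.π k).obj (X.val R) =>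
      ((Spectrum.π k).map (X.res i) x, (Spectrum.π k).map (X.res j) x)
  sheaf : ∀ (m : ℕ) {K L : PtTop.{0}} (f : K ⟶ L) (hK : PtTop.IsFiniteComplex K)
    (hL : PtTop.IsFiniteComplex L) (pK : E.IsProjective K hK) (pL : E.IsProjective L hL),
    E.IsProjective (PtTop.cone f) (.cone f hK hL) → E.IsHomologySurjective (PtTop.coneIncl f) →
    ∀ (F : Site.ofComplex E m K hK pK ⟶ Site.ofComplex E m L hL pL),
    F.hom = (Spectrum.loopsPow m).map (Spectrum.suspensionMap f) →
    ∀ hC : IsFiniteProjective E (Spectrum.cone F.hom),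
    Spectrum.IsStableEquiv (Spectrum.coneMap
      (f := X.res (Q := ⟨Spectrum.cone F.hom, hC⟩)
        (ObjectProperty.homMk (Spectrum.coneIncl F.hom)))
      (f' := X.res (Site.incl E (Site.ofComplex E m K hK pK)))
      (X.res (P := (Site.cone E).obj _) (Q := ⟨Spectrum.cone F.hom, hC⟩)
        (ObjectProperty.homMk (Spectrum.coneMap (𝟙 _) F.hom rfl)))
      (X.res F)
      (by rw [← Functor.map_comp, ← Functor.map_comp]; rfl))

/-- Synthetic spectra, as a property of presheaves. -/
def isSynthetic (E : RingSpectrum) : ObjectProperty (Psh.{u} E) := fun X => IsSynthetic X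

/-- The category `Syn_E` of synthetic spectra based on `E`. Since the conditions only involve finite
homotopy limits of spectra, cofibers in `Syn_E` are computed objectwise. -/
abbrev Syn (E : RingSpectrum) : Type (u + 1) := (isSynthetic.{u} E).FullSubcategory

/-! ## Powers of `τ` and the quotients `X/τⁿ` -/

namespace Psh

variable {E : RingSpectrum}

/-- The bigraded suspension `Dⁿ = Σ^{0,-n}`. -/
def Dpow : ℕ → Psh.{u} E ⥤ Psh.{u} E
  | 0 => 𝟭 _
  | n + 1 => Dpow n ⋙ D

/-- The map `τⁿ : Σ^{0,-n}X → X`. -/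
def tauPow : ∀ n : ℕ, Dpow n ⟶ 𝟭 (Psh.{u} E)
  | 0 => 𝟙 _
  | n + 1 =>
    { app := fun X => D.map ((tauPow n).app X) ≫ tau.app X
      naturality := fun X Y f => by
        have h := (tauPow n).naturality f
        have ht := tau.naturality f
        dsimp only [Dpow, Functor.comp_map, Functor.id_map] at h ht ⊢
        rw [← Category.assoc, ← D.map_comp, h, D.map_comp, Category.assoc, ht, Category.assoc] }

/-- The map `τ : Σ^{0,-(n+1)}X → Σ^{0,-n}X`. -/
def tauStep : ∀ n : ℕ, Dpow (n + 1) ⟶ Dpow (E := E) n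
  | 0 => tau
  | n + 1 => Functor.whiskerRight (tauStep n) D

/-- The map `τⁱ : Σ^{0,-(m+i)}X → Σ^{0,-m}X`. -/
def tauFrom (m : ℕ) : ∀ i : ℕ, Dpow (m + i) ⟶ Dpow (E := E) m
  | 0 => 𝟙 _
  | i + 1 => tauStep (m + i) ≫ tauFrom m i

theorem tauStep_tauPow (n : ℕ) (X : Psh.{u} E) :
    (tauStep n).app X ≫ (tauPow n).app X = (tauPow (n + 1)).app X := by
  induction n with
  | zero =>
    change tau.app X ≫ 𝟙 X = D.map (𝟙 X) ≫ tau.app X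
    rw [D.map_id]
    exact (Category.comp_id (tau.app X)).trans (Category.id_comp (tau.app X)).symm
  | succ n ih =>
    change D.map ((tauStep n).app X) ≫ D.map ((tauPow n).app X) ≫ tau.app X =
      D.map ((tauPow (n + 1)).app X) ≫ tau.app X
    rw [← Category.assoc, ← D.map_comp, ih]

theorem tauFrom_tauPow (m i : ℕ) (X : Psh.{u} E) :
    (tauFrom m i).app X ≫ (tauPow m).app X = (tauPow (m + i)).app X := by
  induction i with
  | zero => exact Category.id_comp _
  | succ i ih =>
    change ((tauStep (m + i)).app X ≫ (tauFrom m i).app X) ≫ (tauPow m).app X = _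
    rw [Category.assoc, ih, tauStep_tauPow]
    rfl

/-- The quotient `X/τⁿ = Cτⁿ ⊗ X`, the cofiber of `τⁿ : Σ^{0,-n}X → X`. -/
def quot (X : Psh.{u} E) (n : ℕ) : Psh.{u} E := cone ((tauPow n).app X)

/-- The reduction map `X → X/τⁿ`. -/
def toQuot (X : Psh.{u} E) (n : ℕ) : X ⟶ quot X n := coneIncl ((tauPow n).app X)

/-- The connecting map `X/τⁿ → Σ^{1,-n-1}X`. -/
def quotDelta (X : Psh.{u} E) (n : ℕ) : quot X n ⟶ susp.obj ((Dpow n).obj X) :=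
  conePinch ((tauPow n).app X)

/-- The map `X/τⁿ → Y/τⁿ` induced by `f : X → Y`. -/
def quotMap {X Y : Psh.{u} E} (f : X ⟶ Y) (n : ℕ) : quot X n ⟶ quot Y n :=
  coneMap ((Dpow n).map f) f ((tauPow n).naturality f).symm

/-- The reduction map `X/τ^{m+i} → X/τ^m`. -/
def red (X : Psh.{u} E) (m i : ℕ) : quot X (m + i) ⟶ quot X m :=
  coneMap ((tauFrom m i).app X) (𝟙 X) ((Category.comp_id _).trans (tauFrom_tauPow m i X).symm)

/-- The map `τ : Σ^{0,-1}(X/τⁿ) → X/τ^{n+1}`. -/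
def quotTau (X : Psh.{u} E) (n : ℕ) : D.obj (quot X n) ⟶ quot X (n + 1) :=
  dCone ((tauPow n).app X) ≫ coneMap (𝟙 _) (tau.app X) (Category.id_comp _).symm

/-- The map `τˢ : Σ^{0,-s}(X/τⁿ) → X/τ^{n+s}`. -/
def quotTauPow (X : Psh.{u} E) (n : ℕ) : ∀ s : ℕ, (Dpow s).obj (quot X n) ⟶ quot X (n + s)
  | 0 => 𝟙 _
  | s + 1 => D.map (quotTauPow X n s) ≫ quotTau X (n + s)

/-- The canonical isomorphism `Σ(X/τ) → (ΣX)/τ`. -/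
def suspQuot (X : Psh.{u} E) : susp.obj (quot X 1) ⟶ quot (susp.obj X) 1 :=
  suspCone ((tauPow 1).app X) ≫ coneMap (suspD X) (𝟙 _) (by
    change susp.map (D.map (𝟙 X) ≫ tau.app X) ≫ 𝟙 _ =
      suspD X ≫ D.map (𝟙 _) ≫ tau.app (susp.obj X)
    rw [D.map_id, D.map_id, Category.comp_id]
    erw [Category.id_comp, Category.id_comp]
    exact (suspD_tau X).symm)

/-! ## Bigraded homotopy groups -/

/-- The bigraded homotopy groups `π_{a,b}X = π_{-b}(X(S^{a+b}))`. -/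
def pi (a b : ℤ) : Psh.{u} E ⥤ AddCommGrpCat.{u} :=
  (IsReduced.{u} E).ι ⋙ (evaluation _ _).obj (Opposite.op (Site.sphere E (a + b))) ⋙ Spectrum.π (-b)

/-- The suspension isomorphism `π_{a,b}X → π_{a+1,b-1}(ΣX)`. -/
def suspIso (X : Psh.{u} E) (a b : ℤ) : (pi a b).obj X →+ (pi (a + 1) (b - 1)).obj (susp.obj X) :=
  (eqToHom (by
    have h₁ : a + 1 + (b - 1) = a + b := by ring
    have h₂ : -(b - 1) = -b + 1 := by ring
    change _ = (Spectrum.π (-(b - 1))).obj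
      (Spectrum.susp.obj (X.val (Site.sphere E (a + 1 + (b - 1)))))
    rw [h₁, h₂]) : (Spectrum.π (-b + 1)).obj (Spectrum.susp.obj (X.val (Site.sphere E (a + b)))) ⟶
      (pi (a + 1) (b - 1)).obj (susp.obj X)).hom.comp
    (Spectrum.suspHom (X.val (Site.sphere E (a + b))) (-b))

/-! ## The Adams spectral sequence of a synthetic spectrum and hidden extensions

The Adams spectral sequence of `X` is the `τ`-Bockstein spectral sequence with a change of sign. Its
`E₂` page is `π_{*,*}(X/τ)`, and the differential `d_r` decreases `a` by one and increases `b` by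
`r`. Since `π_{a-1,b+r}(Z) = π_{a,b}(Σ^{1,-r}Z)` and `Σ^{1,-r} = Σ D^{r-1}`, the targets of `d_r`
on `π_{a,b}(X/τ)` are taken in `π_{a,b}(Σ D^{r-1}(X/τ))`. -/

/-- `d_r(x) = z`, i.e. `z` represents `d_r(x)`: there is `w` with `δx = τ^{r-2}w` whose reduction
modulo `τ` is `-z`. (There is no `d₀` or `d₁`.) -/
def IsDifferential {X : Psh.{u} E} {a b : ℤ} : ∀ (r : ℕ) (_ : (pi a b).obj (quot X 1))
    (_ : (pi a b).obj (susp.obj ((Dpow (r - 1)).obj (quot X 1)))), Prop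
  | q + 2, x, z => ∃ w : (pi a b).obj (susp.obj ((Dpow (q + 1)).obj X)),
      (pi a b).map (quotDelta X 1) x = (pi a b).map (susp.map (D.map ((tauPow q).app X))) w ∧
      (pi a b).map (susp.map ((Dpow (q + 1)).map (toQuot X 1))) w = -z
  | _, _, _ => False

/-- `x` survives to the `E_r` page, `r ≥ 2`: a differential `d_r(x)` is defined. -/
def Survives {X : Psh.{u} E} {a b : ℤ} (r : ℕ) (x : (pi a b).obj (quot X 1)) : Prop :=
  ∃ z, IsDifferential r x z

/-- Equality on the `E_r` page, `r ≤ n + 2`, of elements of the target of `d_{n+1}`: the difference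
is in the subgroup of images of `d_2, …, d_{r-1}`, which are the reductions of the elements `v`
with `τ^{r-2}v = 0`. For `r ≤ 2` this is equality. -/
def EqOnPage {X : Psh.{u} E} {a b : ℤ} (r n : ℕ)
    (z z' : (pi a b).obj (susp.obj ((Dpow n).obj (quot X 1)))) : Prop :=
  ∃ (j : ℕ) (h : n = j + (r - 2)) (v : (pi a b).obj (susp.obj ((Dpow n).obj X))),
    (pi a b).map (susp.map (eqToHom (by rw [h]) ≫ (tauFrom j (r - 2)).app X)) v = 0 ∧
    z - z' = (pi a b).map (susp.map ((Dpow n).map (toQuot X 1))) v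

/-- There is a hidden `α`-extension by `s` from `x ∈ π_{a,b}(X/τ)` to
`y ∈ π_{a,b+s}(Y/τ) = π_{a,b}(Σ^{0,-s}(Y/τ))` on the `E_r` page: `s < r - 1`, the class `x` survives
to the `E_r` page, and there are a lift of `x` to `X/τ^{r-1}` and a lift of `y` to `Y/τ^{r-1-s}` such
that `α` maps the former to `τˢ` times the latter. Here `r - 1 = 1 + i + s`. -/
def HiddenExtension {X Y : Psh.{u} E} (α : X ⟶ Y) {a b : ℤ} (s r : ℕ)
    (x : (pi a b).obj (quot X 1)) (y : (pi a b).obj ((Dpow s).obj (quot Y 1))) : Prop :=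
  ∃ i : ℕ, r = 1 + i + s + 1 ∧ Survives r x ∧
    ∃ (x' : (pi a b).obj (quot X (1 + i + s))) (y' : (pi a b).obj ((Dpow s).obj (quot Y (1 + i)))),
      (pi a b).map (red X (1 + i) s ≫ red X 1 i) x' = x ∧
      (pi a b).map ((Dpow s).map (red Y 1 i)) y' = y ∧
      (pi a b).map (quotMap α (1 + i + s)) x' = (pi a b).map (quotTauPow Y (1 + i) s) y'

end Psh

end Synth

end

open Synth

/-! Write `D` for `Σ^{0,-1}` and `Cα` for the cofiber of `α`. By hypothesis the `τ`-boundary of `x̄`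
is `τ^{k-1} w`, where `w` reduces modulo `τ` to minus a representative of `d_{k+1}(x̄)`. Equality
with `ι_α y` on the `E_k` page means that this representative differs from `ι_α y` by the reduction
of some `v` killed by `τ^{k-2}`. Replacing `w` by `w - v` leaves the boundary equation intact and
makes the reduction exactly `-ι_α y`.

Divisibility of the boundary by `τ^{k-1}` lifts `x̄` to a class of `Cα/τ^k` with boundary `w`
(`IsConeExact.exists_lift`). Now `Cα/τ^k` is the total cofiber of the square formed by `α` and `τ^k`
on `X` and `Y`. That square maps to the square with rows `D^k(X/τ) → D^k(Y/τ)` and `X/τ^{k+1} →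
Y/τ^{k+1}` and vertical maps `τ^k`. Let `ξ` be the image of the lift in the total cofiber of the
second square. Its boundary in the suspended cofiber of the upper row is `-ι y`, so it comes from
the corner `D^k(Y/τ)`. By `exists_of_total` such a `ξ` yields a class `z` of `X/τ^{k+1}` with `α z =
τ^k y` in `Y/τ^{k+1}`, and the image of `z` in the cofiber of the left column is the other boundary
of `ξ`. Reduced modulo `τ`, that other boundary is `δ_α x̄ = x`. Hence `z` lifts `x`, which also
gives survival to the `E_{k+2}` page (`survives_of_lift`). The argument is
`Spectrum.exists_lift_with_image`, applied to values of presheaves at a sphere in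
`Psh.exists_lift_with_image`.

All cofibers are strict mapping cones and the squares involved commute strictly, so the homotopy
theory enters only through two facts about sequential spectra: exactness of stable homotopy groups
on mapping cones (`isConeExact_π`) and bijectivity of the suspension homomorphism
(`suspHom_bijective`). Both are proved with explicit maps of cubes. Signs caused by exchanging
coordinates are controlled by rotating a square through maps preserving its boundary
(`exists_rotation`). -/

noncomputable section

namespace Synth

section

open PtTop

/-! ## Cubical representatives of stable homotopy classes -/

namespace Spectrum

/-- A point of the `n`-fold loop spectrum, evaluated on the `n`-cube. -/
def evalPow : ∀ (n : ℕ) (Z : Spectrum.{u}) (j : ℕ), ((loopsPow n).obj Z).level j →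
    (Fin n → unitInterval) → Z.level j
  | 0, _, _, w, _ => w
  | n + 1, Z, j, w, u => PtTop.eval (A := Z.level j)
      (evalPow n (loops.obj Z) j w fun i => u i.succ) (u 0)

theorem continuous_eval {A : PtTop.{u}} :
    Continuous fun p : PtTop.loops A × unitInterval => PtTop.eval p.1 p.2 :=
  (Path.continuous_uncurry_iff (X := A) (x := A.pt) (y := A.pt)
    (g := fun w : Path A.pt A.pt => w)).mpr continuous_id

theorem continuous_evalPow (n : ℕ) (Z : Spectrum.{u}) (j : ℕ) :
    Continuous fun p : ((loopsPow n).obj Z).level j × (Fin n → unitInterval) =>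
      evalPow n Z j p.1 p.2 := by
  induction n generalizing Z with
  | zero => exact continuous_fst
  | succ n ih =>
    exact continuous_eval.comp (((ih (loops.obj Z)).comp
      (continuous_fst.prodMk (by fun_prop))).prodMk (by fun_prop))

theorem evalPow_pt (n : ℕ) (Z : Spectrum.{u}) (j : ℕ) (u : Fin n → unitInterval) :
    evalPow n Z j ((loopsPow n).obj Z |>.level j).pt u = (Z.level j).pt := by
  induction n generalizing Z with
  | zero => rfl
  | succ n ih => exact congrArg (fun w => PtTop.eval w (u 0)) (ih (loops.obj Z) _)

theorem evalPow_boundary (n : ℕ) (Z : Spectrum.{u}) (j : ℕ) (w : ((loopsPow n).obj Z).level j)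
    (u : Fin n → unitInterval) (hu : u ∈ Cube.boundary (Fin n)) :
    evalPow n Z j w u = (Z.level j).pt := by
  induction n generalizing Z with
  | zero => obtain ⟨i, -⟩ := hu; exact i.elim0
  | succ n ih =>
    obtain ⟨i, hi⟩ := hu
    induction i using Fin.cases with
    | zero =>
      rcases hi with hi | hi
      · exact (congrArg _ hi).trans (Path.source _)
      · exact (congrArg _ hi).trans (Path.target _)
    | succ i => exact congrArg (fun w => PtTop.eval w (u 0)) (ih (loops.obj Z) w _ ⟨i, hi⟩)

theorem evalPow_injective (n : ℕ) (Z : Spectrum.{u}) (j : ℕ) :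
    Function.Injective (evalPow n Z j) := by
  induction n generalizing Z with
  | zero => exact fun w w' h => congrFun h Fin.elim0
  | succ n ih =>
    refine fun w w' h => ih (loops.obj Z) (funext fun u => Path.ext (funext fun t => ?_))
    exact congrFun h (Fin.cons t u)

/-- The exponential law for cubes, in families over an arbitrary space `T`; taking `T` to be a cube,
or a cube times an interval, gives loops and homotopies. The first cube coordinate is the innermost
loop, because `loopsPow (n + 1)` loops once before applying `loopsPow n`. -/
theorem exists_evalPow (n : ℕ) (Z : Spectrum.{u}) (j : ℕ) {T : Type*} [TopologicalSpace T]
    (G : T → (Fin n → unitInterval) → Z.level j) (hG : Continuous fun p : T × _ => G p.1 p.2)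
    (hb : ∀ t, ∀ u ∈ Cube.boundary (Fin n), G t u = (Z.level j).pt) :
    ∃ g : T → ((loopsPow n).obj Z).level j, Continuous g ∧ ∀ t u, evalPow n Z j (g t) u = G t u := by
  induction n generalizing Z with
  | zero =>
    refine ⟨fun t => G t Fin.elim0, hG.comp (continuous_id.prodMk continuous_const), fun t u => ?_⟩
    exact congrArg (G t) (Subsingleton.elim _ _)
  | succ n ih =>
    obtain ⟨g, hg, hg'⟩ := ih (loops.obj Z) (fun t u =>
      ({ toFun := fun s => G t (Fin.cons s u)
         continuous_toFun := hG.comp (continuous_const.prodMk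
          (continuous_id.finCons continuous_const))
         source' := hb _ _ ⟨0, Or.inl (by simp)⟩
         target' := hb _ _ ⟨0, Or.inr (by simp)⟩ } : Path (Z.level j).pt (Z.level j).pt))
      (Path.continuous_uncurry_iff.mp (hG.comp ((continuous_fst.comp continuous_fst).prodMk
        (continuous_snd.finCons (continuous_snd.comp continuous_fst)))))
      (by
        rintro t u ⟨i, hi⟩
        refine Path.ext (funext fun s => hb _ _ ⟨i.succ, ?_⟩)
        simpa using hi)
    refine ⟨g, hg, fun t u => ?_⟩
    have := congrArg (fun w => PtTop.eval w (u 0)) (hg' t fun i => u i.succ)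
    refine this.trans ?_
    change G t (Fin.cons (u 0) (Fin.tail u)) = _
    rw [Fin.cons_self_tail]

theorem evalPow_map (n : ℕ) {Z W : Spectrum.{u}} (φ : Z ⟶ W) (j : ℕ)
    (w : ((loopsPow n).obj Z).level j) (u : Fin n → unitInterval) :
    evalPow n W j ((((loopsPow n).map φ).app j).toFun w) u =
      (φ.app j).toFun (evalPow n Z j w u) := by
  induction n generalizing Z W with
  | zero => rfl
  | succ n ih => exact congrArg (fun w => PtTop.eval w (u 0)) (ih (loops.map φ) w _)

theorem evalPow_str (n : ℕ) (Z : Spectrum.{u}) (j : ℕ) (t : unitInterval)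
    (w : ((loopsPow n).obj Z).level j) (u : Fin n → unitInterval) :
    evalPow n Z (j + 1) (((loopsPow n).obj Z).str j (t, w)) u = Z.str j (t, evalPow n Z j w u) := by
  induction n generalizing Z with
  | zero => rfl
  | succ n ih => exact congrArg (fun w => PtTop.eval w (u 0)) (ih (loops.obj Z) w _)

end Spectrum

namespace PtTop

/-- Maps from the product of two cubes to a pointed space that are constant on the boundary. -/
structure IsLoop {i n : ℕ} {A : PtTop.{u}}
    (g : (Fin i → unitInterval) → (Fin n → unitInterval) → A) : Prop where
  cont : Continuous fun p : (Fin i → unitInterval) × (Fin n → unitInterval) => g p.1 p.2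
  left : ∀ s ∈ Cube.boundary (Fin i), ∀ u, g s u = A.pt
  right : ∀ s, ∀ u ∈ Cube.boundary (Fin n), g s u = A.pt

/-- Homotopies of maps that are constant on the boundary. -/
structure IsLoopHomotopy {i n : ℕ} {A : PtTop.{u}}
    (H : unitInterval → (Fin i → unitInterval) → (Fin n → unitInterval) → A) : Prop where
  cont : Continuous fun p : unitInterval × (Fin i → unitInterval) × (Fin n → unitInterval) =>
    H p.1 p.2.1 p.2.2
  left : ∀ t, ∀ s ∈ Cube.boundary (Fin i), ∀ u, H t s u = A.pt
  right : ∀ t s, ∀ u ∈ Cube.boundary (Fin n), H t s u = A.pt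

theorem IsLoop.continuous_comp {i n : ℕ} {A : PtTop.{u}}
    {g : (Fin i → unitInterval) → (Fin n → unitInterval) → A} (hg : IsLoop g) {T : Type*}
    [TopologicalSpace T] {s : T → Fin i → unitInterval} {u : T → Fin n → unitInterval}
    (hs : Continuous s) (hu : Continuous u) : Continuous fun x => g (s x) (u x) :=
  hg.cont.comp (hs.prodMk hu)

theorem IsLoopHomotopy.continuous_comp {i n : ℕ} {A : PtTop.{u}}
    {H : unitInterval → (Fin i → unitInterval) → (Fin n → unitInterval) → A}
    (hH : IsLoopHomotopy H) {T : Type*} [TopologicalSpace T] {t : T → unitInterval}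
    {s : T → Fin i → unitInterval} {u : T → Fin n → unitInterval} (ht : Continuous t)
    (hs : Continuous s) (hu : Continuous u) : Continuous fun x => H (t x) (s x) (u x) :=
  hH.cont.comp (ht.prodMk (hs.prodMk hu))

theorem IsLoopHomotopy.isLoop {i n : ℕ} {A : PtTop.{u}}
    {H : unitInterval → (Fin i → unitInterval) → (Fin n → unitInterval) → A}
    (hH : IsLoopHomotopy H) (t : unitInterval) : IsLoop (H t) :=
  ⟨hH.cont.comp (continuous_const.prodMk continuous_id), hH.left t, hH.right t⟩

end PtTop

namespace Spectrum

/-- The class of a generalised loop in the `i + 2`-nd level of the `n`-fold loop spectrum. -/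
def loopClass {Z : Spectrum.{u}} (i : ℕ)
    (w : GenLoop (Fin (i + 2)) (Z.level (i + 2)) (Z.level (i + 2)).pt) : pi0.obj Z :=
  (Limits.colimit.ι (pi0Seq.obj Z) i).hom (Additive.ofMul (PtTop.cls w))

/-- `x ∈ π_n(Z)` is represented by the cubical map `g` to the `i + 2`-nd level of `Z`. -/
def Rep {n : ℕ} {Z : Spectrum.{u}} (x : (loopsPow n ⋙ pi0).obj Z) (i : ℕ)
    (g : (Fin (i + 2) → unitInterval) → (Fin n → unitInterval) → Z.level (i + 2)) : Prop :=
  ∃ w, x = loopClass (Z := (loopsPow n).obj Z) i w ∧ ∀ s u, g s u = evalPow n Z (i + 2) (w s) u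

/-- The stabilisation of a cubical map. -/
def stabLoop {n i j : ℕ} {Z : Spectrum.{u}}
    (g : (Fin i → unitInterval) → (Fin n → unitInterval) → Z.level j) :
    (Fin (i + 1) → unitInterval) → (Fin n → unitInterval) → Z.level (j + 1) :=
  fun s u => Z.str j (s 0, g (fun k => s k.succ) u)

theorem loopClass_stab {Z : Spectrum.{u}} (i : ℕ)
    (w : GenLoop (Fin (i + 2)) (Z.level (i + 2)) (Z.level (i + 2)).pt) :
    loopClass (i + 1) (genLoopStab (i + 2) (Z.str (i + 2)) (Z.str_cont _) (Z.str_zero _)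
      (Z.str_one _) (Z.str_pt _) w) = loopClass i w := by
  have h := Limits.colimit.w (pi0Seq.obj Z) (homOfLE (Nat.le_succ i))
  have h' := congrArg (fun k => k.hom (Additive.ofMul (PtTop.cls w))) h
  refine Eq.trans ?_ h'
  have e : (pi0Seq.obj Z).map (homOfLE (Nat.le_succ i)) = AddCommGrpCat.ofHom (stab Z i) :=
    Functor.ofSequence_map_homOfLE_succ _ i
  exact congrArg (fun k => (k ≫ Limits.colimit.ι (pi0Seq.obj Z) (i + 1)).hom
    (Additive.ofMul (PtTop.cls w))) e.symm

theorem loopClass_map {Z W : Spectrum.{u}} (φ : Z ⟶ W) (i : ℕ)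
    (w : GenLoop (Fin (i + 2)) (Z.level (i + 2)) (Z.level (i + 2)).pt) :
    pi0.map φ (loopClass i w) = loopClass i (genLoopMap _ (φ.app (i + 2)) w) := by
  have h := Limits.ι_colimMap (pi0Seq.map φ) i
  exact congrArg (fun k => k.hom (Additive.ofMul (PtTop.cls w))) h

/-- Needed to describe elements of the colimit, and equality between them, at finite stages. The
index category `ℕ` is smaller than the universe `u` of the groups, hence the change of size. -/
instance preservesColimit_pi0Seq (Z : Spectrum.{u}) :
    Limits.PreservesColimit (pi0Seq.obj Z) (forget AddCommGrpCat.{u}) :=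
  haveI := Limits.preservesFilteredColimitsOfSize_shrink.{0, u, 0, u} (forget AddCommGrpCat.{u})
  inferInstance

/-- The representative `w` is stabilised `d` times in `Z`, and `φ` commutes strictly with the
structure maps, so the image of the stabilisation is the stabilisation of the image. The stage `k`
is kept as a free variable so that the induction moves `i` to `i + 1` without changing it. -/
theorem homotopy_of_map_loopClass {i k : ℕ} (d : ℕ) (hk : k = i + d) {Z W : Spectrum.{u}}
    (φ : Z ⟶ W)
    (w : GenLoop (Fin (i + 2)) (Z.level (i + 2)) (Z.level (i + 2)).pt)
    (h : ((pi0Seq.obj W).map (homOfLE (hk ▸ Nat.le_add_right i d) : i ⟶ k)).hom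
      (Additive.ofMul (PtTop.cls (genLoopMap _ (φ.app (i + 2)) w))) = 0) :
    ∃ w' : GenLoop (Fin (k + 2)) (Z.level (k + 2)) (Z.level (k + 2)).pt,
      loopClass k w' = loopClass i w ∧
        GenLoop.Homotopic GenLoop.const (genLoopMap _ (φ.app (k + 2)) w') := by
  induction d generalizing i with
  | zero =>
    obtain rfl : k = i := hk
    refine ⟨w, rfl, ?_⟩
    have e : (pi0Seq.obj W).map (homOfLE le_rfl : k ⟶ k) = 𝟙 _ := (pi0Seq.obj W).map_id k
    have h' := (congrArg (fun f => f.hom (Additive.ofMul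
      (PtTop.cls (genLoopMap _ (φ.app (k + 2)) w)))) e).symm.trans h
    exact Quotient.exact (s := GenLoop.Homotopic.setoid _ _) (Additive.ofMul.injective h').symm
  | succ d ih =>
    obtain ⟨w', h₁, h₂⟩ := ih (i := i + 1) (by omega) (genLoopStab (i + 2) (Z.str (i + 2))
      (Z.str_cont _) (Z.str_zero _) (Z.str_one _) (Z.str_pt _) w) (by
      have e : (pi0Seq.obj W).map (homOfLE (hk ▸ Nat.le_add_right i _) : i ⟶ k) =
          AddCommGrpCat.ofHom (Spectrum.stab W i) ≫
            (pi0Seq.obj W).map (homOfLE (by omega) : i + 1 ⟶ k) := by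
        have e' : (pi0Seq.obj W).map (homOfLE (Nat.le_succ i)) = AddCommGrpCat.ofHom (stab W i) :=
          Functor.ofSequence_map_homOfLE_succ _ i
        exact ((pi0Seq.obj W).map_comp (homOfLE (Nat.le_succ i)) (homOfLE (by omega))).trans
          (congrArg (fun q => q ≫ (pi0Seq.obj W).map (homOfLE (by omega) : i + 1 ⟶ k)) e')
      rw [e] at h
      refine Eq.trans (congrArg _ ?_) h
      refine congrArg Additive.ofMul (congrArg PtTop.cls (GenLoop.ext _ _ fun s => ?_))
      exact φ.comm _ _ _)
    exact ⟨w', h₁.trans (loopClass_stab i w), h₂⟩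

namespace Rep

variable {n : ℕ} {Z W : Spectrum.{u}} {i : ℕ}
  {g : (Fin (i + 2) → unitInterval) → (Fin n → unitInterval) → Z.level (i + 2)}
  {x : (loopsPow n ⋙ pi0).obj Z}

theorem isLoop (h : Rep x i g) : IsLoop g := by
  obtain ⟨w, -, hw⟩ := h
  obtain rfl : g = fun s u => evalPow n Z (i + 2) (w s) u := funext fun s => funext fun u => hw s u
  refine ⟨(continuous_evalPow n Z _).comp ((w.1.continuous.comp continuous_fst).prodMk
    continuous_snd), fun s hs u => ?_, fun s u hu => evalPow_boundary _ _ _ _ _ hu⟩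
  exact (congrArg (fun k => evalPow n Z (i + 2) k u) (w.2 s hs)).trans (evalPow_pt ..)

theorem of_isLoop (hg : IsLoop g) : ∃ x : (loopsPow n ⋙ pi0).obj Z, Rep x i g := by
  obtain ⟨w, hw, hw'⟩ := exists_evalPow n Z (i + 2) g hg.cont hg.right
  refine ⟨_, ⟨⟨w, hw⟩, fun s hs => evalPow_injective n Z _ (funext fun u => ?_)⟩, rfl,
    fun s u => (hw' s u).symm⟩
  exact (hw' s u).trans ((hg.left s hs u).trans (evalPow_pt ..).symm)

theorem map (φ : Z ⟶ W) (h : Rep x i g) :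
    Rep ((loopsPow n ⋙ pi0).map φ x) i fun s u => (φ.app (i + 2)).toFun (g s u) := by
  obtain ⟨w, rfl, hw⟩ := h
  refine ⟨genLoopMap _ (((loopsPow n).map φ).app (i + 2)) w, loopClass_map _ _ _, fun s u => ?_⟩
  exact (congrArg (φ.app (i + 2)).toFun (hw s u)).trans (evalPow_map ..).symm

theorem stab (h : Rep x i g) : Rep x (i + 1) (stabLoop g) := by
  obtain ⟨w, rfl, hw⟩ := h
  refine ⟨_, (loopClass_stab i w).symm, fun s u => ?_⟩
  exact (congrArg (fun k => Z.str (i + 2) (s 0, k)) (hw _ u)).trans (evalPow_str ..).symm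

theorem exists_rep (x : (loopsPow n ⋙ pi0).obj Z) : ∃ i g, Rep x i g := by
  obtain ⟨i, y, hy⟩ := Limits.Concrete.colimit_exists_rep (pi0Seq.obj ((loopsPow n).obj Z)) x
  obtain ⟨w, rfl⟩ : ∃ w, Additive.ofMul (PtTop.cls w) = y := Quotient.exists_rep (Additive.toMul y)
  exact ⟨i, _, w, hy.symm, fun _ _ => rfl⟩

theorem eq_of_homotopy {g' : (Fin (i + 2) → unitInterval) → (Fin n → unitInterval) → Z.level (i + 2)}
    {x' : (loopsPow n ⋙ pi0).obj Z} (h : Rep x i g) (h' : Rep x' i g')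
    {H : unitInterval → (Fin (i + 2) → unitInterval) → (Fin n → unitInterval) → Z.level (i + 2)}
    (hH : IsLoopHomotopy H) (h₀ : ∀ s u, H 0 s u = g s u) (h₁ : ∀ s u, H 1 s u = g' s u) :
    x = x' := by
  obtain ⟨w, rfl, hw⟩ := h
  obtain ⟨w', rfl, hw'⟩ := h'
  -- Curry only the loop coordinates; the homotopy parameter and the sphere coordinates stay in the
  -- parameter space.
  obtain ⟨K, hK, hK'⟩ := exists_evalPow n Z (i + 2)
    (fun p : unitInterval × (Fin (i + 2) → unitInterval) => H p.1 p.2)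
    (hH.cont.comp ((continuous_fst.comp continuous_fst).prodMk
      ((continuous_snd.comp continuous_fst).prodMk continuous_snd)))
    (fun p => hH.right p.1 p.2)
  have e : PtTop.cls w = PtTop.cls w' := by
    refine Quotient.sound ⟨⟨⟨⟨K, hK⟩, fun s => ?_, fun s => ?_⟩, fun t s hs => ?_⟩⟩
    · exact evalPow_injective n Z _ (funext fun u => (hK' _ u).trans ((h₀ s u).trans (hw s u)))
    · exact evalPow_injective n Z _ (funext fun u => (hK' _ u).trans ((h₁ s u).trans (hw' s u)))
    · refine evalPow_injective n Z _ (funext fun u => (hK' _ u).trans ((hH.left t s hs u).trans ?_))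
      exact (evalPow_pt n Z _ u).symm.trans
        (congrArg (fun k => evalPow n Z (i + 2) k u) (w.2 s hs).symm)
  rw [loopClass, e, loopClass]

theorem unique {x' : (loopsPow n ⋙ pi0).obj Z} (h : Rep x i g) (h' : Rep x' i g) : x = x' :=
  h.eq_of_homotopy h' (H := fun _ => g) ⟨h.isLoop.cont.comp continuous_snd,
    fun _ => h.isLoop.left, fun _ => h.isLoop.right⟩ (fun _ _ => rfl) fun _ _ => rfl

theorem of_homotopy {g' : (Fin (i + 2) → unitInterval) → (Fin n → unitInterval) → Z.level (i + 2)}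
    (h : Rep x i g)
    {H : unitInterval → (Fin (i + 2) → unitInterval) → (Fin n → unitInterval) → Z.level (i + 2)}
    (hH : IsLoopHomotopy H) (h₀ : ∀ s u, H 0 s u = g s u) (h₁ : ∀ s u, H 1 s u = g' s u) :
    Rep x i g' := by
  obtain rfl : H 1 = g' := funext fun s => funext fun u => h₁ s u
  obtain ⟨x', hx'⟩ := of_isLoop (hH.isLoop 1)
  rwa [h.eq_of_homotopy hx' hH h₀ fun _ _ => rfl]

theorem zero (n : ℕ) (Z : Spectrum.{u}) (i : ℕ) :
    Rep (0 : (loopsPow n ⋙ pi0).obj Z) i fun _ _ => (Z.level (i + 2)).pt :=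
  ⟨GenLoop.const, (map_zero (Limits.colimit.ι (pi0Seq.obj ((loopsPow n).obj Z)) i).hom).symm,
    fun _ u => (evalPow_pt n Z _ u).symm⟩

theorem eq_zero (h : Rep x i g)
    {H : unitInterval → (Fin (i + 2) → unitInterval) → (Fin n → unitInterval) → Z.level (i + 2)}
    (hH : IsLoopHomotopy H) (h₀ : ∀ s u, H 0 s u = (Z.level (i + 2)).pt)
    (h₁ : ∀ s u, H 1 s u = g s u) : x = 0 :=
  ((zero n Z i).eq_of_homotopy h hH h₀ h₁).symm

theorem neg (h : Rep x i g) :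
    Rep (-x) i fun s u => g (fun k => if k = 0 then unitInterval.symm (s k) else s k) u := by
  obtain ⟨w, rfl, hw⟩ := h
  refine ⟨GenLoop.symmAt 0 w, ?_, fun s u => ?_⟩
  · refine (map_neg (Limits.colimit.ι (pi0Seq.obj ((loopsPow n).obj Z)) i).hom _).symm.trans
      (congrArg _ ?_)
    exact congrArg Additive.ofMul (HomotopyGroup.inv_spec (i := (0 : Fin (i + 2))) (p := w))
  · refine (hw _ u).trans ?_
    refine congrArg (fun k => evalPow n Z (i + 2) (w k) u) (funext fun k => ?_)
    split_ifs with hk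
    · rw [hk]
    · rfl

/-- A class in the kernel of `φ` has a representative whose image is null-homotopic. -/
theorem exists_of_map_eq_zero (φ : Z ⟶ W) (h : (loopsPow n ⋙ pi0).map φ x = 0) :
    ∃ i g H, Rep x i g ∧ IsLoopHomotopy (A := W.level (i + 2)) H ∧
      (∀ s u, H 0 s u = (W.level (i + 2)).pt) ∧
      ∀ s u, H 1 s u = (φ.app (i + 2)).toFun (g s u) := by
  obtain ⟨i, g, w, rfl, hw⟩ := exists_rep x
  have h' : loopClass i (genLoopMap _ (((loopsPow n).map φ).app (i + 2)) w) = 0 :=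
    (loopClass_map _ _ _).symm.trans h
  -- A class that vanishes in a filtered colimit vanishes at some finite stage `k`.
  obtain ⟨k, f, f', hf⟩ := (Limits.Concrete.colimit_rep_eq_iff_exists
    (pi0Seq.obj ((loopsPow n).obj W)) (Additive.ofMul (PtTop.cls (genLoopMap _
      (((loopsPow n).map φ).app (i + 2)) w)) : hgrp i _) (0 : hgrp i _)).mp
      (h'.trans (map_zero (Limits.colimit.ι (pi0Seq.obj ((loopsPow n).obj W)) i).hom).symm)
  obtain ⟨d, hd⟩ := Nat.exists_eq_add_of_le (leOfHom f)
  obtain ⟨w', h₁, ⟨H⟩⟩ := homotopy_of_map_loopClass d hd ((loopsPow n).map φ) w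
    (hf.trans (map_zero ((pi0Seq.obj ((loopsPow n).obj W)).map f').hom))
  refine ⟨k, _, fun t s u => evalPow n W (k + 2) (H (t, s)) u, ⟨w', h₁.symm, fun _ _ => rfl⟩,
    ⟨?_, fun t s hs u => ?_, fun t s u hu => evalPow_boundary _ _ _ _ _ hu⟩,
    fun s u => ?_, fun s u => ?_⟩
  · exact (continuous_evalPow n W _).comp ((H.continuous.comp (continuous_fst.prodMk
      (continuous_fst.comp continuous_snd))).prodMk (continuous_snd.comp continuous_snd))
  · exact (congrArg (fun q => evalPow n W (k + 2) q u) (H.eq_fst t hs)).trans (evalPow_pt ..)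
  · exact (congrArg (fun q => evalPow n W (k + 2) q u) (H.apply_zero s)).trans (evalPow_pt ..)
  · exact (congrArg (fun q => evalPow n W (k + 2) q u) (H.apply_one s)).trans (evalPow_map ..)

end Rep

/-- The unit `Z → ΩΣZ` adds one loop coordinate, and evaluating it turns that coordinate into the
suspension coordinate. -/
theorem Rep.suspHom {n : ℕ} {Z : Spectrum.{u}} {i : ℕ}
    {g : (Fin (i + 2) → unitInterval) → (Fin n → unitInterval) → Z.level (i + 2)}
    {x : (loopsPow n ⋙ pi0).obj Z} (h : Rep x i g) :
    Rep (n := n + 1) (Z := susp.obj Z) (Spectrum.suspHom Z (Int.ofNat n) x) i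
      fun s u => Quot.mk _ (u 0, g s fun k => u k.succ) := by
  obtain ⟨w, hw, hw'⟩ := h.map (unit Z)
  refine ⟨w, hw, fun s u => ?_⟩
  exact congrArg (fun k => PtTop.eval k (u 0)) (hw' s fun k => u k.succ)

end Spectrum

/-! ## Rotating the square -/

/-- The boundary of the unit square. -/
def squareBoundary : Set (unitInterval × unitInterval) :=
  {p | p.1 = 0 ∨ p.1 = 1 ∨ p.2 = 0 ∨ p.2 = 1}

/-- The linear map `(x, y) ↦ (a x + b y, -b x + a y)` of the plane, clamped to a self-map of the
square, which is identified with `[-1, 1]²`. -/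
def clampedLinear (a b : ℝ) (p : unitInterval × unitInterval) : unitInterval × unitInterval :=
  (Set.projIcc 0 1 zero_le_one ((1 + (a * (2 * p.1 - 1) + b * (2 * p.2 - 1))) / 2),
    Set.projIcc 0 1 zero_le_one ((1 + (-b * (2 * p.1 - 1) + a * (2 * p.2 - 1))) / 2))

/-- In centred coordinates a boundary point has `x² + y² ≥ 1`, and the matrix multiplies this by `a²
+ b²`. If the factor is at least `2`, one image coordinate has absolute value at least `1` and is
clamped to the boundary. The other two alternatives allow the factor to drop to `1` when the axes
are preserved or exchanged. -/
theorem clampedLinear_boundary {a b : ℝ}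
    (h : 2 ≤ a ^ 2 + b ^ 2 ∨ (1 ≤ a ∧ b = 0) ∨ (a = 0 ∧ 1 ≤ b)) {p : unitInterval × unitInterval}
    (hp : p ∈ squareBoundary) : clampedLinear a b p ∈ squareBoundary := by
  obtain ⟨⟨u, hu⟩, ⟨v, hv⟩⟩ := p
  obtain ⟨x, rfl⟩ : ∃ x, u = (x + 1) / 2 := ⟨2 * u - 1, by ring⟩
  obtain ⟨y, rfl⟩ : ∃ y, v = (y + 1) / 2 := ⟨2 * v - 1, by ring⟩
  have hxy : x ^ 2 = 1 ∨ y ^ 2 = 1 := by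
    simp only [squareBoundary, Set.mem_ofPred_eq, Subtype.ext_iff, Set.Icc.coe_zero,
      Set.Icc.coe_one] at hp
    rcases hp with h | h | h | h
    · left; rw [show x = -1 by linarith]; norm_num
    · left; rw [show x = 1 by linarith]; norm_num
    · right; rw [show y = -1 by linarith]; norm_num
    · right; rw [show y = 1 by linarith]; norm_num
  have key : 1 ≤ (a * x + b * y) ^ 2 ∨ 1 ≤ (-b * x + a * y) ^ 2 := by
    rcases h with h | ⟨h, rfl⟩ | ⟨rfl, h⟩
    · by_contra! hc
      have e : (a * x + b * y) ^ 2 + (-b * x + a * y) ^ 2 = (a ^ 2 + b ^ 2) * (x ^ 2 + y ^ 2) := by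
        ring
      have : 1 ≤ x ^ 2 + y ^ 2 := by
        rcases hxy with h | h
        · nlinarith [sq_nonneg y]
        · nlinarith [sq_nonneg x]
      nlinarith
    · have h2 : 1 ≤ a ^ 2 := one_le_pow₀ h
      rcases hxy with h | h
      · left; rw [zero_mul, add_zero, mul_pow, h, mul_one]; exact h2
      · right; rw [neg_zero, zero_mul, zero_add, mul_pow, h, mul_one]; exact h2
    · have h2 : 1 ≤ b ^ 2 := one_le_pow₀ h
      rcases hxy with h | h
      · right; rw [zero_mul, add_zero, mul_pow, h, mul_one, neg_sq]; exact h2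
      · left; rw [zero_mul, zero_add, mul_pow, h, mul_one]; exact h2
  have clamp : ∀ z : ℝ, 1 ≤ z ^ 2 → Set.projIcc (0 : ℝ) 1 zero_le_one ((1 + z) / 2) = 0 ∨
      Set.projIcc (0 : ℝ) 1 zero_le_one ((1 + z) / 2) = 1 := by
    intro z hz
    rcases le_or_gt 1 z with h | h
    · exact Or.inr (Set.projIcc_of_right_le _ (by linarith))
    · refine Or.inl (Set.projIcc_of_le_left _ ?_)
      nlinarith
  simp only [squareBoundary, clampedLinear, Set.mem_ofPred_eq]
  have ex : 2 * ((x + 1) / 2) - 1 = x := by ring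
  have ey : 2 * ((y + 1) / 2) - 1 = y := by ring
  rw [ex, ey]
  rcases key with h | h
  · rcases clamp _ h with h | h
    · exact Or.inl h
    · exact Or.inr (Or.inl h)
  · rcases clamp _ h with h | h
    · exact Or.inr (Or.inr (Or.inl h))
    · exact Or.inr (Or.inr (Or.inr h))

theorem continuous_clampedLinear {T : Type*} [TopologicalSpace T] {a b : T → ℝ}
    {p : T → unitInterval × unitInterval} (ha : Continuous a) (hb : Continuous b)
    (hp : Continuous p) : Continuous fun t => clampedLinear (a t) (b t) (p t) := by
  refine Continuous.prodMk (continuous_projIcc.comp ?_) (continuous_projIcc.comp ?_) <;> fun_prop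

/-- The homotopy of maps of pairs of the square given by a path of linear maps. -/
def clampedHomotopy (a b : ℝ → ℝ) (ha : Continuous a) (hb : Continuous b)
    (h : ∀ t : unitInterval, 2 ≤ a t ^ 2 + b t ^ 2 ∨ (1 ≤ a t ∧ b t = 0) ∨ (a t = 0 ∧ 1 ≤ b t)) :
    ContinuousMap.HomotopyWith
      (⟨clampedLinear (a 0) (b 0), continuous_clampedLinear continuous_const continuous_const
        continuous_id⟩ : C(unitInterval × unitInterval, unitInterval × unitInterval))
      (⟨clampedLinear (a 1) (b 1), continuous_clampedLinear continuous_const continuous_const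
        continuous_id⟩ : C(unitInterval × unitInterval, unitInterval × unitInterval))
      (fun f => ∀ p ∈ squareBoundary, f p ∈ squareBoundary) where
  toFun q := clampedLinear (a q.1) (b q.1) q.2
  continuous_toFun := continuous_clampedLinear (ha.comp (by fun_prop)) (hb.comp (by fun_prop))
    continuous_snd
  map_zero_left p := by simp
  map_one_left p := by simp
  prop' t _ hp := clampedLinear_boundary (h t) hp

/-- The square can be rotated by a right angle through maps preserving the boundary. -/
theorem exists_rotation : ∃ ρ : C(unitInterval × (unitInterval × unitInterval),
    unitInterval × unitInterval), (∀ p, ρ (0, p) = p) ∧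
      (∀ u v, ρ (1, (u, v)) = (v, unitInterval.symm u)) ∧
      ∀ t, ∀ p ∈ squareBoundary, ρ (t, p) ∈ squareBoundary := by
  -- Expand by the factor `2`, turn along the segment from `(2, 0)` to `(0, 2)`, and shrink back. On
  -- that segment `a² + b² = 4((1 - t)² + t²) ≥ 2`; without the expansion the corners would be cut
  -- and the boundary would not be preserved.
  let H₁ := clampedHomotopy (fun t => 1 + t) (fun _ => 0) (by fun_prop) (by fun_prop)
    (fun t => Or.inr (Or.inl ⟨by linarith [t.2.1], rfl⟩))
  let H₂ := clampedHomotopy (fun t => 2 * (1 - t)) (fun t => 2 * t) (by fun_prop) (by fun_prop)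
    (fun t => Or.inl (by nlinarith [sq_nonneg (2 * (t : ℝ) - 1)]))
  let H₃ := clampedHomotopy (fun _ => 0) (fun t => 2 - t) (by fun_prop) (by fun_prop)
    (fun t => Or.inr (Or.inr ⟨rfl, by linarith [t.2.2]⟩))
  let K := (H₁.trans (H₂.cast (by simp; norm_num) rfl)).trans (H₃.cast (by simp) rfl)
  refine ⟨K.toContinuousMap, fun p => (K.apply_zero p).trans ?_,
    fun u v => (K.apply_one _).trans ?_, fun t p hp => K.prop t p hp⟩
  · refine Prod.ext ?_ ?_ <;>
    · refine (congrArg (Set.projIcc 0 1 zero_le_one) ?_).trans (Set.projIcc_val zero_le_one _)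
      ring
  · refine Prod.ext ?_ ?_ <;>
    · refine (congrArg (Set.projIcc 0 1 zero_le_one) ?_).trans (Set.projIcc_val zero_le_one _)
      simp only [unitInterval.coe_symm_eq]
      ring

/-! ## Maps of cones and suspensions of pointed spaces -/

namespace PtTop

theorem mem_boundary_succ {i : ℕ} {s : Fin (i + 1) → unitInterval} :
    s ∈ Cube.boundary (Fin (i + 1)) ↔
      (s 0 = 0 ∨ s 0 = 1) ∨ (fun k : Fin i => s k.succ) ∈ Cube.boundary (Fin i) := by
  constructor
  · rintro ⟨k, hk⟩
    induction k using Fin.cases with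
    | zero => exact Or.inl hk
    | succ k => exact Or.inr ⟨k, hk⟩
  · rintro (h | ⟨k, hk⟩)
    · exact ⟨0, h⟩
    · exact ⟨k.succ, hk⟩

/-- The point `[t, a]` of the reduced suspension. -/
def suspMk {A : PtTop.{u}} (t : unitInterval) (a : A) : susp A := Quot.mk _ (t, a)

/-- The point `[t, a]` of the reduced mapping cone. -/
def coneInl {A B : PtTop.{u}} (f : A ⟶ B) (t : unitInterval) (a : A) : cone f :=
  Quot.mk _ (Sum.inl (t, a))

/-- The point of the reduced mapping cone given by a point of the target. -/
def coneInr {A B : PtTop.{u}} (f : A ⟶ B) (b : B) : cone f := Quot.mk _ (Sum.inr b)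

theorem continuous_suspMk {T : Type*} [TopologicalSpace T] {A : PtTop.{u}} {t : T → unitInterval}
    {a : T → A} (ht : Continuous t) (ha : Continuous a) : Continuous fun x => suspMk (t x) (a x) :=
  continuous_quot_mk.comp (ht.prodMk ha)

theorem continuous_coneInl {T : Type*} [TopologicalSpace T] {A B : PtTop.{u}} {f : A ⟶ B}
    {t : T → unitInterval} {a : T → A} (ht : Continuous t) (ha : Continuous a) :
    Continuous fun x => coneInl f (t x) (a x) :=
  continuous_quot_mk.comp (continuous_inl.comp (ht.prodMk ha))

theorem continuous_coneInr {T : Type*} [TopologicalSpace T] {A B : PtTop.{u}} {f : A ⟶ B}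
    {b : T → B} (hb : Continuous b) : Continuous fun x => coneInr f (b x) :=
  continuous_quot_mk.comp (continuous_inr.comp hb)

theorem susp_cases {A : PtTop.{u}} (c : susp A) : ∃ t a, c = suspMk t a := by
  obtain ⟨q, rfl⟩ := Quot.exists_rep c
  exact ⟨q.1, q.2, rfl⟩

theorem cone_cases {A B : PtTop.{u}} {f : A ⟶ B} (c : cone f) :
    (∃ t a, c = coneInl f t a) ∨ ∃ b, c = coneInr f b := by
  obtain ⟨q | q, rfl⟩ := Quot.exists_rep c
  · exact Or.inl ⟨q.1, q.2, rfl⟩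
  · exact Or.inr ⟨q, rfl⟩

@[simp] theorem suspMk_zero {A : PtTop.{u}} (a : A) : suspMk 0 a = (susp A).pt :=
  Quot.sound (.zero a)

@[simp] theorem suspMk_one {A : PtTop.{u}} (a : A) : suspMk 1 a = (susp A).pt :=
  Quot.sound (.one a)

@[simp] theorem suspMk_pt {A : PtTop.{u}} (t : unitInterval) : suspMk t A.pt = (susp A).pt :=
  Quot.sound (.base t)

@[simp] theorem coneInl_zero {A B : PtTop.{u}} (f : A ⟶ B) (a : A) :
    coneInl f 0 a = (cone f).pt :=
  Quot.sound (.zero a)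

@[simp] theorem coneInl_pt {A B : PtTop.{u}} (f : A ⟶ B) (t : unitInterval) :
    coneInl f t A.pt = (cone f).pt :=
  Quot.sound (.base t)

theorem coneInl_one {A B : PtTop.{u}} (f : A ⟶ B) (a : A) :
    coneInl f 1 a = coneInr f (f.toFun a) :=
  Quot.sound (.one a)

@[simp] theorem coneInr_pt {A B : PtTop.{u}} (f : A ⟶ B) : coneInr f B.pt = (cone f).pt := rfl

/-- Maps out of the mapping cone. -/
def coneLift {A B : PtTop.{u}} {f : A ⟶ B} {α : Type*} {c : α} (p : unitInterval → A → α)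
    (q : B → α) (hc : q B.pt = c) (h₀ : ∀ a, p 0 a = c) (hp : ∀ t, p t A.pt = c)
    (h₁ : ∀ a, p 1 a = q (f.toFun a)) : cone f → α :=
  Quot.lift (Sum.elim (fun w => p w.1 w.2) q) (by
    rintro _ _ (a | t | a)
    · exact (h₀ a).trans hc.symm
    · exact (hp t).trans hc.symm
    · exact h₁ a)

/-- Maps out of the reduced suspension. -/
def suspLift {A : PtTop.{u}} {α : Type*} {c : α} (p : unitInterval → A → α)
    (h₀ : ∀ a, p 0 a = c) (h₁ : ∀ a, p 1 a = c) (hp : ∀ t, p t A.pt = c) : susp A → α :=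
  Quot.lift (fun w => p w.1 w.2) (by
    rintro _ _ (a | a | t)
    · exact (h₀ a).trans (h₀ _).symm
    · exact (h₁ a).trans (h₀ _).symm
    · exact (hp t).trans (h₀ _).symm)

/-- The map `(t, c) ↦ [t r, f a]` for `c = (r, a)` in the cone, and `(t, b) ↦ [t, b]`. -/
def coneSweep {A B : PtTop.{u}} (f : A ⟶ B) (t : unitInterval) : cone f → susp B :=
  coneLift (c := (susp B).pt) (fun r a => suspMk (t * r) (f.toFun a)) (suspMk t) (by simp)
    (by simp) (by simp [f.map_pt]) (by simp)

theorem continuous_coneSweep {A B : PtTop.{u}} (f : A ⟶ B) :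
    Continuous fun p : unitInterval × cone f => coneSweep f p.1 p.2 := by
  have := f.cont
  exact continuous_of_cone (continuous_suspMk (by fun_prop) (by fun_prop))
    (continuous_suspMk (by fun_prop) (by fun_prop))

@[simp] theorem coneSweep_pt {A B : PtTop.{u}} (f : A ⟶ B) (t : unitInterval) :
    coneSweep f t (cone f).pt = (susp B).pt :=
  suspMk_pt _

theorem coneSweep_coneInl {A B : PtTop.{u}} (f : A ⟶ B) (t r : unitInterval) (a : A) :
    coneSweep f t (coneInl f r a) = suspMk (t * r) (f.toFun a) := rfl

theorem coneSweep_coneInr {A B : PtTop.{u}} (f : A ⟶ B) (t : unitInterval) (b : B) :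
    coneSweep f t (coneInr f b) = suspMk t b := rfl

@[simp] theorem coneSweep_zero {A B : PtTop.{u}} (f : A ⟶ B) (c : cone f) :
    coneSweep f 0 c = (susp B).pt := by
  obtain ⟨r, a, rfl⟩ | ⟨b, rfl⟩ := cone_cases c
  · simp [coneSweep_coneInl]
  · simp [coneSweep_coneInr]

/-- The homotopy `(l, t, a) ↦ ((1 + l) t, a)`, continued in the cone over `B` by
`(2 - (1 + l) t, f a)`. -/
def conePath {A B : PtTop.{u}} (f : A ⟶ B) (l t : unitInterval) (a : A) : cone (coneIncl f) :=
  if (1 + l : ℝ) * t ≤ 1 then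
    coneInr (coneIncl f) (coneInl f (Set.projIcc 0 1 zero_le_one ((1 + l : ℝ) * t)) a)
  else coneInl (coneIncl f) (Set.projIcc 0 1 zero_le_one (2 - (1 + l : ℝ) * t)) (f.toFun a)

theorem coneInl_coneIncl_one {A B : PtTop.{u}} (f : A ⟶ B) (a : A) :
    coneInr (coneIncl f) (coneInl f 1 a) = coneInl (coneIncl f) 1 (f.toFun a) := by
  rw [coneInl_one, coneInl_one]
  rfl

theorem continuous_conePath {A B : PtTop.{u}} (f : A ⟶ B) :
    Continuous fun p : unitInterval × (unitInterval × A) => conePath f p.1 p.2.1 p.2.2 := by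
  have hf := f.cont
  refine Continuous.if_le ?_ ?_ (by fun_prop) continuous_const ?_
  · exact continuous_coneInr (continuous_coneInl (continuous_projIcc.comp (by fun_prop))
      (by fun_prop))
  · exact continuous_coneInl (continuous_projIcc.comp (by fun_prop)) (by fun_prop)
  · rintro ⟨l, t, a⟩ h
    dsimp only at h ⊢
    rw [h, show (2 - 1 : ℝ) = 1 by norm_num, Set.projIcc_right]
    exact coneInl_coneIncl_one f a

theorem conePath_zero {A B : PtTop.{u}} (f : A ⟶ B) (l : unitInterval) (a : A) :
    conePath f l 0 a = (cone (coneIncl f)).pt := by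
  simp only [conePath, Set.Icc.coe_zero, mul_zero, zero_le_one, if_true, Set.projIcc_left]
  exact congrArg _ (coneInl_zero f a)

theorem conePath_pt {A B : PtTop.{u}} (f : A ⟶ B) (l t : unitInterval) :
    conePath f l t A.pt = (cone (coneIncl f)).pt := by
  rw [conePath, f.map_pt, coneInl_pt, coneInl_pt, coneInr_pt, ite_self]

theorem conePath_one {A B : PtTop.{u}} (f : A ⟶ B) (l : unitInterval) (a : A) :
    conePath f l 1 a = coneInl (coneIncl f) (unitInterval.symm l) (f.toFun a) := by
  -- At `l = 0` the endpoint `t = 1` falls in the first branch of `conePath`, and the gluing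
  -- relation identifies it with the second.
  by_cases hl : l = 0
  · subst hl
    simp [conePath, coneInl_coneIncl_one]
  · have h : 0 < (l : ℝ) := lt_of_le_of_ne l.2.1 fun h => hl (Subtype.ext h.symm)
    have h' : ¬ (1 + l : ℝ) * (1 : unitInterval) ≤ 1 := by simpa using h
    rw [conePath, if_neg h']
    refine congrArg (fun c => coneInl _ c (f.toFun a)) ?_
    refine (congrArg (Set.projIcc 0 1 zero_le_one) ?_).trans (Set.projIcc_val zero_le_one _)
    simp only [unitInterval.coe_symm_eq, Set.Icc.coe_one]
    ring

theorem conePath_zero_left {A B : PtTop.{u}} (f : A ⟶ B) (t : unitInterval) (a : A) :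
    conePath f 0 t a = coneInr (coneIncl f) (coneInl f t a) := by
  simp [conePath, t.2.2]

/-- The map from `ΣA` to the cone of `B → cone f`. -/
def suspToCone {A B : PtTop.{u}} (f : A ⟶ B) : susp A ⟶ cone (coneIncl f) where
  toFun := suspLift (conePath f 1) (conePath_zero f 1) (fun a => by simp [conePath_one])
    (conePath_pt f 1)
  cont := continuous_quot_lift _ ((continuous_conePath f).comp
    (continuous_const.prodMk continuous_id))
  map_pt := conePath_pt _ _ _

/-- The homotopy from the inclusion of `cone f` into the cone of `B → cone f` to a map factoring
through `ΣA`. -/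
def coneShift {A B : PtTop.{u}} (f : A ⟶ B) (l : unitInterval) : cone f → cone (coneIncl f) :=
  coneLift (conePath f l) (coneInl (coneIncl f) (unitInterval.symm l)) (coneInl_pt _ _)
    (conePath_zero f l) (conePath_pt f l) (conePath_one f l)

theorem continuous_coneShift {A B : PtTop.{u}} (f : A ⟶ B) :
    Continuous fun p : unitInterval × cone f => coneShift f p.1 p.2 := by
  exact continuous_of_cone (continuous_conePath f)
    (continuous_coneInl (by fun_prop) (by fun_prop))

theorem coneShift_pt {A B : PtTop.{u}} (f : A ⟶ B) (l : unitInterval) :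
    coneShift f l (cone f).pt = (cone (coneIncl f)).pt :=
  coneInl_pt _ _

theorem coneShift_zero {A B : PtTop.{u}} (f : A ⟶ B) (c : cone f) :
    coneShift f 0 c = (coneIncl (coneIncl f)).toFun c := by
  obtain ⟨r, a, rfl⟩ | ⟨b, rfl⟩ := cone_cases c
  · exact conePath_zero_left _ _ _
  · change coneInl _ (unitInterval.symm 0) b = _
    rw [unitInterval.symm_zero]
    exact coneInl_one (coneIncl f) b

/-- The contraction of the cone of the identity. -/
def coneContract (A : PtTop.{u}) (l : unitInterval) : cone (𝟙 A) → cone (𝟙 A) :=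
  coneLift (c := (cone (𝟙 A)).pt) (fun r a => coneInl (𝟙 A) (l * r) a) (coneInl (𝟙 A) l) (by simp)
    (by simp) (by simp) (by simp)

theorem continuous_coneContract (A : PtTop.{u}) :
    Continuous fun p : unitInterval × cone (𝟙 A) => coneContract A p.1 p.2 := by
  exact continuous_of_cone (continuous_coneInl (by fun_prop) (by fun_prop))
    (continuous_coneInl (by fun_prop) (by fun_prop))

theorem coneContract_pt (A : PtTop.{u}) (l : unitInterval) :
    coneContract A l (cone (𝟙 A)).pt = (cone (𝟙 A)).pt :=
  coneInl_pt _ _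

theorem coneContract_zero (A : PtTop.{u}) (c : cone (𝟙 A)) :
    coneContract A 0 c = (cone (𝟙 A)).pt := by
  obtain ⟨r, a, rfl⟩ | ⟨b, rfl⟩ := cone_cases c
  · change coneInl _ (0 * r) a = _
    simp
  · exact coneInl_zero _ _

theorem coneContract_one (A : PtTop.{u}) (c : cone (𝟙 A)) : coneContract A 1 c = c := by
  obtain ⟨r, a, rfl⟩ | ⟨b, rfl⟩ := cone_cases c
  · change coneInl _ (1 * r) a = _
    rw [one_mul]
  · exact coneInl_one _ _

end PtTop

namespace Spectrum

/-- The structure map of a spectrum as a map out of the reduced suspension. -/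
def suspStr (Z : Spectrum.{u}) (j : ℕ) : PtTop.susp (Z.level j) ⟶ Z.level (j + 1) where
  toFun := suspLift (fun t z => Z.str j (t, z)) (Z.str_zero j) (Z.str_one j) (Z.str_pt j)
  cont := continuous_quot_lift _ (Z.str_cont j)
  map_pt := Z.str_zero _ _

theorem suspStr_naturality {Z W : Spectrum.{u}} (f : Z ⟶ W) (j : ℕ) (c : PtTop.susp (Z.level j)) :
    (f.app (j + 1)).toFun ((suspStr Z j).toFun c) =
      (suspStr W j).toFun ((suspMap (f.app j)).toFun c) := by
  obtain ⟨q, rfl⟩ := Quot.exists_rep c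
  exact f.comm j q.1 q.2

/-! ## Exactness of non-negative stable homotopy groups -/

/-- The sweep starts from the composite of the pinch map with `Σf`; this is the end that sees the
class of `A` constructed in the next proof. -/
theorem coneSweep_one {A B : Spectrum.{u}} (f : A ⟶ B) (j : ℕ) (c : (cone f).level j) :
    coneSweep (f.app j) 1 c = (suspMap (f.app j)).toFun (((conePinch f).app j).toFun c) := by
  obtain ⟨r, a, rfl⟩ | ⟨b, rfl⟩ := cone_cases c
  · rw [coneSweep_coneInl, one_mul]
    rfl
  · rw [coneSweep_coneInr, suspMk_one]
    exact (suspMap (f.app j)).map_pt.symm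

variable {n : ℕ}

/-- Exactness of `π_n(A) → π_n(B) → π_n(cone f)`. -/
theorem exists_of_map_coneIncl_eq_zero {A B : Spectrum.{u}} (f : A ⟶ B)
    (x : (loopsPow n ⋙ pi0).obj B) (hx : (loopsPow n ⋙ pi0).map (coneIncl f) x = 0) :
    ∃ y, (loopsPow n ⋙ pi0).map f y = x := by
  obtain ⟨i, g, H, hg, hH, h₀, h₁⟩ := Rep.exists_of_map_eq_zero (coneIncl f) hx
  -- Pinching the null-homotopy `H` collapses both of its ends, so the homotopy parameter becomes an
  -- additional sphere coordinate and gives a map of cubes into `ΣA`. The structure map of `A`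
  -- brings it to the next level.
  have hl : IsLoop (A := A.level (i + 1 + 2)) fun s u => (suspStr A (i + 2)).toFun
      (((conePinch f).app (i + 2)).toFun (H (s 0) (fun k => s k.succ) u)) := by
    refine ⟨?_, fun s hs u => ?_, fun s u hu => ?_⟩
    · have h₂ := (suspStr A (i + 2)).cont
      have h₃ := ((conePinch f).app (i + 2)).cont
      exact h₂.comp (h₃.comp (hH.continuous_comp (by fun_prop) (by fun_prop) (by fun_prop)))
    · rcases mem_boundary_succ.mp hs with (h | h) | h
      · rw [h, h₀, PtTop.Hom.map_pt]
        exact PtTop.Hom.map_pt _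
      · rw [h, h₁]
        exact PtTop.Hom.map_pt _
      · rw [hH.left _ _ h, PtTop.Hom.map_pt]
        exact PtTop.Hom.map_pt _
    · rw [hH.right _ _ _ hu, PtTop.Hom.map_pt]
      exact PtTop.Hom.map_pt _
  obtain ⟨y, hy⟩ := Rep.of_isLoop hl
  refine ⟨y, Rep.unique ?_ hg.stab⟩
  have hpt : ∀ t, (suspStr B (i + 2)).toFun (coneSweep (f.app (i + 2)) t
      ((cone f).level (i + 2)).pt) = (B.level (i + 1 + 2)).pt := fun t =>
    (congrArg _ (coneSweep_pt _ t)).trans (PtTop.Hom.map_pt _)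
  have hs : ∀ {T : Type} [TopologicalSpace T] {t : T → unitInterval}
      {c : T → PtTop.cone (f.app (i + 2))}, Continuous t → Continuous c → Continuous fun x =>
        (suspStr B (i + 2)).toFun (coneSweep (f.app (i + 2)) (t x) (c x)) := fun ht hc =>
    (suspStr B (i + 2)).cont.comp ((continuous_coneSweep _).comp (ht.prodMk hc))
  have hone : ∀ (s : Fin (i + 2) → unitInterval) (u : Fin n → unitInterval) (t : unitInterval),
      coneSweep (f.app (i + 2)) t (H 1 s u) = suspMk t (g s u) := fun s u t =>
    congrArg _ (h₁ s u)
  -- Move the sweep parameter from `1` down to `s 0`, then the parameter of `H` from `s 0` up to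
  -- `1`. Throughout, at `s 0 = 1` the value is `[1, g]`, which is the base point. The result is
  -- `σ(s 0, g)`, the stabilisation of `g`.
  refine ((hy.map f).of_homotopy (g' := fun s u => (suspStr B (i + 2)).toFun
      (coneSweep (f.app (i + 2)) (s 0) (H (s 0) (fun k => s k.succ) u)))
      (H := fun l s u => (suspStr B (i + 2)).toFun (coneSweep (f.app (i + 2))
        (max (s 0) (unitInterval.symm l)) (H (s 0) (fun k => s k.succ) u)))
      ⟨?_, fun l s hs u => ?_, fun l s u hu => ?_⟩ (fun s u => ?_) (fun s u => ?_)).of_homotopy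
      (H := fun l s u => (suspStr B (i + 2)).toFun (coneSweep (f.app (i + 2))
        (s 0) (H (max (s 0) l) (fun k => s k.succ) u)))
      ⟨?_, fun l s hs u => ?_, fun l s u hu => ?_⟩ (fun s u => ?_) (fun s u => ?_)
  · exact hs (by fun_prop) (hH.continuous_comp (by fun_prop) (by fun_prop) (by fun_prop))
  · rcases mem_boundary_succ.mp hs with (h | h) | h
    · rw [h, h₀]; exact hpt _
    · rw [h, hone, max_eq_left unitInterval.le_one', suspMk_one, PtTop.Hom.map_pt]
    · rw [hH.left _ _ h]; exact hpt _
  · rw [hH.right _ _ _ hu]; exact hpt _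
  · rw [unitInterval.symm_zero, max_eq_right unitInterval.le_one']
    exact (congrArg _ (coneSweep_one f _ _)).trans (suspStr_naturality f (i + 2) _).symm
  · rw [unitInterval.symm_one, max_eq_left unitInterval.nonneg']
  · exact hs (by fun_prop) (hH.continuous_comp (by fun_prop) (by fun_prop) (by fun_prop))
  · rcases mem_boundary_succ.mp hs with (h | h) | h
    · rw [h]
      exact (congrArg _ (coneSweep_zero _ _)).trans (PtTop.Hom.map_pt _)
    · rw [h, max_eq_left unitInterval.le_one', hone, suspMk_one, PtTop.Hom.map_pt]
    · rw [hH.left _ _ h]; exact hpt _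
  · rw [hH.right _ _ _ hu]; exact hpt _
  · rw [max_eq_left unitInterval.nonneg']
  · rw [max_eq_right unitInterval.le_one', hone]
    rfl

/-- Exactness of `π_n(B) → π_n(cone f) → π_n(ΣA)`. -/
theorem exists_of_map_conePinch_eq_zero {A B : Spectrum.{u}} (f : A ⟶ B)
    (x : (loopsPow n ⋙ pi0).obj (cone f)) (hx : (loopsPow n ⋙ pi0).map (conePinch f) x = 0) :
    ∃ y, (loopsPow n ⋙ pi0).map (coneIncl f) y = x := by
  -- Apply the exactness just proved to the inclusion `B → cone f`: it suffices that `x` dies in the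
  -- cone of this inclusion.
  refine exists_of_map_coneIncl_eq_zero _ _ ?_
  obtain ⟨i, g, H, hg, hH, h₀, h₁⟩ := Rep.exists_of_map_eq_zero (conePinch f) hx
  have hgl := hg.isLoop
  have hgc := hgl.cont
  -- In that cone, `coneShift` retracts `B` along the new cone coordinate and deforms the inclusion
  -- of `cone f` to a map factoring through the pinch to `ΣA`. There the given null-homotopy
  -- applies.
  refine (((hg.map (coneIncl (coneIncl f))).of_homotopy
      (H := fun l s u => coneShift (f.app (i + 2)) l (g s u))
      (g' := fun s u => (suspToCone (f.app (i + 2))).toFun (H 1 s u))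
      ⟨?_, fun l s hs u => ?_, fun l s u hu => ?_⟩ (fun s u => ?_) (fun s u => ?_))).eq_zero
      (H := fun l s u => (suspToCone (f.app (i + 2))).toFun (H l s u))
      ⟨?_, fun l s hs u => ?_, fun l s u hu => ?_⟩ (fun s u => ?_) (fun s u => rfl)
  · exact (continuous_coneShift (f.app (i + 2))).comp
      (continuous_fst.prodMk (hgc.comp continuous_snd))
  · rw [hgl.left s hs]; exact coneShift_pt _ _
  · rw [hgl.right s u hu]; exact coneShift_pt _ _
  · exact coneShift_zero _ _
  · rw [h₁]
    obtain ⟨r, a, h⟩ | ⟨b, h⟩ := cone_cases (g s u)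
    · rw [h]; rfl
    · rw [h]
      change coneInl _ (unitInterval.symm 1) b = _
      rw [unitInterval.symm_one, coneInl_zero]
      exact (suspToCone (f.app (i + 2))).map_pt.symm
  · exact (suspToCone (f.app (i + 2))).cont.comp hH.cont
  · rw [hH.left l s hs]; exact PtTop.Hom.map_pt _
  · rw [hH.right l s u hu]; exact PtTop.Hom.map_pt _
  · rw [h₀]; exact PtTop.Hom.map_pt _

theorem eq_zero_of_cone_id {A : Spectrum.{u}} (x : (loopsPow n ⋙ pi0).obj (cone (𝟙 A))) :
    x = 0 := by
  obtain ⟨i, g, hg⟩ := Rep.exists_rep x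
  have hgl := hg.isLoop
  refine hg.eq_zero (H := fun l s u => coneContract (A.level (i + 2)) l (g s u))
    ⟨?_, fun l s hs u => ?_, fun l s u hu => ?_⟩ (fun s u => coneContract_zero _ _)
    (fun s u => coneContract_one _ _)
  · exact (continuous_coneContract (A.level (i + 2))).comp
      (continuous_fst.prodMk (hgl.cont.comp continuous_snd))
  · rw [hgl.left s hs]; exact coneContract_pt _ _
  · rw [hgl.right s u hu]; exact coneContract_pt _ _

/-- Up to sign, `(t, s) ↦ [t, σ z(s)]` represents the same class as `z`. -/
theorem Rep.stab_susp {A : Spectrum.{u}} {i : ℕ}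
    {z : (Fin (i + 2) → unitInterval) → (Fin n → unitInterval) → (susp.obj A).level (i + 2)}
    (hz : IsLoop z) {y : (loopsPow n ⋙ pi0).obj (susp.obj A)}
    (hy : Rep y (i + 1) fun s u => suspMk (s 0) ((suspStr A (i + 2)).toFun
      (z (fun k => s k.succ) u))) : Rep (-y) (i + 1) (stabLoop z) := by
  obtain ⟨ρ, hρ₀, hρ₁, hρb⟩ := exists_rotation
  have hb : ∀ p ∈ squareBoundary, ∀ a : A.level (i + 2),
      suspMk p.1 (A.str (i + 2) (p.2, a)) = (PtTop.susp (A.level (i + 2 + 1))).pt := by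
    rintro ⟨p, q⟩ hp a
    rcases hp with h | h | h | h <;> dsimp only at h ⊢ <;> rw [h]
    · exact suspMk_zero _
    · exact suspMk_one _
    · rw [A.str_zero]; exact suspMk_pt _
    · rw [A.str_one]; exact suspMk_pt _
  -- Rotate the square formed by the sphere coordinate `t` and the suspension coordinate `v`. It is
  -- well defined on the suspension because the boundary of that square always goes to the base
  -- point.
  let Ψ (l t : unitInterval) : PtTop.susp (A.level (i + 2)) → PtTop.susp (A.level (i + 2 + 1)) :=
    suspLift (c := (PtTop.susp (A.level (i + 2 + 1))).pt)
      (fun v a => suspMk (ρ (l, (t, v))).1 (A.str (i + 2) ((ρ (l, (t, v))).2, a)))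
      (fun a => hb _ (hρb _ _ (Or.inr (Or.inr (Or.inl rfl)))) a)
      (fun a => hb _ (hρb _ _ (Or.inr (Or.inr (Or.inr rfl)))) a)
      (fun v => by rw [A.str_pt]; exact suspMk_pt _)
  have hΨ : ∀ {T : Type} [TopologicalSpace T] {l t : T → unitInterval}
      {c : T → PtTop.susp (A.level (i + 2))}, Continuous l → Continuous t → Continuous c →
        Continuous fun x => Ψ (l x) (t x) (c x) := by
    intro T _ l t c hl ht hc
    have := A.str_cont (i + 2)
    have h : Continuous fun p : (unitInterval × unitInterval) × PtTop.susp (A.level (i + 2)) =>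
        Ψ p.1.1 p.1.2 p.2 :=
      continuous_of_susp (continuous_suspMk (A := A.level (i + 2 + 1)) (by fun_prop) (by fun_prop))
    exact h.comp ((hl.prodMk ht).prodMk hc)
  have hΨpt : ∀ l t, Ψ l t (PtTop.susp (A.level (i + 2))).pt =
      (PtTop.susp (A.level (i + 2 + 1))).pt := fun l t =>
    hb _ (hρb _ _ (Or.inr (Or.inr (Or.inl rfl)))) _
  have hΨb : ∀ l t c, (t = 0 ∨ t = 1) → Ψ l t c = (PtTop.susp (A.level (i + 2 + 1))).pt := by
    intro l t c ht
    obtain ⟨v, a, rfl⟩ := susp_cases c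
    refine hb _ (hρb _ _ ?_) _
    rcases ht with rfl | rfl
    · exact Or.inl rfl
    · exact Or.inr (Or.inl rfl)
  -- The rotation ends at `[v, σ(1 - t, a)]`, the stabilisation with its first coordinate reversed;
  -- undoing the reversal costs the sign.
  have key := (hy.of_homotopy (H := fun l s u => Ψ l (s 0) (z (fun k => s k.succ) u))
    (g' := fun s u => (susp.obj A).str (i + 2) (unitInterval.symm (s 0), z (fun k => s k.succ) u))
    ⟨?_, fun l s hs u => ?_, fun l s u hu => ?_⟩ (fun s u => ?_) (fun s u => ?_)).neg
  · convert key using 3 with s u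
    simp [stabLoop, Fin.succ_ne_zero]
  · exact hΨ (by fun_prop) (by fun_prop) (hz.continuous_comp (by fun_prop) (by fun_prop))
  · rcases mem_boundary_succ.mp hs with h | h
    · exact hΨb _ _ _ h
    · rw [hz.left _ h]; exact hΨpt _ _
  · rw [hz.right _ _ hu]; exact hΨpt _ _
  · obtain ⟨v, a, h⟩ := susp_cases (z (fun k => s k.succ) u)
    rw [h]
    change suspMk (ρ (0, (s 0, v))).1 (A.str (i + 2) ((ρ (0, (s 0, v))).2, a)) = _
    rw [hρ₀]
    rfl
  · obtain ⟨v, a, h⟩ := susp_cases (z (fun k => s k.succ) u)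
    rw [h]
    change suspMk (ρ (1, (s 0, v))).1 (A.str (i + 2) ((ρ (1, (s 0, v))).2, a)) = _
    rw [hρ₁]
    rfl

/-- Exchanging two coordinates changes the sign. -/
theorem Rep.swap {Z : Spectrum.{u}} {i : ℕ}
    {g : (Fin (i + 2) → unitInterval) → (Fin (n + 1) → unitInterval) → Z.level (i + 2)}
    {x : (loopsPow (n + 1) ⋙ pi0).obj Z} (h : Rep x i g) :
    Rep (-x) i fun s u => g (Function.update s 0 (u 0)) (Function.update u 0 (s 0)) := by
  obtain ⟨ρ, hρ₀, hρ₁, hρb⟩ := exists_rotation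
  have hg := h.isLoop
  have hgc := hg.cont
  have hb : ∀ p ∈ squareBoundary, ∀ s u,
      g (Function.update s 0 p.1) (Function.update u 0 p.2) = (Z.level (i + 2)).pt := by
    rintro ⟨p, q⟩ hp s u
    rcases hp with h | h | h | h <;> dsimp only at h ⊢ <;> rw [h]
    · exact hg.left _ ⟨0, Or.inl (by simp)⟩ _
    · exact hg.left _ ⟨0, Or.inr (by simp)⟩ _
    · exact hg.right _ _ ⟨0, Or.inl (by simp)⟩
    · exact hg.right _ _ ⟨0, Or.inr (by simp)⟩
  -- The exchange is the rotation followed by a reflection, and the reflection of a sphere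
  -- coordinate is negation.
  have key := (h.of_homotopy (H := fun l s u => g (Function.update s 0 (ρ (l, (s 0, u 0))).1)
      (Function.update u 0 (ρ (l, (s 0, u 0))).2))
    (g' := fun s u => g (Function.update s 0 (u 0))
      (Function.update u 0 (unitInterval.symm (s 0))))
    ⟨?_, fun l s hs u => ?_, fun l s u hu => ?_⟩ (fun s u => ?_) (fun s u => ?_)).neg
  · refine (congrArg (Rep (-x) i) (funext fun s => funext fun u => ?_)).mp key
    refine congrArg₂ g (funext fun k => ?_) (by simp)
    by_cases hk : k = 0
    · subst hk; simp
    · simp [hk]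
  · refine hgc.comp (Continuous.prodMk ?_ ?_)
    · exact Continuous.update (by fun_prop) 0 (by fun_prop)
    · exact Continuous.update (by fun_prop) 0 (by fun_prop)
  · obtain ⟨k, hk⟩ := hs
    by_cases hk0 : k = 0
    · subst hk0
      refine hb _ (hρb _ _ ?_) _ _
      rcases hk with hk | hk
      · exact Or.inl hk
      · exact Or.inr (Or.inl hk)
    · exact hg.left _ ⟨k, by rwa [Function.update_of_ne hk0]⟩ _
  · obtain ⟨k, hk⟩ := hu
    by_cases hk0 : k = 0
    · subst hk0
      refine hb _ (hρb _ _ ?_) _ _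
      rcases hk with hk | hk
      · exact Or.inr (Or.inr (Or.inl hk))
      · exact Or.inr (Or.inr (Or.inr hk))
    · exact hg.right _ _ ⟨k, by rwa [Function.update_of_ne hk0]⟩
  · simp [hρ₀]
  · simp [hρ₁]

/-- Exactness of `π_n(cone f) → π_n(ΣA) → π_n(ΣB)`. -/
theorem exists_of_map_susp_eq_zero {A B : Spectrum.{u}} (f : A ⟶ B)
    (x : (loopsPow n ⋙ pi0).obj (susp.obj A))
    (hx : (loopsPow n ⋙ pi0).map (susp.map f) x = 0) :
    ∃ y, (loopsPow n ⋙ pi0).map (conePinch f) y = x := by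
  obtain ⟨i, z, H, hz, hH, h₀, h₁⟩ := Rep.exists_of_map_eq_zero (susp.map f) hx
  have hzl := hz.isLoop
  have hsA := (suspStr A (i + 2)).cont
  have hsB := (suspStr B (i + 2)).cont
  -- The class in `cone f` glues two null-homotopies of the image of `σ z` in `B`: on the first half
  -- the given one, pushed up by the structure map of `B`, and on the second half the cone
  -- coordinate run from `1` to `0`.
  let v (s : Fin (i + 3) → unitInterval) (u : Fin n → unitInterval) :
      PtTop.cone (f.app (i + 3)) :=
    if (s 0 : ℝ) ≤ 1 / 2 then coneInr (f.app (i + 3)) ((suspStr B (i + 2)).toFun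
      (H (Set.projIcc 0 1 zero_le_one (2 * (s 0 : ℝ))) (fun k => s k.succ) u))
    else coneInl (f.app (i + 3)) (Set.projIcc 0 1 zero_le_one (2 - 2 * (s 0 : ℝ)))
      ((suspStr A (i + 2)).toFun (z (fun k => s k.succ) u))
  have hv : IsLoop (A := (cone f).level (i + 1 + 2)) v := by
    refine ⟨?_, fun s hs u => ?_, fun s u hu => ?_⟩
    · refine Continuous.if_le ?_ ?_ (by fun_prop) continuous_const ?_
      · exact continuous_coneInr (hsB.comp (hH.continuous_comp (continuous_projIcc.comp
          (by fun_prop)) (by fun_prop) (by fun_prop)))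
      · refine continuous_coneInl (continuous_projIcc.comp (by fun_prop))
          (hsA.comp (hzl.continuous_comp (by fun_prop) (by fun_prop)))
      · rintro ⟨s, u⟩ h
        dsimp only at h ⊢
        rw [h, show (2 * (1 / 2) : ℝ) = 1 by norm_num, show (2 - 1 : ℝ) = 1 by norm_num,
          Set.projIcc_right]
        refine Eq.trans ?_ (coneInl_one (f.app (i + 3)) _).symm
        refine congrArg _ ((congrArg _ (h₁ _ u)).trans ?_)
        exact (suspStr_naturality f (i + 2) _).symm
    · rcases mem_boundary_succ.mp hs with (h | h) | h
      · simp only [v, h]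
        rw [if_pos (by norm_num)]
        simp only [Set.Icc.coe_zero, mul_zero, Set.projIcc_left]
        refine (congrArg (coneInr _) ((congrArg _ (h₀ _ u)).trans (PtTop.Hom.map_pt _))).trans ?_
        exact coneInr_pt _
      · simp only [v, h]
        rw [if_neg (by norm_num)]
        simp only [Set.Icc.coe_one, mul_one, sub_self, Set.projIcc_left]
        exact coneInl_zero _ _
      · simp only [v]
        rw [hH.left _ _ h, hzl.left _ h]
        refine (congrArg₂ (fun p q => if (s 0 : ℝ) ≤ 1 / 2 then coneInr _ p else coneInl _ _ q)
          (PtTop.Hom.map_pt _) (PtTop.Hom.map_pt _)).trans ?_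
        rw [coneInr_pt, coneInl_pt, ite_self]
        rfl
    · simp only [v]
      rw [hH.right _ _ _ hu, hzl.right _ _ hu]
      refine (congrArg₂ (fun p q => if (s 0 : ℝ) ≤ 1 / 2 then coneInr _ p else coneInl _ _ q)
        (PtTop.Hom.map_pt _) (PtTop.Hom.map_pt _)).trans ?_
      rw [coneInr_pt, coneInl_pt, ite_self]
      rfl
  obtain ⟨y, hy⟩ := Rep.of_isLoop (n := n) (i := i + 1) (Z := cone f) hv
  -- Pinching kills the first half and leaves the suspension coordinate `2 - 2 s₀` on the second.
  -- Clamping `(2 - l)(1 - s₀)` covers both halves by one formula, since the coordinate `1` is also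
  -- the base point, and reaches `1 - s₀` at `l = 1`.
  have key := ((hy.map (conePinch f)).of_homotopy (H := fun l s u =>
      suspMk (Set.projIcc 0 1 zero_le_one ((2 - l : ℝ) * (1 - (s 0 : ℝ))))
        ((suspStr A (i + 2)).toFun (z (fun k => s k.succ) u)))
    (g' := fun s u => suspMk (unitInterval.symm (s 0))
        ((suspStr A (i + 2)).toFun (z (fun k => s k.succ) u)))
    ⟨?_, fun l s hs u => ?_, fun l s u hu => ?_⟩ (fun s u => ?_) (fun s u => ?_)).neg
  -- The sign from reversing `s₀` cancels the sign in `Rep.stab_susp`.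
  · have key' := Rep.stab_susp hzl (y := -(loopsPow n ⋙ pi0).map (conePinch f) y) (by
      convert key using 3 with s u
      simp [Fin.succ_ne_zero])
    rw [neg_neg] at key'
    exact ⟨y, key'.unique hz.stab⟩
  · exact continuous_suspMk (A := A.level (i + 2 + 1)) (continuous_projIcc.comp (by fun_prop))
      (hsA.comp (hzl.continuous_comp (by fun_prop) (by fun_prop)))
  · rcases mem_boundary_succ.mp hs with (h | h) | h
    · rw [h, Set.projIcc_of_right_le _ (by have := l.2.2; simp; linarith)]
      exact suspMk_one _
    · rw [h, Set.projIcc_of_le_left _ (by simp)]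
      exact suspMk_zero _
    · rw [hzl.left _ h]
      exact (congrArg _ (PtTop.Hom.map_pt _)).trans (suspMk_pt _)
  · rw [hzl.right _ _ hu]
    exact (congrArg _ (PtTop.Hom.map_pt _)).trans (suspMk_pt _)
  · simp only [v]
    split_ifs with h
    · rw [Set.projIcc_of_right_le _ (by simp; linarith)]
      exact suspMk_one _
    · refine congrArg (fun c => suspMk c _) (congrArg (Set.projIcc 0 1 zero_le_one) ?_)
      simp only [Set.Icc.coe_zero]
      ring
  · refine congrArg (fun c => suspMk c _) ?_
    refine (congrArg (Set.projIcc 0 1 zero_le_one) ?_).trans (Set.projIcc_val zero_le_one _)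
    simp only [unitInterval.coe_symm_eq, Set.Icc.coe_one]
    ring

/-- A null-homotopy in `ΩΣZ` becomes one of the stabilised representative: evaluate the loop at the
new sphere coordinate and apply the structure map `ΣZ_m → Z_{m+1}`. -/
theorem map_unit_injective (Z : Spectrum.{u}) :
    Function.Injective ((loopsPow n ⋙ pi0).map (unit Z)) := by
  refine (injective_iff_map_eq_zero ((loopsPow n ⋙ pi0).map (unit Z)).hom).mpr fun x hx => ?_
  obtain ⟨i, g, H, hg, hH, h₀, h₁⟩ := Rep.exists_of_map_eq_zero (unit Z) hx
  have hs := (suspStr Z (i + 2)).cont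
  have he : Continuous fun p : PtTop.loops ((susp.obj Z).level (i + 2)) × unitInterval =>
      PtTop.eval p.1 p.2 := continuous_eval
  refine hg.stab.eq_zero (H := fun l s u => (suspStr Z (i + 2)).toFun
    (PtTop.eval (A := (susp.obj Z).level (i + 2)) (H l (fun k => s k.succ) u) (s 0)))
    ⟨?_, fun l s hs u => ?_, fun l s u hu => ?_⟩ (fun s u => ?_) (fun s u => ?_)
  · exact hs.comp (he.comp ((hH.continuous_comp (by fun_prop) (by fun_prop) (by fun_prop)).prodMk (by fun_prop)))
  · rcases mem_boundary_succ.mp hs with (h | h) | h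
    · rw [h]
      exact (congrArg _ (Path.source _)).trans (PtTop.Hom.map_pt _)
    · rw [h]
      exact (congrArg _ (Path.target _)).trans (PtTop.Hom.map_pt _)
    · rw [hH.left _ _ h]
      exact PtTop.Hom.map_pt _
  · rw [hH.right _ _ _ hu]
    exact PtTop.Hom.map_pt _
  · rw [h₀]
    exact PtTop.Hom.map_pt _
  · rw [h₁]
    rfl

/-- The preimage uses the first loop coordinate of `z` as a new sphere coordinate, after composing
with the structure map `ΣZ_m → Z_{m+1}`. -/
theorem map_unit_surjective (Z : Spectrum.{u}) (x : (loopsPow (n + 1) ⋙ pi0).obj (susp.obj Z)) :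
    ∃ y : (loopsPow n ⋙ pi0).obj Z, suspHom Z (Int.ofNat n) y = x := by
  obtain ⟨i, z, hz⟩ := Rep.exists_rep x
  have hzl := hz.isLoop
  have hs := (suspStr Z (i + 2)).cont
  obtain ⟨y, hy⟩ := Rep.of_isLoop (n := n) (i := i + 1) (Z := Z)
    (g := fun s u => (suspStr Z (i + 2)).toFun (z (fun k => s k.succ) (Fin.cons (s 0) u))) (by
      refine ⟨?_, fun s hs u => ?_, fun s u hu => ?_⟩
      · exact hs.comp (hzl.continuous_comp (by fun_prop)
          (Continuous.finCons (by fun_prop) (by fun_prop)))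
      · rcases mem_boundary_succ.mp hs with h | h
        · rw [hzl.right _ _ ⟨0, by simpa using h⟩]
          exact PtTop.Hom.map_pt _
        · rw [hzl.left _ h]
          exact PtTop.Hom.map_pt _
      · obtain ⟨k, hk⟩ := hu
        rw [hzl.right _ _ ⟨k.succ, by simpa using hk⟩]
        exact PtTop.Hom.map_pt _)
  refine ⟨y, ?_⟩
  -- Suspending `y` leaves the new sphere coordinate and the new loop coordinate in the wrong
  -- places. `Rep.swap` exchanges them at the cost of a sign, which `Rep.stab_susp` removes.
  have key := Rep.stab_susp hzl (y := -suspHom Z (Int.ofNat n) y) (by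
    refine (congrArg (Rep _ (i + 1)) (funext fun s => funext fun u => ?_)).mp hy.suspHom.swap
    have h₁ : (Fin.cons (Function.update s 0 (u 0) 0) fun k => Function.update u 0 (s 0) k.succ :
        Fin (n + 1) → unitInterval) = u := by
      exact funext (Fin.cases (by simp) fun k => by simp)
    have h₂ : (fun k : Fin (i + 2) => Function.update s 0 (u 0) k.succ) = fun k => s k.succ :=
      funext fun k => Function.update_of_ne (Fin.succ_ne_zero k) _ _
    exact congrArg₂ suspMk (Function.update_self ..)
      (congrArg (suspStr Z (i + 2)).toFun (congrArg₂ z h₂ h₁)))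
  refine (neg_neg (suspHom Z (Int.ofNat n) y)).symm.trans (key.unique hz.stab)

/-! ## Exactness of all stable homotopy groups -/

/-- The inverse of the interchange `Σ(cone f) → cone (Σf)`. -/
def coneSusp {A B : Spectrum.{u}} (f : A ⟶ B) : cone (susp.map f) ⟶ susp.obj (cone f) where
  app n :=
    { toFun := coneLift (c := (PtTop.susp (PtTop.cone (f.app n))).pt)
        (fun t => suspLift (c := (PtTop.susp (PtTop.cone (f.app n))).pt)
          (fun s a => suspMk s (coneInl (f.app n) t a)) (fun _ => suspMk_zero _)
          (fun _ => suspMk_one _) (fun s => (congrArg (suspMk s) (coneInl_pt _ _)).trans (suspMk_pt _)))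
        (suspLift (c := (PtTop.susp (PtTop.cone (f.app n))).pt)
          (fun s b => suspMk s (coneInr (f.app n) b)) (fun _ => suspMk_zero _)
          (fun _ => suspMk_one _) (fun s => suspMk_pt _))
        (suspMk_zero _)
        (fun c => by
          obtain ⟨s, a, rfl⟩ := susp_cases c
          exact (congrArg (suspMk s) (coneInl_zero _ _)).trans (suspMk_pt _))
        (fun t => suspMk_zero _)
        (fun c => by
          obtain ⟨s, a, rfl⟩ := susp_cases c
          exact congrArg (suspMk s) (coneInl_one _ _))
      cont := continuous_quot_lift _ (continuous_sum_dom.mpr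
        ⟨continuous_of_susp (continuous_suspMk (by fun_prop)
          (continuous_coneInl (by fun_prop) (by fun_prop))),
        continuous_quot_lift _ (continuous_suspMk (by fun_prop)
          (continuous_coneInr (by fun_prop)))⟩)
      map_pt := suspMk_zero _ }
  comm n t x := by
    obtain ⟨⟨s, y⟩ | y, rfl⟩ := Quot.exists_rep x <;> obtain ⟨q, rfl⟩ := Quot.exists_rep y <;> rfl

theorem suspCone_coneSusp {A B : Spectrum.{u}} (f : A ⟶ B) :
    suspCone f ≫ coneSusp f = 𝟙 _ := by
  ext n x
  obtain ⟨⟨s, y⟩, rfl⟩ := Quot.exists_rep x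
  obtain ⟨q | q, rfl⟩ := Quot.exists_rep y <;> rfl

theorem coneIncl_coneSusp {A B : Spectrum.{u}} (f : A ⟶ B) :
    coneIncl (susp.map f) ≫ coneSusp f = susp.map (coneIncl f) := by
  ext n x
  obtain ⟨q, rfl⟩ := Quot.exists_rep x
  rfl

/-- The exchange of the two suspension coordinates. -/
def suspSwap (A : Spectrum.{u}) : susp.obj (susp.obj A) ⟶ susp.obj (susp.obj A) where
  app n :=
    { toFun := suspLift (c := (PtTop.susp (PtTop.susp (A.level n))).pt)
        (fun s => suspLift (c := (PtTop.susp (PtTop.susp (A.level n))).pt)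
          (fun t a => suspMk t (suspMk s a)) (fun _ => suspMk_zero _)
          (fun _ => suspMk_one _) (fun t => (congrArg (suspMk t) (suspMk_pt _)).trans (suspMk_pt _)))
        (fun c => by
          obtain ⟨t, a, rfl⟩ := susp_cases c
          exact (congrArg (suspMk t) (suspMk_zero _)).trans (suspMk_pt _))
        (fun c => by
          obtain ⟨t, a, rfl⟩ := susp_cases c
          exact (congrArg (suspMk t) (suspMk_one _)).trans (suspMk_pt _))
        (fun s => suspMk_zero _)
      cont := continuous_quot_lift _ (continuous_of_susp (continuous_suspMk (by fun_prop)
        (continuous_suspMk (by fun_prop) (by fun_prop))))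
      map_pt := suspMk_zero _ }
  comm n t x := by
    obtain ⟨⟨s, y⟩, rfl⟩ := Quot.exists_rep x
    obtain ⟨q, rfl⟩ := Quot.exists_rep y
    rfl

theorem suspSwap_suspSwap (A : Spectrum.{u}) : suspSwap A ≫ suspSwap A = 𝟙 _ := by
  ext n x
  obtain ⟨⟨s, y⟩, rfl⟩ := Quot.exists_rep x
  obtain ⟨q, rfl⟩ := Quot.exists_rep y
  rfl

theorem suspSwap_naturality {A B : Spectrum.{u}} (f : A ⟶ B) :
    suspSwap A ≫ susp.map (susp.map f) = susp.map (susp.map f) ≫ suspSwap B := by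
  ext n x
  obtain ⟨⟨s, y⟩, rfl⟩ := Quot.exists_rep x
  obtain ⟨q, rfl⟩ := Quot.exists_rep y
  rfl

/-- The two sides order the two suspension coordinates differently. The correcting swap has itself
as inverse, so exactness passes through it without a computation of signs. -/
theorem suspCone_conePinch {A B : Spectrum.{u}} (f : A ⟶ B) :
    suspCone f ≫ conePinch (susp.map f) = susp.map (conePinch f) ≫ suspSwap A := by
  ext n x
  obtain ⟨⟨s, y⟩, rfl⟩ := Quot.exists_rep x
  obtain ⟨q | q, rfl⟩ := Quot.exists_rep y
  · rfl
  · exact (suspMk_zero _).symm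

theorem coneSusp_conePinch {A B : Spectrum.{u}} (f : A ⟶ B) :
    coneSusp f ≫ susp.map (conePinch f) = conePinch (susp.map f) ≫ suspSwap A := by
  ext n x
  obtain ⟨⟨s, y⟩ | y, rfl⟩ := Quot.exists_rep x <;> obtain ⟨q, rfl⟩ := Quot.exists_rep y
  · rfl
  · exact (suspMk_pt _).trans (suspMk_zero _).symm

/-- The part of the long exact sequence of a cofiber sequence of spectra involving the cofiber. -/
structure IsConeExact (F : Spectrum.{u} ⥤ AddCommGrpCat.{u}) : Prop where
  -- Stated for a map equal to the identity, so that it applies to `susp.map (𝟙 A)` without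
  -- transporting along an equality of cones.
  cone_id : ∀ {A : Spectrum.{u}} (f : A ⟶ A), f = 𝟙 A → ∀ x : F.obj (cone f), x = 0
  conePinch : ∀ {A B : Spectrum.{u}} (f : A ⟶ B) (x : F.obj (cone f)),
    F.map (conePinch f) x = 0 → ∃ y, F.map (coneIncl f) y = x
  susp : ∀ {A B : Spectrum.{u}} (f : A ⟶ B) (x : F.obj (susp.obj A)),
    F.map (susp.map f) x = 0 → ∃ y, F.map (Spectrum.conePinch f) y = x

theorem map_comp_apply (F : Spectrum.{u} ⥤ AddCommGrpCat.{u}) {A B C : Spectrum.{u}} (f : A ⟶ B)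
    (g : B ⟶ C) (x : F.obj A) : F.map (f ≫ g) x = F.map g (F.map f x) := by
  rw [F.map_comp]
  rfl

theorem map_id_apply (F : Spectrum.{u} ⥤ AddCommGrpCat.{u}) {A : Spectrum.{u}} (x : F.obj A) :
    F.map (𝟙 A) x = x := by
  rw [F.map_id]
  rfl

/-- Suspension commutes with mapping cones up to the isomorphism `suspCone`. Repeated use passes
from degree `0` to the negative degrees, where homotopy groups are defined by suspending. -/
theorem IsConeExact.suspComp {F : Spectrum.{u} ⥤ AddCommGrpCat.{u}} (hF : IsConeExact F) :
    IsConeExact (Spectrum.susp ⋙ F) where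
  cone_id f hf x := by
    have h : F.map (suspCone f) x = 0 :=
      hF.cone_id _ (by rw [hf, Spectrum.susp.map_id]) _
    have e := map_comp_apply F (suspCone f) (coneSusp f) x
    rw [suspCone_coneSusp, map_id_apply] at e
    exact e.trans ((congrArg _ h).trans (map_zero _))
  conePinch f x hx := by
    obtain ⟨y, hy⟩ := hF.conePinch (Spectrum.susp.map f) (F.map (suspCone f) x) (by
      rw [← map_comp_apply, suspCone_conePinch, map_comp_apply]
      exact (congrArg _ hx).trans (map_zero _))
    refine ⟨y, ?_⟩
    change F.map (Spectrum.susp.map (coneIncl f)) y = x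
    rw [← coneIncl_coneSusp, map_comp_apply, hy, ← map_comp_apply, suspCone_coneSusp, map_id_apply]
  susp f x hx := by
    obtain ⟨y, hy⟩ := hF.susp (Spectrum.susp.map f) (F.map (suspSwap _) x) (by
      rw [← map_comp_apply, suspSwap_naturality, map_comp_apply]
      exact (congrArg _ hx).trans (map_zero _))
    refine ⟨F.map (coneSusp f) y, ?_⟩
    change F.map (Spectrum.susp.map (Spectrum.conePinch f)) _ = x
    rw [← map_comp_apply, coneSusp_conePinch, map_comp_apply, hy, ← map_comp_apply,
      suspSwap_suspSwap, map_id_apply]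

theorem isConeExact_π (k : ℤ) : IsConeExact (π.{u} k) := by
  have h (n : ℕ) : IsConeExact (loopsPow.{u} n ⋙ pi0) :=
    ⟨fun f hf x => by subst hf; exact eq_zero_of_cone_id x, exists_of_map_conePinch_eq_zero,
      exists_of_map_susp_eq_zero⟩
  have h' (n : ℕ) : IsConeExact (suspPow.{u} n ⋙ pi0) := by
    induction n with
    | zero => exact h 0
    | succ n ih => exact ih.suspComp
  cases k with
  | ofNat n => exact h n
  | negSucc n => exact h' (n + 1)

theorem suspHom_bijective (Z : Spectrum.{u}) (k : ℤ) : Function.Bijective (suspHom Z k) := by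
  match k with
  | Int.ofNat n => exact ⟨map_unit_injective Z, map_unit_surjective Z⟩
  | Int.negSucc 0 => exact Function.bijective_id
  | Int.negSucc (_ + 1) => exact Function.bijective_id

theorem unit_naturality {Z W : Spectrum.{u}} (φ : Z ⟶ W) :
    unit Z ≫ loops.map (susp.map φ) = φ ≫ unit W := rfl

theorem suspHom_naturality {Z W : Spectrum.{u}} (φ : Z ⟶ W) (k : ℤ) (x : (π k).obj Z) :
    (π (k + 1)).map (susp.map φ) (suspHom Z k x) = suspHom W k ((π k).map φ x) := by
  match k with
  | Int.ofNat n =>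
    have h := map_comp_apply (loopsPow n ⋙ pi0) (unit Z) (loops.map (susp.map φ)) x
    rw [unit_naturality] at h
    exact h.symm.trans (map_comp_apply (loopsPow n ⋙ pi0) φ (unit W) x)
  | Int.negSucc 0 => rfl
  | Int.negSucc (_ + 1) => rfl

/-! ## Total cofibers of squares -/

/-- The retraction `(r, (s, x)) ↦ (r s, x)` of the cone of `cone (𝟙 N) → cone t` onto `cone t`. -/
def coneMul {N M : Spectrum.{u}} (t : N ⟶ M) :
    cone (coneMap (f := 𝟙 N) (f' := t) (𝟙 N) t rfl) ⟶ cone t where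
  app n :=
    { toFun := coneLift (c := (PtTop.cone (t.app n)).pt)
        (fun r => coneLift (c := (PtTop.cone (t.app n)).pt) (fun s x => coneInl (t.app n) (r * s) x)
          (coneInl (t.app n) r) (coneInl_pt _ _)
          (fun x => (congrArg (fun q => coneInl (t.app n) q x) (mul_zero r)).trans (coneInl_zero _ _))
          (fun _ => coneInl_pt _ _) (fun x => by rw [mul_one]; rfl))
        id rfl
        (fun c => by
          obtain ⟨s, x, rfl⟩ | ⟨x, rfl⟩ := cone_cases c
          · exact (congrArg (fun q => coneInl (t.app n) q x) (zero_mul s)).trans (coneInl_zero _ _)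
          · exact coneInl_zero _ _)
        (fun r => coneInl_pt _ _)
        (fun c => by
          obtain ⟨s, x, rfl⟩ | ⟨x, rfl⟩ := cone_cases c
          · exact congrArg (fun q => coneInl (t.app n) q x) (one_mul s)
          · exact coneInl_one _ _)
      cont := continuous_quot_lift _ (continuous_sum_dom.mpr ⟨continuous_of_cone
        (continuous_coneInl (by fun_prop) (by fun_prop))
        (continuous_coneInl (by fun_prop) (by fun_prop)), continuous_id⟩)
      map_pt := rfl }
  comm n t x := by
    obtain ⟨⟨s, y⟩ | y, rfl⟩ := Quot.exists_rep x
    · obtain ⟨q | q, rfl⟩ := Quot.exists_rep y <;> rfl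
    · rfl

/-- The map `(r, (s, x)) ↦ [r s, x]` from the cone of `cone (𝟙 N) → ΣN` to `ΣN`. -/
def suspMul (N : Spectrum.{u}) : cone (conePinch (𝟙 N)) ⟶ susp.obj N where
  app n :=
    { toFun := coneLift (c := (PtTop.susp (N.level n)).pt)
        (fun r => coneLift (c := (PtTop.susp (N.level n)).pt) (fun s x => suspMk (r * s) x)
          (suspMk r) (suspMk_pt _)
          (fun x => (congrArg (fun q => suspMk q x) (mul_zero r)).trans (suspMk_zero _))
          (fun _ => suspMk_pt _) (fun x => by rw [mul_one]; rfl))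
        id rfl
        (fun c => by
          obtain ⟨s, x, rfl⟩ | ⟨x, rfl⟩ := cone_cases c
          · exact (congrArg (fun q => suspMk q x) (zero_mul s)).trans (suspMk_zero _)
          · exact suspMk_zero _)
        (fun r => suspMk_pt _)
        (fun c => by
          obtain ⟨s, x, rfl⟩ | ⟨x, rfl⟩ := cone_cases c
          · exact congrArg (fun q => suspMk q x) (one_mul s)
          · exact suspMk_one _)
      cont := continuous_quot_lift _ (continuous_sum_dom.mpr ⟨continuous_of_cone
        (continuous_suspMk (by fun_prop) (by fun_prop))
        (continuous_suspMk (by fun_prop) (by fun_prop)), continuous_id⟩)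
      map_pt := rfl }
  comm n t x := by
    obtain ⟨⟨s, y⟩ | y, rfl⟩ := Quot.exists_rep x
    · obtain ⟨q | q, rfl⟩ := Quot.exists_rep y <;> rfl
    · rfl

theorem coneMap_conePinch {A B A' B' : Spectrum.{u}} {f : A ⟶ B} {f' : A' ⟶ B'} (a : A ⟶ A')
    (b : B ⟶ B') (h : f ≫ b = a ≫ f') :
    coneMap a b h ≫ conePinch f' = conePinch f ≫ susp.map a := by
  ext n x
  obtain ⟨q | q, rfl⟩ := Quot.exists_rep x
  · rfl
  · exact (PtTop.Hom.map_pt ((susp.map a).app n)).symm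

/-- `F` is not assumed additive: the zero map acts by zero because it factors through the cone of an
identity. -/
theorem IsConeExact.map_zero_apply {F : Spectrum.{u} ⥤ AddCommGrpCat.{u}} (hF : IsConeExact F)
    (A B : Spectrum.{u}) (x : F.obj A) : F.map (zero A B) x = 0 := by
  have e : zero A B = coneIncl (𝟙 A) ≫ zero (cone (𝟙 A)) B := rfl
  rw [e, map_comp_apply, hF.cone_id _ rfl (F.map (coneIncl (𝟙 A)) x), map_zero]

section Square

variable {A B A' B' : Spectrum.{u}} {f : A ⟶ B} {f' : A' ⟶ B'} (a : A ⟶ A') (b : B ⟶ B')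
  (h : f ≫ b = a ≫ f')

/-- The quotient of the total cofiber of a square by its last corner. -/
abbrev squareQuot (f : A ⟶ B) (a : A ⟶ A') : Spectrum.{u} := cone (conePinch f ≫ susp.map a)

/-- The quotient map from the total cofiber. -/
def toSquareQuot : cone (coneMap a b h) ⟶ squareQuot f a :=
  coneMap (𝟙 _) (conePinch f') ((coneMap_conePinch a b h).trans (Category.id_comp _).symm)

/-- The map `[t, b] ↦ (t, b)`. -/
def suspToSquareQuot (f : A ⟶ B) (a : A ⟶ A') : susp.obj B ⟶ squareQuot f a where
  app n :=
    { toFun := suspLift (c := (PtTop.cone ((conePinch f ≫ susp.map a).app n)).pt)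
        (fun t b => coneInl ((conePinch f ≫ susp.map a).app n) t (coneInr (f.app n) b))
        (fun _ => coneInl_zero _ _)
        (fun b => (coneInl_one _ _).trans (congrArg (coneInr _)
          (PtTop.Hom.map_pt ((susp.map a).app n))))
        (fun _ => coneInl_pt _ _)
      cont := continuous_quot_lift _ (continuous_coneInl (by fun_prop)
        (continuous_coneInr (by fun_prop)))
      map_pt := coneInl_zero _ _ }
  comm n t x := by
    obtain ⟨q, rfl⟩ := Quot.exists_rep x
    rfl

/-- The projection `(t, (s, a)) ↦ [s, (t, a)]` collapsing `ΣB`. -/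
def squareQuotPinch (f : A ⟶ B) (a : A ⟶ A') : squareQuot f a ⟶ susp.obj (cone a) where
  app n :=
    { toFun := coneLift (c := (PtTop.susp (PtTop.cone (a.app n))).pt)
        (fun t => coneLift (c := (PtTop.susp (PtTop.cone (a.app n))).pt)
          (fun s x => suspMk s (coneInl (a.app n) t x))
          (fun _ => (PtTop.susp (PtTop.cone (a.app n))).pt) rfl (fun _ => suspMk_zero _)
          (fun s => (congrArg (suspMk s) (coneInl_pt _ _)).trans (suspMk_pt _))
          (fun _ => suspMk_one _))
        (suspMap (PtTop.coneIncl (a.app n))).toFun (PtTop.Hom.map_pt _)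
        (fun c => by
          obtain ⟨s, x, rfl⟩ | ⟨x, rfl⟩ := cone_cases c
          · exact (congrArg (suspMk s) (coneInl_zero _ _)).trans (suspMk_pt _)
          · rfl)
        (fun _ => rfl)
        (fun c => by
          obtain ⟨s, x, rfl⟩ | ⟨x, rfl⟩ := cone_cases c
          · exact congrArg (suspMk s) (coneInl_one _ _)
          · exact (suspMk_zero _).symm)
      cont := continuous_quot_lift _ (continuous_sum_dom.mpr ⟨continuous_of_cone
        (continuous_suspMk (by fun_prop) (continuous_coneInl (by fun_prop) (by fun_prop)))
        continuous_const, PtTop.Hom.cont _⟩)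
      map_pt := PtTop.Hom.map_pt (suspMap (PtTop.coneIncl (a.app n))) }
  comm n t x := by
    obtain ⟨⟨s, y⟩ | y, rfl⟩ := Quot.exists_rep x
    · obtain ⟨q | q, rfl⟩ := Quot.exists_rep y
      · rfl
      · exact ((susp.obj (cone a)).str_pt n t).symm
    · obtain ⟨q, rfl⟩ := Quot.exists_rep y
      rfl

/-- The map `(t, (s, a)) ↦ [t s, f' a]` to the suspension of the last corner. -/
def squareQuotMul : squareQuot f a ⟶ susp.obj B' :=
  coneMap (f' := conePinch (𝟙 B')) (coneMap (f' := 𝟙 B') (f ≫ b) b (Category.comp_id _).symm)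
    (susp.map f') (by
      rw [coneMap_conePinch, Category.assoc, ← susp.map_comp, h]) ≫ suspMul B'

theorem toSquareQuot_conePinch : toSquareQuot a b h ≫ conePinch (conePinch f ≫ susp.map a) =
    conePinch (coneMap a b h) := by
  rw [toSquareQuot, coneMap_conePinch, susp.map_id, Category.comp_id]

/-- Collapsing the last corner retains the boundary of the total cofiber in the other direction, the
one toward `Σ(cone a)`. -/
theorem toSquareQuot_squareQuotPinch : toSquareQuot a b h ≫ squareQuotPinch f a =
    coneSwap a b h ≫ conePinch (coneMap f f' h.symm) := by
  ext n x
  obtain ⟨⟨s, y⟩ | y, rfl⟩ := Quot.exists_rep x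
  · obtain ⟨q | q, rfl⟩ := Quot.exists_rep y <;> rfl
  · obtain ⟨q | q, rfl⟩ := Quot.exists_rep y
    · rfl
    · exact suspMk_zero _

/-- The form of the right-hand side is what matters: the composite passes through the contractible
`cone (𝟙 B')`, so it vanishes on homotopy groups. -/
theorem toSquareQuot_squareQuotMul : toSquareQuot a b h ≫ squareQuotMul a b h =
    coneMap (f' := coneMap (f := 𝟙 B') (f' := 𝟙 B') (𝟙 _) (𝟙 _) rfl)
      (coneMap (f' := 𝟙 B') (f ≫ b) b (Category.comp_id _).symm)
      (coneMap (f' := 𝟙 B') f' (𝟙 _) rfl) (by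
        refine coneMap_square _ _ _ _ ?_ ?_
        · rw [Category.comp_id]; exact h.symm
        · rfl) ≫ coneMul (𝟙 B') ≫ conePinch (𝟙 B') := by
  ext n x
  obtain ⟨⟨s, y⟩ | y, rfl⟩ := Quot.exists_rep x
  · obtain ⟨q | q, rfl⟩ := Quot.exists_rep y
    · rfl
    · rfl
  · obtain ⟨q | q, rfl⟩ := Quot.exists_rep y
    · rfl
    · exact suspMk_zero _

theorem suspToSquareQuot_conePinch : suspToSquareQuot f a ≫ conePinch (conePinch f ≫ susp.map a) =
    susp.map (coneIncl f) := by
  ext n x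
  obtain ⟨q, rfl⟩ := Quot.exists_rep x
  rfl

theorem suspToSquareQuot_squareQuotPinch :
    suspToSquareQuot f a ≫ squareQuotPinch f a = zero _ _ := by
  ext n x
  obtain ⟨q, rfl⟩ := Quot.exists_rep x
  rfl

theorem suspToSquareQuot_squareQuotMul :
    suspToSquareQuot f a ≫ squareQuotMul a b h = susp.map b := by
  ext n x
  obtain ⟨q, rfl⟩ := Quot.exists_rep x
  rfl

theorem coneIncl_squareQuotPinch :
    coneIncl (conePinch f ≫ susp.map a) ≫ squareQuotPinch f a = susp.map (coneIncl a) := rfl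

theorem coneIncl_squareQuotMul :
    coneIncl (conePinch f ≫ susp.map a) ≫ squareQuotMul a b h = susp.map f' := rfl

/-- Let `ξ` be a class in the total cofiber of a square whose boundary in `Σ(cone f)` is `-[y]` for
a class `y` of `B`. Then the boundary of `ξ` in `Σ(cone a)` comes from a class of `A'` with the same
image in `B'` as `y`. -/
theorem exists_of_total (j : ℤ) (ξ : (π (j + 1)).obj (cone (coneMap a b h))) (y : (π j).obj B)
    (hy : (π (j + 1)).map (conePinch (coneMap a b h)) ξ =
      -(π (j + 1)).map (susp.map (coneIncl f)) (suspHom B j y)) :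
    ∃ x : (π j).obj A', (π j).map f' x = (π j).map b y ∧
      (π (j + 1)).map (susp.map (coneIncl a)) (suspHom A' j x) =
        (π (j + 1)).map (coneSwap a b h ≫ conePinch (coneMap f f' h.symm)) ξ := by
  have hF := isConeExact_π.{u} (j + 1)
  let S {Z : Spectrum.{u}} (z : (π j).obj Z) : (π (j + 1)).obj (susp.obj Z) := suspHom Z j z
  have hS {Z W : Spectrum.{u}} (φ : Z ⟶ W) (z : (π j).obj Z) :
      (π (j + 1)).map (susp.map φ) (S z) = S ((π j).map φ z) := suspHom_naturality φ j z
  -- Once the last corner is collapsed, `y` has a second image, along `ΣB`, whose boundary is `[y]`.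
  -- Adding it cancels the boundary `-[y]` of `ξ`, so the sum comes from `ΣA'`; this is where the
  -- sign convention for differentials is used.
  have e₁ : (π (j + 1)).map (conePinch (conePinch f ≫ susp.map a))
      ((π (j + 1)).map (toSquareQuot a b h) ξ + (π (j + 1)).map (suspToSquareQuot f a) (S y)) =
        0 := by
    rw [map_add, ← map_comp_apply, ← map_comp_apply, toSquareQuot_conePinch,
      suspToSquareQuot_conePinch, hy]
    exact neg_add_cancel _
  obtain ⟨x', hx'⟩ := hF.conePinch _ _ e₁
  obtain ⟨x, rfl⟩ : ∃ x, S x = x' := (suspHom_bijective A' j).2 x'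
  refine ⟨x, (suspHom_bijective B' j).1 ?_, ?_⟩
  -- In `ΣB'` the contribution of `ξ` vanishes, leaving the desired equality of the images of `x`
  -- and `y`.
  · have e₂ := congrArg ((π (j + 1)).map (squareQuotMul a b h)) hx'
    rw [map_add, ← map_comp_apply, ← map_comp_apply, ← map_comp_apply, coneIncl_squareQuotMul,
      toSquareQuot_squareQuotMul, suspToSquareQuot_squareQuotMul, map_comp_apply, map_comp_apply,
      hF.cone_id _ rfl ((π (j + 1)).map (coneMul (𝟙 B')) _), map_zero, zero_add, hS, hS] at e₂
    exact e₂
  -- This projection kills the contribution of `y` and keeps the other boundary of `ξ`.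
  · have e₂ := congrArg ((π (j + 1)).map (squareQuotPinch f a)) hx'
    rw [map_add, ← map_comp_apply, ← map_comp_apply, ← map_comp_apply, coneIncl_squareQuotPinch,
      toSquareQuot_squareQuotPinch, suspToSquareQuot_squareQuotPinch, hF.map_zero_apply,
      add_zero] at e₂
    exact e₂

end Square

end Spectrum

end

/-! ### Lifting along quotients and the geometric core -/

namespace Spectrum

/-- Consecutive maps of the cofiber sequence compose to a map through a contractible cone. -/
theorem conePinch_susp {A B : Spectrum.{u}} (f : A ⟶ B) :
    conePinch f ≫ susp.map f = coneMap (f' := 𝟙 B) f (𝟙 B) rfl ≫ conePinch (𝟙 B) :=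
  (coneMap_conePinch f (𝟙 B) rfl).symm

/-- A class of `cone t` whose boundary is divisible by `l` lifts to the cofiber of `l ≫ t`. -/
theorem IsConeExact.exists_lift {F : Spectrum.{u} ⥤ AddCommGrpCat.{u}} (hF : IsConeExact F)
    {A B C : Spectrum.{u}} (l : A ⟶ B) (t : B ⟶ C) (x : F.obj (cone t)) (w : F.obj (Spectrum.susp.obj A))
    (h : F.map (Spectrum.conePinch t) x = F.map (Spectrum.susp.map l) w) :
    ∃ z : F.obj (cone (l ≫ t)), F.map (Spectrum.conePinch (l ≫ t)) z = w ∧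
      F.map (coneMap (f' := t) l (𝟙 C) (Category.comp_id _)) z = x := by
  obtain ⟨z, hz⟩ := hF.susp (l ≫ t) w (by
    rw [Spectrum.susp.map_comp, map_comp_apply, ← h, ← map_comp_apply, conePinch_susp,
      map_comp_apply, hF.cone_id _ rfl (F.map _ x), map_zero])
  -- The lift `z` has the right boundary, but its image may differ from `x`. The difference has zero
  -- boundary, so it comes from `C`, and subtracting that class does not change the boundary of `z`.
  obtain ⟨c, hc⟩ := hF.conePinch t
    (F.map (coneMap (f' := t) l (𝟙 C) (Category.comp_id _)) z - x) (by
    rw [map_sub, ← map_comp_apply, coneMap_conePinch, map_comp_apply, hz, h, sub_self])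
  refine ⟨z - F.map (coneIncl (l ≫ t)) c, ?_, ?_⟩
  · rw [map_sub, ← map_comp_apply, hz,
      show coneIncl (l ≫ t) ≫ Spectrum.conePinch (l ≫ t) = zero _ _ from rfl, hF.map_zero_apply,
      sub_zero]
  · rw [map_sub, ← map_comp_apply,
      show coneIncl (l ≫ t) ≫ coneMap (f' := t) l (𝟙 C) (Category.comp_id _) = coneIncl t from rfl,
      hc, sub_sub_cancel]

theorem coneIncl_coneMul {N M : Spectrum.{u}} (t : N ⟶ M) :
    coneMap (coneIncl (𝟙 N)) (coneIncl t) rfl ≫ coneMul t = 𝟙 (cone t) := by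
  ext n x
  obtain ⟨q | q, rfl⟩ := Quot.exists_rep x
  · rfl
  · rfl

theorem coneSwap_naturality {A B A' B' U V U' V' : Spectrum.{u}} {f : A ⟶ B} {f' : A' ⟶ B'}
    {a : A ⟶ A'} {b : B ⟶ B'} (h : f ≫ b = a ≫ f') {g : U ⟶ V} {g' : U' ⟶ V'} {c : U ⟶ U'}
    {d : V ⟶ V'} (k : g ≫ d = c ≫ g') (i : A ⟶ U) (j : B ⟶ V) (i' : A' ⟶ U') (j' : B' ⟶ V')
    (hij : f ≫ j = i ≫ g) (hij' : f' ≫ j' = i' ≫ g') (hi : a ≫ i' = i ≫ c) (hj : b ≫ j' = j ≫ d) :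
    coneMap (f := coneMap a b h) (f' := coneMap c d k) (coneMap i j hij) (coneMap i' j' hij')
        (coneMap_square _ _ _ _ hi hj) ≫ coneSwap c d k =
      coneSwap a b h ≫ coneMap (f := coneMap f f' h.symm) (f' := coneMap g g' k.symm)
        (coneMap i i' hi) (coneMap j j' hj) (coneMap_square _ _ _ _ hij hij') := by
  ext n x
  obtain ⟨⟨s, y⟩ | y, rfl⟩ := Quot.exists_rep x <;> obtain ⟨q | q, rfl⟩ := Quot.exists_rep y <;> rfl

/-- The geometric input for hidden extensions. The spectra `X₀`, `X₁`, `Xₖ` stand for the values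
of `X`, `Σ^{0,-1}X`, `Σ^{0,-k}X`, and `QX`, `RX` for those of `Σ^{0,-k}(X/τ)`, `X/τ^{k+1}`. -/
theorem exists_lift_with_image {Xₖ X₁ X₀ Yₖ Y₀ Cₖ C₁ QX QY RX RY Z : Spectrum.{u}}
    {α₀ : X₀ ⟶ Y₀} {αₖ : Xₖ ⟶ Yₖ} {tX : X₁ ⟶ X₀} {lX : Xₖ ⟶ X₁} {sY : Yₖ ⟶ Y₀}
    (hs : αₖ ≫ sY = (lX ≫ tX) ≫ α₀) (d : Cₖ ⟶ cone αₖ) {tC : C₁ ⟶ cone α₀} {lC : Cₖ ⟶ C₁}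
    (hC : lC ≫ tC = d ≫ coneMap (lX ≫ tX) sY hs)
    {f : QX ⟶ QY} {f' : RX ⟶ RY} {a : QX ⟶ RX} {b : QY ⟶ RY} (h : f ≫ b = a ≫ f')
    {iX : Xₖ ⟶ QX} {iY : Yₖ ⟶ QY} (hi : αₖ ≫ iY = iX ≫ f) {rX : X₀ ⟶ RX} {rY : Y₀ ⟶ RY}
    (hr : α₀ ≫ rY = rX ≫ f') (hX : (lX ≫ tX) ≫ rX = iX ≫ a) (hY : sY ≫ rY = iY ≫ b)
    {p : QX ⟶ cone (𝟙 X₁)} {red : RX ⟶ cone tX}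
    (hp : a ≫ red = p ≫ coneMap (f' := tX) (𝟙 X₁) tX rfl)
    (hip : iX ≫ p = lX ≫ coneIncl (𝟙 X₁)) (hred : rX ≫ red = coneIncl tX)
    {m : Z ⟶ cone f} {redC : Cₖ ⟶ Z} {iZ : QY ⟶ Z} (hm : redC ≫ m = d ≫ coneMap iX iY hi)
    (hm' : iZ ≫ m = coneIncl f) {e : cone tC ⟶ susp.obj (cone tX)}
    (he : coneMap (f := lC ≫ tC) lC (𝟙 _) (Category.comp_id _) ≫ e =
      coneMap (f' := coneMap (lX ≫ tX) sY hs) d (𝟙 _) ((Category.comp_id _).trans hC) ≫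
        coneSwap (lX ≫ tX) sY hs ≫ conePinch (coneMap αₖ α₀ hs.symm) ≫
          susp.map (coneMap lX (𝟙 X₀) (Category.comp_id _)))
    {j : ℤ} (x : (π j).obj (cone tX)) (y : (π j).obj QY) (x' : (π (j + 1)).obj (cone tC))
    (w : (π (j + 1)).obj (susp.obj Cₖ))
    (hx : (π (j + 1)).map e x' = suspHom (cone tX) j x)
    (hw : (π (j + 1)).map (conePinch tC) x' = (π (j + 1)).map (susp.map lC) w)
    (hy : (π (j + 1)).map (susp.map redC) w =
      -(π (j + 1)).map (susp.map iZ) (suspHom QY j y)) :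
    ∃ z : (π j).obj RX, (π j).map red z = x ∧ (π j).map f' z = (π j).map b y := by
  -- The lift of `x̄` to `Cα/τ^k` with boundary `w`. Below, `Ψ` identifies `Cα/τ^k` with the total
  -- cofiber of the square of `α` and `τ^k`, and `Φ` maps that to the total cofiber of the square of
  -- quotients.
  obtain ⟨v, hv, hv'⟩ := (isConeExact_π (j + 1)).exists_lift lC tC x' w hw
  let Φ : cone (coneMap (lX ≫ tX) sY hs) ⟶ cone (coneMap a b h) :=
    coneMap (coneMap iX iY hi) (coneMap rX rY hr) (coneMap_square _ _ _ _ hX hY)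
  let Ψ : cone (lC ≫ tC) ⟶ cone (coneMap (lX ≫ tX) sY hs) :=
    coneMap d (𝟙 _) ((Category.comp_id _).trans hC)
  obtain ⟨z, hz, hz'⟩ := exists_of_total a b h j ((π (j + 1)).map (Ψ ≫ Φ) v) y (by
    rw [← map_comp_apply, Category.assoc, coneMap_conePinch, ← Category.assoc, coneMap_conePinch,
      Category.assoc, ← susp.map_comp, ← hm, map_comp_apply, hv, susp.map_comp, map_comp_apply, hy,
      map_neg, ← map_comp_apply, ← susp.map_comp, hm'])
  refine ⟨z, (suspHom_bijective _ j).1 ?_, hz⟩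
  -- Since `a ≫ red` factors through `cone (𝟙 X₁)` by `p`, the reduction `X/τ^{k+1} → X/τ` extends
  -- over the cofiber of `a`. On `X/τ^k` this extension is the usual reduction.
  have key : coneMap (f := lX ≫ tX) (f' := a) iX rX hX ≫
      coneMap (f := a) (f' := coneMap (f' := tX) (𝟙 X₁) tX rfl) p red hp ≫ coneMul tX =
        coneMap lX (𝟙 X₀) (Category.comp_id _) := by
    rw [← Category.assoc, coneMap_square (f₃ := tX) hX hp (c := lX) (d := 𝟙 _) (Category.comp_id _)
      (c' := coneIncl (𝟙 X₁)) (d' := coneIncl tX) rfl hip (hred.trans (Category.id_comp _).symm),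
      Category.assoc, coneIncl_coneMul, Category.comp_id]
  -- Apply the extended reduction to the second conclusion of `exists_of_total`: one side becomes
  -- the suspension of `red z`, the other the image of `x̄` under `e`, which is the suspension of
  -- `x`.
  have hz'' := congrArg ((π (j + 1)).map (susp.map (coneMap (f' := coneMap (f' := tX) (𝟙 X₁) tX rfl)
    p red hp ≫ coneMul tX))) hz'
  rw [← map_comp_apply, ← susp.map_comp, ← map_comp_apply, ← map_comp_apply] at hz''
  refine ((suspHom_naturality red j z).symm.trans hz'').trans ?_
  rw [← hx, ← hv', ← map_comp_apply, he]
  refine congrArg (fun k => (π (j + 1)).map k v) ?_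
  have hn := coneSwap_naturality hs h iX iY rX rY hi hr hX hY
  simp only [Ψ, Φ, Category.assoc]
  refine congrArg (fun k => _ ≫ k) ?_
  rw [← Category.assoc, hn]
  refine (Category.assoc _ _ _).trans (congrArg (fun k => coneSwap _ _ hs ≫ k) ?_)
  rw [← Category.assoc, coneMap_conePinch]
  refine (Category.assoc _ _ _).trans (congrArg (fun k => conePinch _ ≫ k) ?_)
  rw [← susp.map_comp, key]

theorem coneSusp_suspCone {A B : Spectrum.{u}} (f : A ⟶ B) :
    coneSusp f ≫ suspCone f = 𝟙 _ := by
  ext n x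
  obtain ⟨⟨s, y⟩ | y, rfl⟩ := Quot.exists_rep x <;> obtain ⟨q, rfl⟩ := Quot.exists_rep y <;> rfl

/-- One boundary of the total cofiber can be computed before forming the cones in the other
direction. At presheaf level this compares `δ_α` modulo `τ` with the boundary of the total cofiber.
-/
theorem coneSwap_conePinch_suspCone {A B A' B' : Spectrum.{u}} {f : A ⟶ B} {f' : A' ⟶ B'}
    (a : A ⟶ A') (b : B ⟶ B') (h : f ≫ b = a ≫ f') :
    coneSwap a b h ≫ conePinch (coneMap f f' h.symm) ≫ suspCone a =
      coneMap (conePinch f) (conePinch f') (coneMap_conePinch a b h) := by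
  ext n x
  obtain ⟨⟨s, y⟩ | y, rfl⟩ := Quot.exists_rep x
  · obtain ⟨q | q, rfl⟩ := Quot.exists_rep y
    · rfl
    · exact (Quot.sound (.base _)).symm
  · obtain ⟨q | q, rfl⟩ := Quot.exists_rep y <;> rfl

end Spectrum

namespace Psh

variable {E : RingSpectrum}

theorem hom_ext {X Y : Psh.{u} E} {f g : X ⟶ Y} (h : ∀ P, f.hom.app P = g.hom.app P) : f = g :=
  ObjectProperty.hom_ext _ (NatTrans.ext (funext h))

/-! ## Functoriality of cofibers of presheaves -/

/-- The interchange of the two cofibers attached to a commutative square. -/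
def coneSwap {A B A' B' : Psh.{u} E} {f : A ⟶ B} {f' : A' ⟶ B'} (a : A ⟶ A') (b : B ⟶ B')
    (h : f ≫ b = a ≫ f') : cone (coneMap a b h) ⟶ cone (coneMap f f' h.symm) :=
  ObjectProperty.homMk
    { app := fun P => Spectrum.coneSwap (a.hom.app P) (b.hom.app P)
        (congrArg (fun k : A ⟶ B' => k.hom.app P) h)
      naturality := fun P Q g => by
        refine Spectrum.hom_ext fun n x => ?_
        obtain ⟨⟨s, y⟩ | y, rfl⟩ := Quot.exists_rep x <;>
          obtain ⟨q | q, rfl⟩ := Quot.exists_rep y <;> rfl }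

theorem coneMap_comp {A B A' B' A'' B'' : Psh.{u} E} {f : A ⟶ B} {f' : A' ⟶ B'} {f'' : A'' ⟶ B''}
    {a : A ⟶ A'} {b : B ⟶ B'} (h : f ≫ b = a ≫ f') {a' : A' ⟶ A''} {b' : B' ⟶ B''}
    (h' : f' ≫ b' = a' ≫ f'') {a'' : A ⟶ A''} {b'' : B ⟶ B''} (ha : a ≫ a' = a'')
    (hb : b ≫ b' = b'') : coneMap a b h ≫ coneMap a' b' h' = coneMap a'' b''
      (by rw [← ha, ← hb, ← Category.assoc, h, Category.assoc, h', Category.assoc]) := by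
  subst ha hb
  refine hom_ext fun P => Spectrum.hom_ext fun n x => ?_
  obtain ⟨q | q, rfl⟩ := Quot.exists_rep x <;> rfl

theorem coneMap_id {A B : Psh.{u} E} (f : A ⟶ B) (h : f ≫ 𝟙 B = 𝟙 A ≫ f) :
    coneMap (𝟙 A) (𝟙 B) h = 𝟙 (cone f) :=
  hom_ext fun P => Spectrum.coneMap_id (congrArg (comp · P.unop) h) rfl rfl

theorem coneIncl_coneMap {A B A' B' : Psh.{u} E} {f : A ⟶ B} {f' : A' ⟶ B'} (a : A ⟶ A')
    (b : B ⟶ B') (h : f ≫ b = a ≫ f') : coneIncl f ≫ coneMap a b h = b ≫ coneIncl f' :=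
  rfl

theorem coneMap_conePinch {A B A' B' : Psh.{u} E} {f : A ⟶ B} {f' : A' ⟶ B'} (a : A ⟶ A')
    (b : B ⟶ B') (h : f ≫ b = a ≫ f') :
    coneMap a b h ≫ conePinch f' = conePinch f ≫ susp.map a :=
  hom_ext fun P => Spectrum.coneMap_conePinch _ _ (congrArg (comp · P.unop) h)

theorem coneSwap_naturality {A B A' B' U V U' V' : Psh.{u} E} {f : A ⟶ B} {f' : A' ⟶ B'}
    {a : A ⟶ A'} {b : B ⟶ B'} (h : f ≫ b = a ≫ f') {g : U ⟶ V} {g' : U' ⟶ V'} {c : U ⟶ U'}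
    {d : V ⟶ V'} (k : g ≫ d = c ≫ g') (i : A ⟶ U) (j : B ⟶ V) (i' : A' ⟶ U') (j' : B' ⟶ V')
    (hij : f ≫ j = i ≫ g) (hij' : f' ≫ j' = i' ≫ g') (hi : a ≫ i' = i ≫ c) (hj : b ≫ j' = j ≫ d) :
    coneMap (f := coneMap a b h) (f' := coneMap c d k) (coneMap i j hij) (coneMap i' j' hij')
        ((coneMap_comp _ _ hi hj).trans (coneMap_comp hij k rfl rfl).symm) ≫ coneSwap c d k =
      coneSwap a b h ≫ coneMap (f := coneMap f f' h.symm) (f' := coneMap g g' k.symm)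
        (coneMap i i' hi) (coneMap j j' hj)
        ((coneMap_comp _ _ hij hij').trans (coneMap_comp hi k.symm rfl rfl).symm) :=
  hom_ext fun P => Spectrum.coneSwap_naturality _ _ _ _ _ _ (congrArg (comp · P.unop) hij)
    (congrArg (comp · P.unop) hij') (congrArg (comp · P.unop) hi) (congrArg (comp · P.unop) hj)

theorem coneSwap_conePinch_suspCone {A B A' B' : Psh.{u} E} {f : A ⟶ B} {f' : A' ⟶ B'}
    (a : A ⟶ A') (b : B ⟶ B') (h : f ≫ b = a ≫ f') :
    coneSwap a b h ≫ conePinch (coneMap f f' h.symm) ≫ suspCone a =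
      coneMap (conePinch f) (conePinch f') (coneMap_conePinch a b h) :=
  hom_ext fun _ => Spectrum.coneSwap_conePinch_suspCone _ _ _

theorem map_coneIncl_dCone {A B : Psh.{u} E} (f : A ⟶ B) :
    D.map (coneIncl f) ≫ dCone f = coneIncl (D.map f) := by
  refine hom_ext fun P => Spectrum.hom_ext fun n x => ?_
  obtain ⟨q | q, rfl⟩ := Quot.exists_rep x <;> rfl

theorem map_coneMap_dCone {A B A' B' : Psh.{u} E} {f : A ⟶ B} {f' : A' ⟶ B'} (a : A ⟶ A')
    (b : B ⟶ B') (h : f ≫ b = a ≫ f') :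
    D.map (coneMap a b h) ≫ dCone f' = dCone f ≫ coneMap (D.map a) (D.map b)
      (by rw [← D.map_comp, h, D.map_comp]) :=
  hom_ext fun P => Spectrum.coneSwap_naturality _ _ _ _ _ _
    (congrArg (comp · ((Site.susp E).obj P.unop)) h)
    (congrArg (comp · ((Site.cone E).obj P.unop)) h) (comp_res a _) (comp_res b _)

/-- Under the interchange, `τ` on a cofiber is the map of cofibers induced by `τ`. This makes
`Cα/τ^k` a total cofiber. -/
theorem dCone_tau {A B : Psh.{u} E} (f : A ⟶ B) :
    dCone f ≫ coneMap (tau.app A) (tau.app B) (tau.naturality f) = tau.app (cone f) := by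
  refine hom_ext fun P => Spectrum.hom_ext fun n x => ?_
  obtain ⟨⟨s, y⟩ | y, rfl⟩ := Quot.exists_rep x
  · obtain ⟨q | q, rfl⟩ := Quot.exists_rep y
    · exact Quot.sound (.base _)
    · rfl
  · obtain ⟨q | q, rfl⟩ := Quot.exists_rep y <;> rfl

theorem dCone_conePinch_suspD {A B : Psh.{u} E} (f : A ⟶ B) :
    dCone f ≫ conePinch (D.map f) ≫ suspD A = D.map (conePinch f) :=
  hom_ext fun _ => Spectrum.coneSwap_conePinch_suspCone _ _ _

/-- An inductive step in abstract form: the equation for `t` is the induction hypothesis, and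
iterated functors match the variables by unfolding. The other lemmas ending in `_of_eq` have the
same role. -/
theorem map_dCone_of_eq {A B A' B' W : Psh.{u} E} {f : A ⟶ B} {f' : A' ⟶ B'} {a : A ⟶ A'}
    {b : B ⟶ B'} (h : f ≫ b = a ≫ f') {φ : W ⟶ cone f} {t : W ⟶ cone f'}
    (ht : t = φ ≫ coneMap a b h) (h' : D.map f ≫ D.map b = D.map a ≫ D.map f') :
    D.map t ≫ dCone f' = (D.map φ ≫ dCone f) ≫ coneMap (D.map a) (D.map b) h' := by
  rw [ht, D.map_comp, Category.assoc, map_coneMap_dCone, Category.assoc]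

theorem dCone_tau_of_eq {A B A' B' W : Psh.{u} E} {f : A ⟶ B} {f' : A' ⟶ B'} {a : A ⟶ A'}
    {b : B ⟶ B'} (h : f ≫ b = a ≫ f') {φ : W ⟶ cone f} {t : W ⟶ cone f'}
    (ht : φ ≫ coneMap a b h = t)
    (h' : D.map f ≫ D.map b ≫ tau.app B' = (D.map a ≫ tau.app A') ≫ f') :
    (D.map φ ≫ dCone f) ≫ coneMap (D.map a ≫ tau.app A') (D.map b ≫ tau.app B') h' =
      D.map t ≫ tau.app (cone f') := by
  rw [← dCone_tau f', ← Category.assoc, map_dCone_of_eq h ht.symm (by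
    rw [← D.map_comp, h, D.map_comp]), Category.assoc, Category.assoc, Category.assoc,
    coneMap_comp _ _ rfl rfl]

/-- The map `τ` from `Σ^{0,-1}` of the cofiber of `t` to the cofiber of `t` times `τ`. -/
def coneTau {N M : Psh.{u} E} (t : N ⟶ M) : D.obj (cone t) ⟶ cone (D.map t ≫ tau.app M) :=
  dCone t ≫ coneMap (𝟙 _) (tau.app M) (Category.id_comp _).symm

theorem map_coneIncl_coneTau {N M : Psh.{u} E} (t : N ⟶ M) :
    D.map (coneIncl t) ≫ coneTau t = tau.app M ≫ coneIncl (D.map t ≫ tau.app M) := by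
  rw [coneTau, ← Category.assoc, map_coneIncl_dCone]
  rfl

theorem map_coneTau_of_eq {N M A B : Psh.{u} E} {t : N ⟶ M} {i : A ⟶ B} {β : B ⟶ cone t}
    {s : A ⟶ M} (h : i ≫ β = s ≫ coneIncl t) :
    D.map i ≫ D.map β ≫ coneTau t = (D.map s ≫ tau.app M) ≫ coneIncl (D.map t ≫ tau.app M) := by
  rw [← Category.assoc, ← D.map_comp, h, D.map_comp, Category.assoc, map_coneIncl_coneTau,
    Category.assoc]

theorem coneTau_naturality_of_eq {N M N' M' A A' : Psh.{u} E} {t : N ⟶ M} {t' : N' ⟶ M'}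
    {n : N ⟶ N'} {m : M ⟶ M'} (h : t ≫ m = n ≫ t') {g : A ⟶ A'} {β : A ⟶ cone t}
    {β' : A' ⟶ cone t'} (hg : g ≫ β' = β ≫ coneMap n m h)
    (h' : (D.map t ≫ tau.app M) ≫ m = D.map n ≫ D.map t' ≫ tau.app M') :
    D.map g ≫ D.map β' ≫ coneTau t' = (D.map β ≫ coneTau t) ≫ coneMap (D.map n) m h' := by
  rw [← Category.assoc, ← D.map_comp, coneTau, coneTau, ← Category.assoc,
    map_dCone_of_eq h hg (by rw [← D.map_comp, h, D.map_comp])]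
  simp only [Category.assoc]
  rw [coneMap_comp _ _ (Category.comp_id _) (tau.naturality m),
    coneMap_comp _ _ (Category.id_comp _) rfl]
  rfl

/-- The composite of `τ` with a reduction factors through the cofiber of the identity. -/
def coneTauLift {N M W : Psh.{u} E} {t : N ⟶ M} (β : W ⟶ cone t) (l : D.obj N ⟶ D.obj M)
    (hl : D.map t = l) : D.obj W ⟶ cone (𝟙 (D.obj M)) :=
  D.map β ≫ dCone t ≫ coneMap l (𝟙 _) (by rw [hl])

/-- A multiple of `τ` is null modulo `τ`, with a strict factorisation through the cone of an
identity. The variables `l` and `τ` are separate because in the application their values agree with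
`D.map t` and `tau.app M` only after rewriting. -/
theorem coneTau_coneMap {N M W : Psh.{u} E} {t : N ⟶ M} (β : W ⟶ cone t) (l : D.obj N ⟶ D.obj M)
    (hl : D.map t = l) (τ : D.obj M ⟶ M) (hτ : τ = tau.app M)
    (h : (D.map t ≫ tau.app M) ≫ 𝟙 M = l ≫ τ) :
    (D.map β ≫ coneTau t) ≫ coneMap l (𝟙 M) h =
      coneTauLift β l hl ≫ coneMap (f' := τ) (𝟙 _) τ rfl := by
  subst hτ
  simp only [coneTau, coneTauLift, Category.assoc]
  exact congrArg (fun φ => D.map β ≫ dCone t ≫ φ)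
    ((coneMap_comp _ _ (Category.id_comp _) (Category.comp_id _)).trans
      (coneMap_comp _ _ (Category.comp_id _) (Category.id_comp _)).symm)

theorem coneIncl_coneTauLift {N M W A : Psh.{u} E} {t : N ⟶ M} (β : W ⟶ cone t)
    (l : D.obj N ⟶ D.obj M) (hl : D.map t = l) {i : A ⟶ W} {s : A ⟶ M}
    (h : i ≫ β = s ≫ coneIncl t) :
    D.map i ≫ coneTauLift β l hl = D.map s ≫ coneIncl (𝟙 (D.obj M)) := by
  rw [coneTauLift, ← Category.assoc, ← D.map_comp, h, D.map_comp, Category.assoc, ← Category.assoc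
    (D.map (coneIncl t)), map_coneIncl_dCone, coneIncl_coneMap, Category.id_comp]

/-! ### Interchanging the cofiber of `τ` with the cofiber of `α` -/

section Interchange

variable {X₁ X₀ Y₁ Y₀ C₁ : Psh.{u} E} {α₁ : X₁ ⟶ Y₁} {α₀ : X₀ ⟶ Y₀} {tX : X₁ ⟶ X₀} {tY : Y₁ ⟶ Y₀}
  (hα : α₁ ≫ tY = tX ≫ α₀) {tC : C₁ ⟶ cone α₀} {γ : C₁ ⟶ cone α₁}
  (hγ : tC ≫ 𝟙 _ = γ ≫ coneMap tX tY hα)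

/-- The interchange of the cofibers of `t` and of `α`. -/
def coneInterchange : cone tC ⟶ cone (coneMap α₁ α₀ hα.symm) :=
  coneMap γ (𝟙 _) hγ ≫ coneSwap tX tY hα

theorem coneIncl_coneInterchange :
    coneIncl tC ≫ coneInterchange hα hγ = coneMap (coneIncl tX) (coneIncl tY) rfl := by
  refine hom_ext fun P => Spectrum.hom_ext fun n x => ?_
  obtain ⟨q | q, rfl⟩ := Quot.exists_rep x <;> rfl

theorem coneMap_coneInterchange {i : Y₁ ⟶ C₁} (hi : i ≫ γ = coneIncl α₁)
    (h : tY ≫ coneIncl α₀ = i ≫ tC) :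
    coneMap i (coneIncl α₀) h ≫ coneInterchange hα hγ = coneIncl (coneMap α₁ α₀ hα.symm) := by
  rw [coneInterchange, ← Category.assoc, coneMap_comp _ _ hi (Category.comp_id _)]
  refine hom_ext fun P => Spectrum.hom_ext fun n x => ?_
  obtain ⟨q | q, rfl⟩ := Quot.exists_rep x <;> rfl

theorem coneInterchange_conePinch {Z₁ : Psh.{u} E} {σ : susp.obj X₁ ⟶ Z₁} {t : Z₁ ⟶ susp.obj X₀}
    {π : C₁ ⟶ Z₁} (hπ : γ ≫ conePinch α₁ ≫ σ = π) (h : tC ≫ conePinch α₀ = π ≫ t)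
    (hσ : susp.map tX ≫ 𝟙 _ = σ ≫ t) :
    coneInterchange hα hγ ≫ conePinch (coneMap α₁ α₀ hα.symm) ≫ suspCone tX ≫
      coneMap σ (𝟙 _) hσ = coneMap π (conePinch α₀) h := by
  have e := coneSwap_conePinch_suspCone tX tY hα
  rw [coneInterchange, Category.assoc, ← Category.assoc (conePinch _), ← Category.assoc
    (coneSwap _ _ _), e, coneMap_comp _ _ rfl (Category.comp_id _),
    coneMap_comp _ _ hπ (Category.id_comp _)]

/-- Naturality of the interchange between the quotients by `τ^k` and by `τ`. It supplies the
hypothesis `he` of `Spectrum.exists_lift_with_image`. -/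
theorem coneMap_coneInterchange_conePinch {Xₖ Yₖ Cₖ : Psh.{u} E} {αₖ : Xₖ ⟶ Yₖ} {lX : Xₖ ⟶ X₁}
    {lY : Yₖ ⟶ Y₁} (hl : αₖ ≫ lY = lX ≫ α₁) {d : Cₖ ⟶ cone αₖ} {lC : Cₖ ⟶ C₁}
    (hd : lC ≫ γ = d ≫ coneMap lX lY hl) {sY : Yₖ ⟶ Y₀} (hY : sY = lY ≫ tY)
    (hs : αₖ ≫ sY = (lX ≫ tX) ≫ α₀) (hC : (lC ≫ tC) ≫ 𝟙 _ = d ≫ coneMap (lX ≫ tX) sY hs) :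
    coneMap (f := lC ≫ tC) (f' := tC) lC (𝟙 _) (Category.comp_id _) ≫
        coneInterchange hα hγ ≫ conePinch (coneMap α₁ α₀ hα.symm) =
      coneMap (f' := coneMap (lX ≫ tX) sY hs) d (𝟙 _) hC ≫ coneSwap (lX ≫ tX) sY hs ≫
        conePinch (coneMap αₖ α₀ hs.symm) ≫
          susp.map (coneMap (f' := tX) lX (𝟙 X₀) (Category.comp_id _)) := by
  subst hY
  have e := coneSwap_naturality hs hα lX lY (𝟙 X₀) (𝟙 Y₀) hl
    ((Category.comp_id _).trans (Category.id_comp _).symm) (Category.comp_id _)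
    (Category.comp_id _)
  have h₁ := coneMap_conePinch (f := coneMap αₖ α₀ hs.symm) (f' := coneMap α₁ α₀ hα.symm)
    (coneMap (f := lX ≫ tX) (f' := tX) lX (𝟙 X₀) (Category.comp_id _))
    (coneMap (f := lY ≫ tY) (f' := tY) lY (𝟙 Y₀) (Category.comp_id _))
    ((coneMap_comp hs.symm _ hl ((Category.comp_id _).trans (Category.id_comp _).symm)).trans
      (coneMap_comp (f' := tX) (Category.comp_id _) hα.symm rfl rfl).symm)
  rw [← h₁, ← Category.assoc (coneSwap _ _ _), ← e, coneInterchange]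
  simp only [Category.assoc]
  refine (Category.assoc _ _ _).symm.trans (Eq.trans (congrArg (· ≫ _) ?_) (Category.assoc _ _ _))
  exact (coneMap_comp _ hγ hd (by rw [coneMap_id])).trans (coneMap_comp hC _ rfl rfl).symm

end Interchange

/-! ## Powers of `τ` -/

/-- The interchange `Dᵏ(cone f) → cone (Dᵏf)`. -/
def dConePow {A B : Psh.{u} E} (f : A ⟶ B) :
    ∀ k : ℕ, (Dpow k).obj (cone f) ⟶ cone ((Dpow k).map f)
  | 0 => 𝟙 _
  | k + 1 => D.map (dConePow f k) ≫ dCone ((Dpow k).map f)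

theorem map_coneIncl_dConePow {A B : Psh.{u} E} (f : A ⟶ B) (k : ℕ) :
    (Dpow k).map (coneIncl f) ≫ dConePow f k = coneIncl ((Dpow k).map f) := by
  induction k with
  | zero => rfl
  | succ k ih =>
    change D.map ((Dpow k).map (coneIncl f)) ≫ D.map (dConePow f k) ≫ dCone _ = _
    rw [← Category.assoc, ← D.map_comp, ih, map_coneIncl_dCone]
    rfl

theorem map_coneMap_dConePow {A B A' B' : Psh.{u} E} {f : A ⟶ B} {f' : A' ⟶ B'} (a : A ⟶ A')
    (b : B ⟶ B') (h : f ≫ b = a ≫ f') (k : ℕ) :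
    (Dpow k).map (coneMap a b h) ≫ dConePow f' k = dConePow f k ≫
      coneMap ((Dpow k).map a) ((Dpow k).map b)
        (by rw [← Functor.map_comp, h, Functor.map_comp]) := by
  induction k with
  | zero => rfl
  | succ k ih =>
    refine (Category.assoc _ _ _).symm.trans (Eq.trans ?_ (map_dCone_of_eq _ ih _))
    exact congrArg (· ≫ dCone _) (D.map_comp _ _).symm

theorem dConePow_tauPow {A B : Psh.{u} E} (f : A ⟶ B) (k : ℕ) :
    dConePow f k ≫ coneMap ((tauPow k).app A) ((tauPow k).app B) ((tauPow k).naturality f) =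
      (tauPow k).app (cone f) := by
  induction k with
  | zero => exact coneMap_id f ((Category.comp_id f).trans (Category.id_comp f).symm)
  | succ k ih => exact dCone_tau_of_eq _ ih _

theorem map_tauPow_dCone {A B : Psh.{u} E} (f : A ⟶ B) (q : ℕ) :
    D.map ((tauPow q).app (cone f)) ≫ dCone f = dConePow f (q + 1) ≫
      coneMap (f := (Dpow (q + 1)).map f) (f' := D.map f) (D.map ((tauPow q).app A))
        (D.map ((tauPow q).app B))
        (by exact (D.map_comp _ _).symm.trans ((D.congr_map ((tauPow q).naturality f)).trans
          (D.map_comp _ _))) :=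
  map_dCone_of_eq _ (dConePow_tauPow f q).symm _

theorem tauPow_one_app (X : Psh.{u} E) : (tauPow 1).app X = tau.app X := by
  change D.map (𝟙 X) ≫ tau.app X = _
  rw [D.map_id]
  exact Category.id_comp (tau.app X)

theorem map_tauPow_tauPow_one (X : Psh.{u} E) (q : ℕ) :
    D.map ((tauPow q).app X) ≫ (tauPow 1).app X = (tauPow (q + 1)).app X :=
  congrArg (D.map ((tauPow q).app X) ≫ ·) (tauPow_one_app X)

theorem eqToHom_tauStep {m n : ℕ} (h : m = n) (X : Psh.{u} E) :
    eqToHom (by rw [h]) ≫ (tauStep n).app X =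
      (tauStep m).app X ≫ eqToHom (by rw [h] : (Dpow m).obj X = (Dpow n).obj X) := by
  subst h
  simp

/-- The map `τⁿ` on `Σ^{0,-1}` factors through `Σ^{0,-(j+1)}`. -/
theorem map_tauPow_eq (j i n : ℕ) (h : n + 1 = j + 1 + i) (X : Psh.{u} E) :
    D.map ((tauPow n).app X) = eqToHom (by rw [h] : (Dpow (n + 1)).obj X = _) ≫
      (tauFrom (j + 1) i).app X ≫ D.map ((tauPow j).app X) := by
  induction i generalizing n with
  | zero =>
    obtain rfl : n = j := by omega
    refine Eq.trans ?_ (Category.id_comp _).symm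
    exact (Category.id_comp _).symm
  | succ i ih =>
    obtain ⟨n, rfl⟩ : ∃ m, n = m + 1 := ⟨n - 1, by omega⟩
    have hn : n + 1 = j + 1 + i := by omega
    rw [← tauStep_tauPow, D.map_comp, ih n hn]
    change (tauStep (n + 1)).app X ≫ _ = _ ≫ ((tauStep (j + 1 + i)).app X ≫ _) ≫ _
    rw [← Category.assoc, ← eqToHom_tauStep hn, Category.assoc]
    exact congrArg (_ ≫ ·) (Category.assoc _ _ _).symm

theorem map_tauPow_eq_tauFrom_one (k n : ℕ) (h : n + 1 = 1 + k) (X : Psh.{u} E) :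
    D.map ((tauPow n).app X) = eqToHom (by rw [h] : (Dpow (n + 1)).obj X = _) ≫
      (tauFrom 1 k).app X := by
  refine (map_tauPow_eq 0 k n h X).trans (congrArg (_ ≫ ·) ?_)
  exact (congrArg (_ ≫ ·) (D.map_id X)).trans (Category.comp_id _)

/-! ## Quotients by powers of `τ` -/

theorem toQuot_quotTauPow (X : Psh.{u} E) (n k : ℕ) :
    (Dpow k).map (toQuot X n) ≫ quotTauPow X n k = (tauPow k).app X ≫ toQuot X (n + k) := by
  induction k with
  | zero => rfl
  | succ k ih => exact map_coneTau_of_eq ih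

theorem quotTauPow_naturality {X Y : Psh.{u} E} (f : X ⟶ Y) (n k : ℕ) :
    (Dpow k).map (quotMap f n) ≫ quotTauPow Y n k = quotTauPow X n k ≫ quotMap f (n + k) := by
  induction k with
  | zero => exact (Category.comp_id _).trans (Category.id_comp _).symm
  | succ k ih => exact coneTau_naturality_of_eq _ ih _

theorem map_tauPow_one_add (X : Psh.{u} E) (k : ℕ) :
    D.map ((tauPow (1 + k)).app X) = (tauFrom 1 (k + 1)).app X :=
  (map_tauPow_eq_tauFrom_one (k + 1) (1 + k) rfl X).trans (Category.id_comp _)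

/-- The map `Σ^{0,-(k+1)}(X/τ) → X/τ` factors through the cofiber of the identity. -/
def quotTauPowLift (X : Psh.{u} E) (k : ℕ) :
    (Dpow (k + 1)).obj (quot X 1) ⟶ cone (𝟙 ((Dpow 1).obj X)) :=
  coneTauLift (quotTauPow X 1 k) ((tauFrom 1 (k + 1)).app X) (map_tauPow_one_add X k)

/-- Supplies the factorisation `hp` of the geometric core: the composite of `τ^{k+1}` with reduction
modulo `τ` is null in a strict way. -/
theorem quotTauPow_red (X : Psh.{u} E) (k : ℕ) :
    quotTauPow X 1 (k + 1) ≫ red X 1 (k + 1) = quotTauPowLift X k ≫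
      coneMap (f' := (tauPow 1).app X) (𝟙 _) ((tauPow 1).app X) rfl :=
  coneTau_coneMap _ _ _ _ (tauPow_one_app X) _

theorem toQuot_quotTauPowLift (X : Psh.{u} E) (k : ℕ) :
    (Dpow (k + 1)).map (toQuot X 1) ≫ quotTauPowLift X k =
      D.map ((tauPow k).app X) ≫ coneIncl (𝟙 ((Dpow 1).obj X)) :=
  coneIncl_coneTauLift _ _ _ (toQuot_quotTauPow X 1 k)

theorem tauPow_one_dCone {X Y : Psh.{u} E} (α : X ⟶ Y) :
    (tauPow 1).app (cone α) ≫ 𝟙 _ = dCone α ≫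
      coneMap ((tauPow 1).app X) ((tauPow 1).app Y) ((tauPow 1).naturality α) := by
  refine (Category.comp_id _).trans ((dConePow_tauPow α 1).symm.trans ?_)
  change (D.map (𝟙 _) ≫ dCone α) ≫ _ = _
  rw [D.map_id]
  exact congrArg (· ≫ _) (Category.id_comp _)

/-- The interchange of the cofibers of `τ` and of `α`. -/
def quotCone {X Y : Psh.{u} E} (α : X ⟶ Y) : quot (cone α) 1 ⟶ cone (quotMap α 1) :=
  coneInterchange _ (tauPow_one_dCone α)

theorem toQuot_quotCone {X Y : Psh.{u} E} (α : X ⟶ Y) :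
    toQuot (cone α) 1 ≫ quotCone α = coneMap (f' := quotMap α 1) (toQuot X 1) (toQuot Y 1) rfl :=
  coneIncl_coneInterchange _ _

theorem quotMap_coneIncl_quotCone {X Y : Psh.{u} E} (α : X ⟶ Y) :
    quotMap (coneIncl α) 1 ≫ quotCone α = coneIncl (quotMap α 1) :=
  coneMap_coneInterchange _ _ (map_coneIncl_dCone α) _

/-- Taking the quotient by `τ` and then the boundary of `α` agrees with the opposite order, so the
hypothesis `δ_α x̄ = x` can be read in the total cofiber. -/
theorem quotCone_conePinch_suspQuot {X Y : Psh.{u} E} (α : X ⟶ Y) :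
    quotCone α ≫ conePinch (quotMap α 1) ≫ suspQuot X = quotMap (conePinch α) 1 :=
  coneInterchange_conePinch _ _ (dCone_conePinch_suspD α) _ _

end Psh

/-- Both interchanges involved have the inverse `coneSusp`, which gives an explicit left inverse.
The value of `suspQuot X` has this form, with `p` the restriction whose cone is the value of `DX`.
-/
theorem Spectrum.suspCone_coneMap_injective {U V B : Spectrum.{u}} (p : U ⟶ V) (t : cone p ⟶ B)
    (T : cone (susp.map p) ⟶ susp.obj B) (h : susp.map t ≫ 𝟙 _ = suspCone p ≫ T)
    (F : Spectrum.{u} ⥤ AddCommGrpCat.{u}) :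
    Function.Injective (F.map (suspCone t ≫ coneMap (f' := T) (suspCone p) (𝟙 _) h)) := by
  have h' : T ≫ 𝟙 _ = coneSusp p ≫ susp.map t := by
    rw [Category.comp_id] at h ⊢
    rw [h, ← Category.assoc, coneSusp_suspCone, Category.id_comp]
  have hr : (suspCone t ≫ coneMap (f' := T) (suspCone p) (𝟙 _) h) ≫
      coneMap (coneSusp p) (𝟙 _) h' ≫ coneSusp t = 𝟙 _ := by
    rw [Category.assoc, ← Category.assoc (coneMap _ _ _), ← coneMap_comp h h'
      ((Category.comp_id _).trans (Category.id_comp _).symm) (suspCone_coneSusp p).symm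
      (Category.comp_id _).symm, coneMap_id _ rfl rfl, Category.id_comp, suspCone_coneSusp]
  intro x y hxy
  have e := congrArg (F.map (coneMap (coneSusp p) (𝟙 _) h' ≫ coneSusp t)) hxy
  rwa [← map_comp_apply, ← map_comp_apply, hr, map_id_apply, map_id_apply] at e

theorem map_sub_of_map_eq_zero {G H : AddCommGrpCat.{u}} (f : G ⟶ H) (w : G) {v : G}
    (hv : f v = 0) : f (w - v) = f w := by
  rw [map_sub, hv, sub_zero]

theorem neg_sub_sub_self {G : Type*} [AddCommGroup G] (g h : G) : -h - (g - h) = -g := by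
  abel

/-! ### The core argument in bigraded homotopy groups -/

namespace Psh

variable {E : RingSpectrum}

/-- The map `Σ(X/τ) → (ΣX)/τ` is injective on homotopy groups. -/
theorem suspQuot_injective (X : Psh.{u} E) (P : Site E) (j : ℤ) :
    Function.Injective ((Spectrum.π j).map (comp (suspQuot X) P)) := by
  refine Spectrum.suspCone_coneMap_injective (res X (Site.pinch E P))
    (comp ((tauPow 1).app X) P) (comp ((tauPow 1).app (susp.obj X)) P) ?_ (Spectrum.π j)
  have h := suspD_tau X
  rw [← tauPow_one_app, ← tauPow_one_app] at h
  exact (Category.comp_id _).trans (congrArg (comp · P) h).symm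

theorem toQuot_naturality {X Y : Psh.{u} E} (f : X ⟶ Y) (n k : ℕ) :
    (Dpow k).map f ≫ (Dpow k).map (toQuot Y n) =
      (Dpow k).map (toQuot X n) ≫ (Dpow k).map (quotMap f n) := by
  rw [← Functor.map_comp, ← Functor.map_comp]
  rfl

theorem toQuot_quotCone_dConePow {X Y : Psh.{u} E} (α : X ⟶ Y) (k : ℕ) :
    (Dpow k).map (toQuot (cone α) 1) ≫ (Dpow k).map (quotCone α) ≫ dConePow (quotMap α 1) k =
      dConePow α k ≫ coneMap ((Dpow k).map (toQuot X 1)) ((Dpow k).map (toQuot Y 1))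
        (toQuot_naturality α 1 k) := by
  rw [← Category.assoc, ← Functor.map_comp, toQuot_quotCone]
  exact map_coneMap_dConePow _ _ _ _

theorem quotMap_coneIncl_quotCone_dConePow {X Y : Psh.{u} E} (α : X ⟶ Y) (k : ℕ) :
    (Dpow k).map (quotMap (coneIncl α) 1) ≫ (Dpow k).map (quotCone α) ≫
      dConePow (quotMap α 1) k = coneIncl ((Dpow k).map (quotMap α 1)) := by
  rw [← Category.assoc, ← Functor.map_comp, quotMap_coneIncl_quotCone, map_coneIncl_dConePow]

theorem exists_lift_with_image {X Y : Psh.{u} E} (α : X ⟶ Y) (q : ℕ) (P : Site E) (j : ℤ)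
    (x : (Spectrum.π j).obj (val (quot X 1) P))
    (y : (Spectrum.π j).obj (val ((Dpow (q + 1)).obj (quot Y 1)) P))
    (x' : (Spectrum.π (j + 1)).obj (val (quot (cone α) 1) P))
    (w : (Spectrum.π (j + 1)).obj (val (susp.obj ((Dpow (q + 1)).obj (cone α))) P))
    (hx : (Spectrum.π (j + 1)).map (comp (quotMap (conePinch α) 1) P) x' =
      (Spectrum.π (j + 1)).map (comp (suspQuot X) P) (Spectrum.suspHom _ j x))
    (hw : (Spectrum.π (j + 1)).map (comp (quotDelta (cone α) 1) P) x' =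
      (Spectrum.π (j + 1)).map (comp (susp.map (D.map ((tauPow q).app (cone α)))) P) w)
    (hy : (Spectrum.π (j + 1)).map
        (comp (susp.map ((Dpow (q + 1)).map (toQuot (cone α) 1))) P) w =
      -(Spectrum.π (j + 1)).map
        (comp (susp.map ((Dpow (q + 1)).map (quotMap (coneIncl α) 1))) P)
        (Spectrum.suspHom _ j y)) :
    ∃ z : (Spectrum.π j).obj (val (quot X (1 + (q + 1))) P),
      (Spectrum.π j).map (comp (red X 1 (q + 1)) P) z = x ∧
      (Spectrum.π j).map (comp (quotMap α (1 + (q + 1))) P) z =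
        (Spectrum.π j).map (comp (quotTauPow Y 1 (q + 1)) P) y := by
  have hX := map_tauPow_tauPow_one X q
  have hY := map_tauPow_tauPow_one Y q
  have hC := map_tauPow_tauPow_one (cone α) q
  have hs : (Dpow (q + 1)).map α ≫ (tauPow (q + 1)).app Y =
      (D.map ((tauPow q).app X) ≫ (tauPow 1).app X) ≫ α := by
    rw [hX]
    exact (tauPow (q + 1)).naturality α
  have hd : D.map ((tauPow q).app (cone α)) ≫ (tauPow 1).app (cone α) = dConePow α (q + 1) ≫
      coneMap (D.map ((tauPow q).app X) ≫ (tauPow 1).app X) ((tauPow (q + 1)).app Y) hs := by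
    rw [hC, ← dConePow_tauPow]
    congr 2
    exact hX.symm
  have he := coneMap_coneInterchange_conePinch ((tauPow 1).naturality α) (tauPow_one_dCone α) _
    (map_tauPow_dCone α q) hY.symm hs ((Category.comp_id _).trans hd)
  refine Spectrum.exists_lift_with_image (congrArg (comp · P) hs) (comp (dConePow α (q + 1)) P)
    (tC := comp ((tauPow 1).app (cone α)) P) (lC := comp (D.map ((tauPow q).app (cone α))) P)
    (congrArg (comp · P) hd) (a := comp (quotTauPow X 1 (q + 1)) P)
    (congrArg (comp · P) (quotTauPow_naturality α 1 (q + 1)))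
    (iX := comp ((Dpow (q + 1)).map (toQuot X 1)) P)
    (iY := comp ((Dpow (q + 1)).map (toQuot Y 1)) P)
    (congrArg (comp · P) (toQuot_naturality α 1 (q + 1)))
    (rX := comp (toQuot X (1 + (q + 1))) P) (rY := comp (toQuot Y (1 + (q + 1))) P) rfl
    ?_ ?_ (p := comp (quotTauPowLift X q) P)
    (congrArg (comp · P) (quotTauPow_red X q)) (congrArg (comp · P) (toQuot_quotTauPowLift X q)) rfl
    (m := comp ((Dpow (q + 1)).map (quotCone α) ≫ dConePow (quotMap α 1) (q + 1)) P)
    (congrArg (comp · P) (toQuot_quotCone_dConePow α (q + 1)))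
    (congrArg (comp · P) (quotMap_coneIncl_quotCone_dConePow α (q + 1)))
    (e := comp (quotCone α ≫ conePinch (quotMap α 1)) P)
    (congrArg (comp · P) he) x y x' w ?_ hw hy
  · refine congrArg (comp · P) ((congrArg (· ≫ toQuot X (1 + (q + 1))) hX).trans
      (toQuot_quotTauPow X 1 (q + 1)).symm)
  · exact congrArg (comp · P) (toQuot_quotTauPow Y 1 (q + 1)).symm
  -- The hypothesis compares classes in `(ΣX)/τ`, while the core needs the equality in `Σ(X/τ)`;
  -- injectivity of the comparison allows it to be cancelled.
  · refine suspQuot_injective X P (j + 1) (Eq.trans ?_ hx)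
    rw [← quotCone_conePinch_suspQuot, ← Category.assoc]
    exact (Spectrum.map_comp_apply _ _ _ _).symm

theorem pi_map_comp_apply {X Y Z : Psh.{u} E} {a b : ℤ} (f : X ⟶ Y) (g : Y ⟶ Z)
    (x : (pi a b).obj X) : (pi a b).map (f ≫ g) x = (pi a b).map g ((pi a b).map f x) := by
  rw [(pi a b).map_comp]
  rfl

/-- A class of `X/τ` which lifts to `X/τ^{k+1}` survives to the `E_{k+2}` page. -/
theorem survives_of_lift {X : Psh.{u} E} {a b : ℤ} (k : ℕ) (z : (pi a b).obj (quot X (1 + k))) :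
    Survives (k + 2) ((pi a b).map (red X 1 k) z) := by
  let e : (Dpow (1 + k)).obj X ⟶ (Dpow (k + 1)).obj X := eqToHom (by rw [Nat.add_comm])
  have h : (tauFrom 1 k).app X = e ≫ D.map ((tauPow k).app X) := by
    rw [map_tauPow_eq_tauFrom_one k k (Nat.add_comm k 1) X]
    exact ((eqToHom_trans_assoc _ _ _).trans (Category.id_comp _)).symm
  -- The boundary of the lift, reindexed from `1 + k` to `k + 1`, is the class `w` required by the
  -- definition of `d_{k+2}`.
  refine ⟨-(pi a b).map (susp.map ((Dpow (k + 1)).map (toQuot X 1))) _,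
    (pi a b).map (quotDelta X (1 + k) ≫ susp.map e) z, ?_, (neg_neg _).symm⟩
  refine (pi_map_comp_apply _ _ _).symm.trans (Eq.trans ?_ (pi_map_comp_apply _ _ _))
  refine congrArg (fun φ => (pi a b).map φ z) ?_
  refine (coneMap_conePinch _ _ _).trans (Eq.trans ?_ (Category.assoc _ _ _).symm)
  refine congrArg (_ ≫ ·) ((congrArg susp.map h).trans (susp.map_comp _ _))

theorem exists_lift_of_suspIso {X Y : Psh.{u} E} (α : X ⟶ Y) (q : ℕ) (a b : ℤ)
    (x : (pi a b).obj (quot X 1)) (y : (pi a b).obj ((Dpow (q + 1)).obj (quot Y 1)))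
    (x' : (pi (a + 1) (b - 1)).obj (quot (cone α) 1))
    (w : (pi (a + 1) (b - 1)).obj (susp.obj ((Dpow (q + 1)).obj (cone α))))
    (hx : (pi (a + 1) (b - 1)).map (quotMap (conePinch α) 1) x' =
      (pi (a + 1) (b - 1)).map (suspQuot X) (suspIso _ a b x))
    (hw : (pi (a + 1) (b - 1)).map (quotDelta (cone α) 1) x' =
      (pi (a + 1) (b - 1)).map (susp.map (D.map ((tauPow q).app (cone α)))) w)
    (hy : (pi (a + 1) (b - 1)).map (susp.map ((Dpow (q + 1)).map (toQuot (cone α) 1))) w =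
      -(pi (a + 1) (b - 1)).map (susp.map ((Dpow (q + 1)).map (quotMap (coneIncl α) 1)))
        (suspIso _ a b y)) :
    ∃ z : (pi a b).obj (quot X (1 + (q + 1))), (pi a b).map (red X 1 (q + 1)) z = x ∧
      (pi a b).map (quotMap α (1 + (q + 1))) z = (pi a b).map (quotTauPow Y 1 (q + 1)) y := by
  -- The indices `a + 1 + (b - 1)` and `-(b - 1)` become free variables, so that substituting the
  -- equalities removes the `eqToHom` in `suspIso`.
  have key (c j c' j' : ℤ) (hc : c' = c) (hj : j' = j + 1)
      (x : (Spectrum.π j).obj (val (quot X 1) (Site.sphere E c)))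
      (y : (Spectrum.π j).obj (val ((Dpow (q + 1)).obj (quot Y 1)) (Site.sphere E c)))
      (x' : (Spectrum.π j').obj (val (quot (cone α) 1) (Site.sphere E c')))
      (w : (Spectrum.π j').obj (val (susp.obj ((Dpow (q + 1)).obj (cone α))) (Site.sphere E c')))
      (hx : (Spectrum.π j').map (comp (quotMap (conePinch α) 1) (Site.sphere E c')) x' =
        (Spectrum.π j').map (comp (suspQuot X) (Site.sphere E c'))
          ((eqToHom (by rw [hc, hj]; rfl) : (Spectrum.π (j + 1)).obj
              (Spectrum.susp.obj (val (quot X 1) (Site.sphere E c))) ⟶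
            (Spectrum.π j').obj (val (susp.obj (quot X 1)) (Site.sphere E c')))
          (Spectrum.suspHom _ j x)))
      (hw : (Spectrum.π j').map (comp (quotDelta (cone α) 1) (Site.sphere E c')) x' =
        (Spectrum.π j').map
          (comp (susp.map (D.map ((tauPow q).app (cone α)))) (Site.sphere E c')) w)
      (hy : (Spectrum.π j').map
          (comp (susp.map ((Dpow (q + 1)).map (toQuot (cone α) 1))) (Site.sphere E c')) w =
        -(Spectrum.π j').map
          (comp (susp.map ((Dpow (q + 1)).map (quotMap (coneIncl α) 1))) (Site.sphere E c'))
          ((eqToHom (by rw [hc, hj]; rfl) : (Spectrum.π (j + 1)).obj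
              (Spectrum.susp.obj (val ((Dpow (q + 1)).obj (quot Y 1)) (Site.sphere E c))) ⟶
            (Spectrum.π j').obj
              (val (susp.obj ((Dpow (q + 1)).obj (quot Y 1))) (Site.sphere E c')))
          (Spectrum.suspHom _ j y))) :
      ∃ z : (Spectrum.π j).obj (val (quot X (1 + (q + 1))) (Site.sphere E c)),
        (Spectrum.π j).map (comp (red X 1 (q + 1)) (Site.sphere E c)) z = x ∧
        (Spectrum.π j).map (comp (quotMap α (1 + (q + 1))) (Site.sphere E c)) z =
          (Spectrum.π j).map (comp (quotTauPow Y 1 (q + 1)) (Site.sphere E c)) y := by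
    subst hc hj
    exact exists_lift_with_image α q _ j x y x' w hx hw hy
  exact key (a + b) (-b) (a + 1 + (b - 1)) (-(b - 1)) (by ring) (by ring) x y x' w hx hw hy

/-- An element annihilated by the power of `τ` defining equality on the `E_r` page is annihilated by
the corresponding power of `τ` on `Σ^{0,-1}`. -/
theorem map_tauPow_eq_zero {X : Psh.{u} E} {a b : ℤ} {q j : ℕ} (h : q + 1 = j + (q + 1 - 2))
    {v : (pi a b).obj (susp.obj ((Dpow (q + 1)).obj X))}
    (hv : (pi a b).map (susp.map (eqToHom (by rw [← h]) ≫ (tauFrom j (q + 1 - 2)).app X)) v = 0) :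
    (pi a b).map (susp.map (D.map ((tauPow q).app X))) v = 0 := by
  -- Truncated subtraction makes `j = 2` for `q ≥ 1` and `j = 1` for `q = 0`. In both cases `j` is
  -- positive, so `τ^q` on `Σ^{0,-1}` factors through the power of `τ` that kills `v`.
  obtain ⟨j, rfl⟩ : ∃ i, j = i + 1 := ⟨j - 1, by omega⟩
  rw [map_tauPow_eq j _ q h]
  refine (congrArg (fun φ => (pi a b).map (susp.map φ) v) (Category.assoc _ _ _).symm).trans ?_
  refine (congrArg (fun φ => (pi a b).map φ v) (susp.map_comp _ _)).trans ?_
  exact (pi_map_comp_apply _ _ _).trans ((congrArg _ hv).trans (map_zero _))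

end Psh

end Synth

end

/-! ### Conclusion -/

open Synth
theorem mainTheorem7 (E : RingSpectrum) (X Y : Syn.{u} E) (α : X ⟶ Y) (k : ℕ) (hk : 1 ≤ k)
    (a b : ℤ) (x : (Psh.pi a b).obj (Psh.quot X.obj 1))
    (hx : Psh.IsDifferential (k + 1) x 0)
    (xbar : (Psh.pi (a + 1) (b - 1)).obj (Psh.quot (Psh.cone α.hom) 1))
    (hδ : (Psh.pi (a + 1) (b - 1)).map (Psh.quotMap (Psh.conePinch α.hom) 1) xbar =
      (Psh.pi (a + 1) (b - 1)).map (Psh.suspQuot X.obj) (Psh.suspIso (Psh.quot X.obj 1) a b x))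
    (y : (Psh.pi a b).obj ((Psh.Dpow k).obj (Psh.quot Y.obj 1)))
    (hy : ∃ z, Psh.IsDifferential (k + 1) xbar z ∧
      Psh.EqOnPage k k ((Psh.pi (a + 1) (b - 1)).map
        (Psh.susp.map ((Psh.Dpow k).map (Psh.quotMap (Psh.coneIncl α.hom) 1)))
        (Psh.suspIso _ a b y)) z) :
    Psh.HiddenExtension α.hom k (k + 2) x y := by
  obtain ⟨q, rfl⟩ : ∃ q, k = q + 1 := ⟨k - 1, by omega⟩
  obtain ⟨z, ⟨w, hw, hwz⟩, j, hj, v, hv, hvz⟩ := hy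
  -- Subtracting `v` keeps the boundary equation, since `τ^q v = 0`, and corrects the reduction: `-z
  -- - (ι y - z) = -ι y`.
  obtain ⟨x', hx', hxy⟩ := Psh.exists_lift_of_suspIso α.hom q a b x y xbar (w - v) hδ
    (hw.trans (map_sub_of_map_eq_zero _ w (Psh.map_tauPow_eq_zero hj hv)).symm)
    (((map_sub _ _ _).trans (congrArg₂ (· - ·) hwz hvz.symm)).trans (neg_sub_sub_self _ _))
  have hred (Z : Psh.{u} E) : Psh.red Z 1 0 = 𝟙 _ := Psh.coneMap_id _ _
  -- On the `E_{k+2}` page a jump by `k` leaves `y` to be lifted to `Y/τ^{(k+1)-k} = Y/τ`, so `i =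
  -- 0` and `y` is its own lift.
  refine ⟨0, by omega, ?_, x', y, ?_, ?_, hxy⟩
  · rw [← hx']
    exact Psh.survives_of_lift (q + 1) x'
  · rw [hred]
    exact (congrArg (fun φ => (Psh.pi a b).map φ x') (Category.comp_id _)).trans hx'
  · rw [hred, CategoryTheory.Functor.map_id, CategoryTheory.Functor.map_id]
    rfl
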